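/- Let $1\le m$ and $n$ be integers. A closed manifold is a compact Hausdorff manifold without boundary; $B_r(x)$ is the open ball in $\mathbb{R}^n$, and volume on subsets of $\mathbb{R}^n$ is the ($m$-dimensional, Lebesgue-normalized) Hausdorff measure. **The class $\mathcal{M}(k,\varepsilon_0,b,V)$.** For $\varepsilon_0,b,V>0$ and an integer $k\ge 3$, let $\mathcal{M}(k,\varepsilon_0,b,V)$ be the set of all $M'\subset\mathbb{R}^n$ of volume at most $V$ for which there are a closed $m$-dimensional $C^k$ manifold $N$ and a $C^k$ immersion $g\colon N\to\mathbb{R}^n$ with $g(N)=M'$ such that for every $x\in M'$: (1) $g^{-1}(B_{\varepsilon_0}(x))$ is a disjoint union of finitely many sets $W_1,\dots,W_\ell$; (2) each $W_i$ is open in $N$ and $C^k$-diffeomorphic to an open $m$-ball; (3) $g|_{W_i}$ is a $C^k$-diffeomorphism onto $W_i'=g(W_i)$; (4) whenever $x\in W_i'$, the set $W_i'$ is the graph (with origin $x$) of a $C^k$ function $h_i\colon U_i\to (T_xW_i')^\perp$ on an open set $U_i\subset T_xW_i'$, with $|\partial^\mu h_i|\le b$ on $U_i$ for every choice of orthonormal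 axes of $T_xW_i'$ and every multi-index $\mu$ with $0\le|\mu|\le k$. **The energy.** For $F\colon(0,\infty)\to\mathbb{R}$, Hadamard's finite part of $F$ at $0^+$ is the number $c$, if it exists, such that $F(\varepsilon)=\sum_{p\in S}a_p\,\varepsilon^{-p}+d\log\varepsilon+c+o(1)$ as $\varepsilon\to0^+$ with a finite set $S\subset(0,\infty)$ and real $a_p,d$. For a closed $m$-dimensional submanifold $M\subset\mathbb{R}^n$, $\mathrm{Pf.}\int_M|x-y|^\alpha\,dy$ is the finite part of $\varepsilon\mapsto\int_{M\setminus B_\varepsilon(x)}|x-y|^\alpha\,dy$, and $$E_\alpha(M)=\int_M\Big(\mathrm{Pf.}\int_M|x-y|^\alpha\,dy\Big)dx .$$ **Theorem.** Let $\varepsilon_0,b,V>0$, let $\alpha\le-2m$ be real, and put $\overline\alpha=\max\{\lfloor-\alpha\rfloor-m,0\}$. For every $C>0$ there is $\delta>0$ such that the following holds. Let $M\in\mathcal{M}(\overline\alpha+3,\varepsilon_0,b,V)$ be a closed $m$-dimensional submanifold embedded in $\mathbb{R}^n$ of class $C^{\overline\alpha+3}$, and suppose: 1. There are a $C^{\overline\alpha+3}$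 immersion $f\colon M\to\mathbb{R}^n$ whose image $M'=f(M)$ belongs to $\mathcal{M}(\overline\alpha+3,\varepsilon_0,b,V)$ and which satisfies $|f(x)-x|<\delta$ for all $x\in M$, and a double point $x'$ of it, i.e. $x'=f(x_1)=f(x_2)$ for some $x_1\ne x_2$ in $M$. 2. $f^{-1}(B_{\varepsilon_0}(x'))$ is a disjoint union of open sets $W_1,\dots,W_l$ ($2\le l<\infty$), each $C^{\overline\alpha+3}$-diffeomorphic to an open $m$-ball, such that each $f|_{W_i}$ is a $C^{\overline\alpha+3}$ embedding. Then $E_\alpha(M)$ is well defined (the integrals and finite parts exist) and $E_\alpha(M)>C$. -/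

import Mathlib

open MeasureTheory Filter Topology Metric
open scoped Manifold ContDiff

namespace RieszRepulsion

noncomputable section

/-- `ℝᵈ` with its Euclidean norm. -/
abbrev Euc (d : ℕ) : Type := EuclideanSpace ℝ (Fin d)

/-! ### Hadamard's finite part and the regularized Riesz energy -/

/-- `c` is the constant term of the expansion of `F ε` as `ε → 0+` in finitely many negative
(possibly non-integral) powers of `ε`, a multiple of `log ε`, a constant, and a vanishing rest. -/
def HasFinitePart (F : ℝ → ℝ) (c : ℝ) : Prop :=
  ∃ (S : Finset ℝ) (a : ℝ → ℝ) (d : ℝ), (∀ p ∈ S, 0 < p) ∧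
    Tendsto (fun ε : ℝ => F ε - (∑ p ∈ S, a p * ε ^ (-p) + d * Real.log ε)) (𝓝[>] 0) (𝓝 c)

theorem tendsto_two_mul : Tendsto (fun ε : ℝ => 2 * ε) (𝓝[>] 0) (𝓝[>] 0) := by
  refine tendsto_nhdsWithin_iff.2 ⟨?_, ?_⟩
  · have h : Tendsto (fun ε : ℝ => 2 * ε) (𝓝 0) (𝓝 (2 * 0)) := tendsto_id.const_mul 2
    rw [mul_zero] at h
    exact h.mono_left nhdsWithin_le_nhds
  · filter_upwards [self_mem_nhdsWithin] with ε hε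
    have : (0 : ℝ) < ε := hε
    show (0 : ℝ) < 2 * ε
    linarith

theorem finitePart_aux (S : Finset ℝ) : ∀ (a : ℝ → ℝ) (d c : ℝ), (∀ p ∈ S, 0 < p) →
    Tendsto (fun ε : ℝ => ∑ p ∈ S, a p * ε ^ (-p) + d * Real.log ε) (𝓝[>] 0) (𝓝 c) →
    d = 0 ∧ c = 0 := by
  induction S using Finset.induction_on with
  | empty =>
    intro a d c _ h
    have h2 := (h.comp tendsto_two_mul).sub h
    have h3 : Tendsto (fun _ : ℝ => d * Real.log 2) (𝓝[>] (0 : ℝ)) (𝓝 (c - c)) := by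
      refine h2.congr' ?_
      filter_upwards [self_mem_nhdsWithin] with ε hε
      have hε' : (0 : ℝ) < ε := hε
      simp only [Function.comp, Finset.sum_empty]
      rw [Real.log_mul two_ne_zero hε'.ne']
      ring
    have h4 := tendsto_nhds_unique h3 tendsto_const_nhds
    have hd : d = 0 := by
      have := Real.log_pos one_lt_two
      rcases mul_eq_zero.1 (h4.symm.trans (sub_self c)) with h | h
      · exact h
      · exact absurd h this.ne'
    subst hd
    refine ⟨rfl, ?_⟩
    have h5 : Tendsto (fun _ : ℝ => (0 : ℝ)) (𝓝[>] (0 : ℝ)) (𝓝 c) := by simpa using h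
    exact tendsto_nhds_unique h5 tendsto_const_nhds
  | insert q S hq ih =>
    intro a d c hp h
    have hq0 : 0 < q := hp q (Finset.mem_insert_self _ _)
    have h2 := ((h.comp tendsto_two_mul).sub (h.const_mul ((2 : ℝ) ^ (-q)))).sub_const
      (d * Real.log 2)
    have h3 : Tendsto (fun ε : ℝ => ∑ p ∈ S, (a p * ((2 : ℝ) ^ (-p) - 2 ^ (-q))) * ε ^ (-p)
        + (d * (1 - 2 ^ (-q))) * Real.log ε) (𝓝[>] 0)
        (𝓝 (c - (2 : ℝ) ^ (-q) * c - d * Real.log 2)) := by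
      refine h2.congr' ?_
      filter_upwards [self_mem_nhdsWithin] with ε hε
      have hε' : (0 : ℝ) < ε := hε
      simp only [Function.comp, Finset.sum_insert hq]
      have hs : ∑ p ∈ S, (a p * ((2 : ℝ) ^ (-p) - 2 ^ (-q))) * ε ^ (-p)
          = ∑ p ∈ S, a p * (2 * ε) ^ (-p) - 2 ^ (-q) * ∑ p ∈ S, a p * ε ^ (-p) := by
        rw [Finset.mul_sum, ← Finset.sum_sub_distrib]
        refine Finset.sum_congr rfl fun p _ => ?_
        rw [Real.mul_rpow two_pos.le hε'.le]
        ring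
      rw [hs, Real.log_mul two_ne_zero hε'.ne', Real.mul_rpow two_pos.le hε'.le]
      ring
    have h2q : (2 : ℝ) ^ (-q) < 1 := Real.rpow_lt_one_of_one_lt_of_neg one_lt_two (by linarith)
    obtain ⟨e1, e2⟩ := ih _ _ _ (fun p hpS => hp p (Finset.mem_insert_of_mem hpS)) h3
    have hd : d = 0 := by
      rcases mul_eq_zero.1 e1 with h | h
      · exact h
      · linarith
    subst hd
    refine ⟨rfl, ?_⟩
    have : c * (1 - (2 : ℝ) ^ (-q)) = 0 := by linarith
    rcases mul_eq_zero.1 this with h | h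
    · exact h
    · linarith

/-- The finite part is unique. -/
theorem HasFinitePart.unique {F : ℝ → ℝ} {c c' : ℝ} (h : HasFinitePart F c)
    (h' : HasFinitePart F c') : c = c' := by
  classical
  obtain ⟨S, a, d, hS, hc⟩ := h
  obtain ⟨S', a', d', hS', hc'⟩ := h'
  have key := hc'.sub hc
  have := finitePart_aux (S ∪ S')
    (fun p => (if p ∈ S then a p else 0) - (if p ∈ S' then a' p else 0)) (d - d') (c' - c)
    (fun p hp => (Finset.mem_union.1 hp).elim (hS p) (hS' p)) (by
      refine key.congr' (Eventually.of_forall fun ε => ?_)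
      have e1 : ∑ p ∈ S ∪ S', (if p ∈ S then a p else 0) * ε ^ (-p)
          = ∑ p ∈ S, a p * ε ^ (-p) := by
        simp only [ite_mul, zero_mul, Finset.sum_ite_mem,
          Finset.inter_eq_right.2 (Finset.subset_union_left (s₁ := S) (s₂ := S'))]
      have e2 : ∑ p ∈ S ∪ S', (if p ∈ S' then a' p else 0) * ε ^ (-p)
          = ∑ p ∈ S', a' p * ε ^ (-p) := by
        simp only [ite_mul, zero_mul, Finset.sum_ite_mem,
          Finset.inter_eq_right.2 (Finset.subset_union_right (s₁ := S) (s₂ := S'))]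
      simp only [sub_mul, Finset.sum_sub_distrib, e1, e2]
      ring)
  linarith [this.2]

open Classical in
/-- Hadamard's finite part of `F` at `0+`; the value is `0` if there is none. -/
def finitePart (F : ℝ → ℝ) : ℝ :=
  if h : ∃ c, HasFinitePart F c then h.choose else 0

/-- The truncated potential `∫_{y ∈ M, |x - y| ≥ ε} |x - y| ^ α dy`, where `dy` is the
`m`-dimensional volume (the Hausdorff measure normalized to agree with Lebesgue measure). -/
def truncatedPotential {n : ℕ} (m : ℕ) (α : ℝ) (M : Set (Euc n)) (x : Euc n) (ε : ℝ) : ℝ :=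
  ∫ y in M \ ball x ε, dist x y ^ α ∂(μHE[m] : Measure (Euc n))

/-- `Pf. ∫_M |x - y| ^ α dy`. -/
def potential {n : ℕ} (m : ℕ) (α : ℝ) (M : Set (Euc n)) (x : Euc n) : ℝ :=
  finitePart (truncatedPotential m α M x)

/-- The regularized `α`-energy `E_α(M) = ∫_M (Pf. ∫_M |x - y| ^ α dy) dx`. -/
def rieszEnergy {n : ℕ} (m : ℕ) (α : ℝ) (M : Set (Euc n)) : ℝ :=
  ∫ x in M, potential m α M x ∂(μHE[m] : Measure (Euc n))

/-- All the integrals and finite parts that occur in `rieszEnergy` exist. -/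
structure RieszEnergyDefined {n : ℕ} (m : ℕ) (α : ℝ) (M : Set (Euc n)) : Prop where
  integrableOn_trunc : ∀ x ∈ M, ∀ ε > 0,
    IntegrableOn (fun y => dist x y ^ α) (M \ ball x ε) (μHE[m] : Measure (Euc n))
  exists_finitePart : ∀ x ∈ M, ∃ c, HasFinitePart (truncatedPotential m α M x) c
  integrableOn_potential : IntegrableOn (potential m α M) M (μHE[m] : Measure (Euc n))

/-! ### Immersions, sheets, and the bounded-geometry class -/

section Immersions

variable {m n : ℕ} {N : Type*} [TopologicalSpace N] [ChartedSpace (Euc m) N]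

/-- A `C^k` immersion of an `m`-manifold into `ℝⁿ` (used for `k ≥ 1`). -/
def IsImm (k : ℕ) (f : N → Euc n) : Prop :=
  ContMDiff (𝓡 m) 𝓘(ℝ, Euc n) k f ∧
    ∀ p : N, Function.Injective (mfderiv (𝓡 m) 𝓘(ℝ, Euc n) f p)

/-- The open subset `W` is `C^k`-diffeomorphic to the open unit `m`-ball. -/
def IsDiffeoToBall (m k : ℕ) {N : Type*} [TopologicalSpace N] [ChartedSpace (Euc m) N]
    (W : Set N) : Prop :=
  ∃ e : OpenPartialHomeomorph (Euc m) N, e.source = ball 0 1 ∧ e.target = W ∧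
    ContMDiffOn (𝓡 m) (𝓡 m) k e e.source ∧ ContMDiffOn (𝓡 m) (𝓡 m) k e.symm e.target

/-- `f⁻¹(B_r(x))` is the disjoint union of `W₁, …, W_ℓ`, each `C^k`-diffeomorphic to an `m`-ball,
and `f` restricted to each `W_i` is a homeomorphism onto its image. For a `C^k` immersion `f` the
last property says that `f|W_i` is a `C^k` embedding, i.e. a `C^k`-diffeomorphism onto `f(W_i)`. -/
structure IsSheets (m k : ℕ) {n : ℕ} {N : Type*} [TopologicalSpace N] [ChartedSpace (Euc m) N]
    (f : N → Euc n) (x : Euc n) (r : ℝ) {l : ℕ} (W : Fin l → Set N) : Prop where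
  iUnion_eq : ⋃ i, W i = f ⁻¹' ball x r
  disjoint : Pairwise fun i j => Disjoint (W i) (W j)
  ball : ∀ i, IsDiffeoToBall m k (W i)
  embedding : ∀ i, IsEmbedding (fun p : W i => f p)

/-- The tangent space at `f p` of the sheet through `p`, as a linear subspace of `ℝⁿ`. -/
def tangentPlane (m : ℕ) {n : ℕ} {N : Type*} [TopologicalSpace N] [ChartedSpace (Euc m) N]
    (f : N → Euc n) (p : N) : Submodule ℝ (Euc n) :=
  let D : Euc m →L[ℝ] Euc n := mfderiv (𝓡 m) 𝓘(ℝ, Euc n) f p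
  LinearMap.range D.toLinearMap

end Immersions

/-- `S` is the graph (with origin `x`) of a `C^k` function `h : U → Tᗮ`, `U ⊆ T` open, all of whose
partial derivatives `∂^μ h`, `0 ≤ |μ| ≤ k`, with respect to any orthonormal basis of the
`m`-dimensional subspace `T` are bounded by `b` on `U`. -/
def IsBoundedGraph (m k : ℕ) (b : ℝ) {n : ℕ} (x : Euc n) (T : Submodule ℝ (Euc n))
    (S : Set (Euc n)) : Prop :=
  ∃ (U : Set T) (h : T → Tᗮ), IsOpen U ∧ ContDiffOn ℝ k h U ∧
    S = (fun u : T => x + (u : Euc n) + (h u : Euc n)) '' U ∧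
    ∀ (e : OrthonormalBasis (Fin m) ℝ T) (j : ℕ), j ≤ k → ∀ s : Fin j → Fin m, ∀ u ∈ U,
      ‖iteratedFDeriv ℝ j h u (fun i => e (s i))‖ ≤ b

/-- The class of closed immersed `m`-dimensional submanifolds `M'` of `ℝⁿ` of volume at most `V`
that are the image of a `C^k` immersion `g` of a closed `C^k` manifold `N` such that, for every
`x ∈ M'`, the preimage of the ball `B_{ε₀}(x)` splits into finitely many embedded `m`-balls, and
each of these sheets passing through `x` is a graph over its tangent space at `x` with derivatives
up to order `k` bounded by `b`. -/
def BoundedGeometry (m n k : ℕ) (ε₀ b V : ℝ) : Set (Set (Euc n)) :=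
  {M' | (μHE[m] : Measure (Euc n)) M' ≤ ENNReal.ofReal V ∧
    ∃ (N : Type) (_ : TopologicalSpace N) (_ : ChartedSpace (Euc m) N)
      (_ : IsManifold (𝓡 m) k N) (_ : CompactSpace N) (_ : T2Space N) (g : N → Euc n),
      IsImm (m := m) k g ∧ Set.range g = M' ∧
      ∀ x ∈ M', ∃ (l : ℕ) (W : Fin l → Set N), IsSheets m k g x ε₀ W ∧
        ∀ i, ∀ p ∈ W i, g p = x → IsBoundedGraph m k b x (tangentPlane m g p) (g '' W i)}

/-- `ᾱ = max {⌊-α⌋ - m, 0}`. -/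
def alphaBar (m : ℕ) (α : ℝ) : ℕ := (⌊-α⌋ - (m : ℤ)).toNat

end

end RieszRepulsion

/-!
Around each of its points `x` the manifold `M` is a graph over a ball of uniform radius `r` with
uniformly bounded derivatives, so the volume of `M ∩ B_t(x)` has an expansion in the powers `t ^ m`,
`t ^ (m + 1)`, … whose coefficients and remainder are bounded uniformly in `M` and `x`. Integrating
by parts over the radius `t`, one sees that the truncated potential is the sum of terms with
vanishing finite part, a uniformly bounded contribution of the sheet through `x`, and the integral
over the rest of `M`. Hence the potential is, up to a uniform constant, at least the integral over
any part of `M` off that sheet.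

If a map `δ`-close to the inclusion has a double point at which two sheets cross, then the sheets of
`M` through the two preimages come within `2δ` of each other, although they are disjoint. Every
dyadic scale between `δ` and `r` contributes a fixed amount to the interaction of these sheets, as
`α ≤ -2m`, so the energy grows at least like `log (1 / δ)`.
-/

namespace RieszRepulsion

noncomputable section

/-! ### Uniform asymptotic expansions at `0+` -/

section UniformExpansion

variable {I : Type*} {N : ℕ} {φ ψ : I → ℝ → ℝ} {c : I → ℕ → ℝ} {K : ℝ}

/-- The family `φ` has the expansion `φ i t = ∑_{j < N} c i j * t ^ j + O(t ^ N)` as `t → 0+`. One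
constant `K` bounds the coefficients and the remainders of all members of the family, so that such
expansions can be integrated over the index. -/
structure HasUniformExpansionWith (N : ℕ) (φ : I → ℝ → ℝ) (c : I → ℕ → ℝ) (K : ℝ) : Prop where
  nonneg : 0 ≤ K
  abs_coeff_le : ∀ i j, |c i j| ≤ K
  eventually_abs_sub_le :
    ∀ᶠ t in 𝓝[>] 0, ∀ i, |φ i t - ∑ j ∈ Finset.range N, c i j * t ^ j| ≤ K * t ^ N

/-- The family `φ` has an expansion of order `N` at `0+` that is uniform in the index, see
`HasUniformExpansionWith`. -/
def HasUniformExpansion (N : ℕ) (φ : I → ℝ → ℝ) : Prop :=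
  ∃ c K, HasUniformExpansionWith N φ c K

theorem HasUniformExpansion.congr (h : HasUniformExpansion N φ)
    (he : ∀ᶠ t in 𝓝[>] 0, ∀ i, φ i t = ψ i t) : HasUniformExpansion N ψ := by
  obtain ⟨c, K, hK, hc, hb⟩ := h
  refine ⟨c, K, hK, hc, ?_⟩
  filter_upwards [hb, he] with t ht het i
  exact het i ▸ ht i

theorem HasUniformExpansion.of_bound
    (h : ∀ᶠ t in 𝓝[>] 0, ∀ i, |φ i t| ≤ K * t ^ N) : HasUniformExpansion N φ := by
  refine ⟨fun _ _ => 0, |K|, abs_nonneg K, fun _ _ => by simp, ?_⟩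
  filter_upwards [h, self_mem_nhdsWithin] with t ht (h0 : 0 < t) i
  simp only [zero_mul, Finset.sum_const_zero, sub_zero]
  exact (ht i).trans (by gcongr; exact le_abs_self K)

theorem HasUniformExpansion.exists_bound (h : HasUniformExpansion N φ) :
    ∃ K, 0 ≤ K ∧ ∀ᶠ t in 𝓝[>] 0, ∀ i, |φ i t| ≤ K := by
  obtain ⟨c, K, hK, hc, hb⟩ := h
  refine ⟨K + N * K, by positivity, ?_⟩
  filter_upwards [hb, Ioo_mem_nhdsGT one_pos] with t ht ⟨h0, ht1⟩ i
  have hsum : |∑ j ∈ Finset.range N, c i j * t ^ j| ≤ N * K := by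
    refine (Finset.abs_sum_le_sum_abs _ _).trans ?_
    refine (Finset.sum_le_card_nsmul _ _ K fun j _ => ?_).trans (by simp)
    rw [abs_mul, abs_of_nonneg (pow_nonneg h0.le j)]
    exact (mul_le_mul (hc i j) (pow_le_one₀ h0.le ht1.le) (by positivity) hK).trans (by simp)
  have hrem : K * t ^ N ≤ K := mul_le_of_le_one_right hK (pow_le_one₀ h0.le ht1.le)
  linarith [ht i, abs_sub_abs_le_abs_sub (φ i t) (∑ j ∈ Finset.range N, c i j * t ^ j)]

theorem HasUniformExpansion.add (h : HasUniformExpansion N φ) (h' : HasUniformExpansion N ψ) :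
    HasUniformExpansion N (fun i t => φ i t + ψ i t) := by
  obtain ⟨c, K, hK, hc, hb⟩ := h
  obtain ⟨c', K', hK', hc', hb'⟩ := h'
  refine ⟨fun i j => c i j + c' i j, K + K', add_nonneg hK hK', fun i j =>
    (abs_add_le _ _).trans (add_le_add (hc i j) (hc' i j)), ?_⟩
  filter_upwards [hb, hb'] with t ht ht' i
  simp only [add_mul, Finset.sum_add_distrib]
  rw [add_sub_add_comm]
  exact (abs_add_le _ _).trans (add_le_add (ht i) (ht' i))

theorem HasUniformExpansion.zero : HasUniformExpansion N (fun (_ : I) _ => 0) :=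
  .of_bound (K := 0) (by simp)

theorem HasUniformExpansion.sum {κ : Type*} {s : Finset κ} {Φ : κ → I → ℝ → ℝ}
    (h : ∀ k ∈ s, HasUniformExpansion N (Φ k)) :
    HasUniformExpansion N (fun i t => ∑ k ∈ s, Φ k i t) := by
  classical
  induction s using Finset.induction_on with
  | empty => simpa only [Finset.sum_empty] using HasUniformExpansion.zero
  | insert a s ha ih =>
    simp only [Finset.sum_insert ha]
    exact (h a (Finset.mem_insert_self _ _)).add
      (ih fun k hk => h k (Finset.mem_insert_of_mem hk))

theorem HasUniformExpansion.bounded_mul (h : HasUniformExpansion N φ) {a : I → ℝ} {A : ℝ}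
    (ha : ∀ i, |a i| ≤ A) : HasUniformExpansion N (fun i t => a i * φ i t) := by
  obtain ⟨c, K, hK, hc, hb⟩ := h
  have haA : ∀ i, |a i| ≤ |A| := fun i => (ha i).trans (le_abs_self A)
  refine ⟨fun i j => a i * c i j, |A| * K, by positivity, fun i j => ?_, ?_⟩
  · rw [abs_mul]
    exact mul_le_mul (haA i) (hc i j) (abs_nonneg _) (abs_nonneg _)
  · filter_upwards [hb] with t ht i
    simp only [mul_assoc]
    rw [← Finset.mul_sum, ← mul_sub, abs_mul]
    exact mul_le_mul (haA i) (ht i) (abs_nonneg _) (abs_nonneg _)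

theorem HasUniformExpansion.X_mul (h : HasUniformExpansion N φ) :
    HasUniformExpansion (N + 1) (fun i t => t * φ i t) := by
  obtain ⟨c, K, hK, hc, hb⟩ := h
  refine ⟨fun i j => if j = 0 then 0 else c i (j - 1), K, hK, fun i j => ?_, ?_⟩
  · split_ifs
    · simpa only [abs_zero] using hK
    · exact hc _ _
  · filter_upwards [hb, self_mem_nhdsWithin] with t ht (h0 : 0 < t) i
    have hsum : ∑ j ∈ Finset.range (N + 1), (if j = 0 then 0 else c i (j - 1)) * t ^ j
        = t * ∑ j ∈ Finset.range N, c i j * t ^ j := by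
      simp only [Finset.sum_range_succ', Nat.add_eq_zero_iff, one_ne_zero, and_false, if_false,
        Nat.add_sub_cancel, if_true, zero_mul, add_zero, Finset.mul_sum]
      exact Finset.sum_congr rfl fun j _ => by ring
    rw [hsum, ← mul_sub, abs_mul, abs_of_pos h0]
    calc t * _ ≤ t * (K * t ^ N) := by gcongr; exact ht i
      _ = _ := by ring

theorem HasUniformExpansion.of_succ (h : HasUniformExpansion (N + 1) φ) :
    HasUniformExpansion N φ := by
  obtain ⟨c, K, hK, hc, hb⟩ := h
  refine ⟨c, K + K, by positivity, fun i j => (hc i j).trans (by linarith), ?_⟩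
  filter_upwards [hb, Ioo_mem_nhdsGT one_pos] with t ht ⟨h0, ht1⟩ i
  have hrem := ht i
  rw [Finset.sum_range_succ, ← sub_sub] at hrem
  have hlast : |c i N * t ^ N| ≤ K * t ^ N := by
    rw [abs_mul, abs_of_nonneg (pow_nonneg h0.le N)]
    gcongr
    exact hc i N
  have hpow : K * t ^ (N + 1) ≤ K * t ^ N := by
    gcongr 1
    exact pow_le_pow_of_le_one h0.le ht1.le (Nat.le_succ N)
  rw [add_mul]
  linarith [abs_sub_abs_le_abs_sub (φ i t - ∑ j ∈ Finset.range N, c i j * t ^ j) (c i N * t ^ N)]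

theorem HasUniformExpansion.mono {N' : ℕ} (h : HasUniformExpansion N φ) (hN : N' ≤ N) :
    HasUniformExpansion N' φ := by
  induction hN with
  | refl => exact h
  | step _ ih => exact ih h.of_succ

theorem HasUniformExpansion.X_pow_mul (h : HasUniformExpansion N φ) (j : ℕ) :
    HasUniformExpansion N (fun i t => t ^ j * φ i t) := by
  induction j with
  | zero => simpa only [pow_zero, one_mul] using h
  | succ j ih => simpa only [pow_succ', mul_assoc] using ih.X_mul.of_succ

theorem HasUniformExpansion.mul (h : HasUniformExpansion N φ) (h' : HasUniformExpansion N ψ) :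
    HasUniformExpansion N (fun i t => φ i t * ψ i t) := by
  obtain ⟨K', -, hb'⟩ := h'.exists_bound
  obtain ⟨c, K, hK, hc, hb⟩ := h
  have hmain : HasUniformExpansion N
      (fun i t => ∑ j ∈ Finset.range N, c i j * (t ^ j * ψ i t)) :=
    .sum fun j _ => (h'.X_pow_mul j).bounded_mul fun i => hc i j
  have hrem : HasUniformExpansion N
      (fun i t => (φ i t - ∑ j ∈ Finset.range N, c i j * t ^ j) * ψ i t) := by
    refine .of_bound (K := K * K') ?_
    filter_upwards [hb, hb', self_mem_nhdsWithin] with t ht ht' (h0 : 0 < t) i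
    rw [abs_mul, mul_right_comm]
    exact mul_le_mul (ht i) (ht' i) (abs_nonneg _) (by positivity)
  refine (hmain.add hrem).congr (Eventually.of_forall fun t i => ?_)
  simp only [sub_mul, Finset.sum_mul, mul_assoc]
  ring

theorem HasUniformExpansion.of_const {a : I → ℝ} {A : ℝ} (ha : ∀ i, |a i| ≤ A) :
    HasUniformExpansion N (fun i _ => a i) := by
  have haA : ∀ i, |a i| ≤ |A| := fun i => (ha i).trans (le_abs_self A)
  cases N with
  | zero => exact .of_bound (K := A) (Eventually.of_forall fun t i => by simpa using ha i)
  | succ N =>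
    refine ⟨fun i j => if j = 0 then a i else 0, |A|, abs_nonneg A, fun i j => ?_, ?_⟩
    · split_ifs
      · exact haA i
      · simp only [abs_zero, abs_nonneg]
    · filter_upwards [self_mem_nhdsWithin] with t (h0 : 0 < t) i
      simp only [ite_mul, zero_mul, Finset.sum_ite_eq', Finset.mem_range, Nat.succ_pos, if_true,
        pow_zero, mul_one, sub_self, abs_zero]
      positivity

theorem HasUniformExpansion.one : HasUniformExpansion N (fun (_ : I) _ => 1) :=
  .of_const (A := 1) fun _ => abs_one.le

theorem HasUniformExpansion.prod {κ : Type*} {s : Finset κ} {Φ : κ → I → ℝ → ℝ}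
    (h : ∀ k ∈ s, HasUniformExpansion N (Φ k)) :
    HasUniformExpansion N (fun i t => ∏ k ∈ s, Φ k i t) := by
  classical
  induction s using Finset.induction_on with
  | empty => simpa only [Finset.prod_empty] using HasUniformExpansion.one
  | insert a s ha ih =>
    simp only [Finset.prod_insert ha]
    exact (h a (Finset.mem_insert_self _ _)).mul
      (ih fun k hk => h k (Finset.mem_insert_of_mem hk))

theorem HasUniformExpansion.pow (h : HasUniformExpansion N φ) (j : ℕ) :
    HasUniformExpansion N (fun i t => φ i t ^ j) := by
  simpa only [Finset.prod_const, Finset.card_range] using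
    HasUniformExpansion.prod (s := Finset.range j) fun _ _ => h

theorem HasUniformExpansion.det {κ : Type*} [Fintype κ] [DecidableEq κ]
    {A : I → ℝ → Matrix κ κ ℝ} (h : ∀ a b, HasUniformExpansion N (fun i t => A i t a b)) :
    HasUniformExpansion N (fun i t => (A i t).det) := by
  simp only [Matrix.det_apply']
  refine .sum fun σ _ => ?_
  refine (HasUniformExpansion.prod fun k _ => h (σ k) k).bounded_mul
    (a := fun _ => ((Equiv.Perm.sign σ : ℤ) : ℝ)) (A := 1) fun _ => ?_
  rcases Int.units_eq_one_or (Equiv.Perm.sign σ) with h | h <;> simp [h]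

theorem HasUniformExpansionWith.tendsto (h : HasUniformExpansionWith (N + 1) φ c K) (i : I) :
    Tendsto (φ i) (𝓝[>] 0) (𝓝 (c i 0)) := by
  have hpoly : Tendsto (fun t : ℝ => ∑ j ∈ Finset.range (N + 1), c i j * t ^ j) (𝓝[>] 0)
      (𝓝 (c i 0)) := by
    have hcont : Continuous (fun t : ℝ => ∑ j ∈ Finset.range (N + 1), c i j * t ^ j) := by fun_prop
    simpa [Finset.sum_range_succ'] using (hcont.tendsto 0).mono_left nhdsWithin_le_nhds
  have hbound : Tendsto (fun t : ℝ => K * t ^ (N + 1)) (𝓝[>] 0) (𝓝 0) := by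
    have hcont : Continuous (fun t : ℝ => K * t ^ (N + 1)) := by fun_prop
    simpa using (hcont.tendsto 0).mono_left nhdsWithin_le_nhds
  have hrem : Tendsto (fun t : ℝ => φ i t - ∑ j ∈ Finset.range (N + 1), c i j * t ^ j) (𝓝[>] 0)
      (𝓝 0) :=
    squeeze_zero_norm' (h.eventually_abs_sub_le.mono fun t ht => ht i) hbound
  simpa using hpoly.add hrem

theorem HasUniformExpansionWith.sub_coeff_zero_div (h : HasUniformExpansionWith (N + 1) φ c K) :
    HasUniformExpansionWith N (fun i t => (φ i t - c i 0) / t) (fun i j => c i (j + 1)) K := by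
  obtain ⟨hK, hc, hb⟩ := h
  refine ⟨hK, fun i j => hc i (j + 1), ?_⟩
  filter_upwards [hb, self_mem_nhdsWithin] with t ht (h0 : 0 < t) i
  have hsum : (∑ j ∈ Finset.range N, c i (j + 1) * t ^ j) * t + c i 0
      = ∑ j ∈ Finset.range (N + 1), c i j * t ^ j := by
    simp only [Finset.sum_range_succ', Finset.sum_mul, pow_zero, mul_one, pow_succ, mul_assoc]
  have hrem : (φ i t - c i 0) / t - ∑ j ∈ Finset.range N, c i (j + 1) * t ^ j
      = (φ i t - ∑ j ∈ Finset.range (N + 1), c i j * t ^ j) / t := by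
    rw [← hsum]
    field_simp
    ring
  rw [hrem, abs_div, abs_of_pos h0, div_le_iff₀ h0, mul_assoc, ← pow_succ]
  exact ht i

theorem HasUniformExpansion.sub_div_X (h : HasUniformExpansion (N + 1) φ) {a : ℝ}
    (ha : ∀ i, Tendsto (φ i) (𝓝[>] 0) (𝓝 a)) :
    HasUniformExpansion N (fun i t => (φ i t - a) / t) := by
  obtain ⟨c, K, hexp⟩ := h
  have hc : ∀ i, c i 0 = a := fun i => tendsto_nhds_unique (hexp.tendsto i) (ha i)
  have hdiv := hexp.sub_coeff_zero_div
  simp only [hc] at hdiv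
  exact ⟨_, _, hdiv⟩

-- `G (a + x) = G a + x * dslope G a (a + x)` turns a bound of order `N` for `dslope G a` into one
-- of order `N + 1` for `G`.
theorem HasUniformExpansion.comp_analytic_add_X_mul (h : HasUniformExpansion N φ) {a : ℝ}
    {G : ℝ → ℝ} (hG : AnalyticAt ℝ G a) :
    HasUniformExpansion (N + 1) (fun i t => G (a + t * φ i t)) := by
  have of_dslope : ∀ {N : ℕ} {G : ℝ → ℝ}, HasUniformExpansion N φ →
      HasUniformExpansion N (fun i t => dslope G a (a + t * φ i t)) →
      HasUniformExpansion (N + 1) (fun i t => G (a + t * φ i t)) := fun {N G} h hquot => by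
    refine ((HasUniformExpansion.of_const fun _ => le_refl |G a|).add
      (h.mul hquot).X_mul).congr (Eventually.of_forall fun t i => ?_)
    have := sub_smul_dslope G a (a + t * φ i t)
    rw [add_sub_cancel_left, smul_eq_mul] at this
    linarith
  have analyticAt_dslope : ∀ {G : ℝ → ℝ}, AnalyticAt ℝ G a → AnalyticAt ℝ (dslope G a) a :=
    fun ⟨_, hp⟩ => ⟨_, hp.has_fpower_series_dslope_fslope⟩
  induction N generalizing G with
  | zero =>
    refine of_dslope h ?_
    obtain ⟨K, hK, hb⟩ := h.exists_bound
    obtain ⟨δ, hδ, hball⟩ := Metric.eventually_nhds_iff.1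
      ((analyticAt_dslope hG).continuousAt.abs.eventually
        (gt_mem_nhds (lt_add_one |dslope G a a|)))
    refine .of_bound (K := |dslope G a a| + 1) ?_
    filter_upwards [hb, Ioo_mem_nhdsGT (div_pos hδ (by positivity : 0 < K + 1))]
      with t ht ⟨h0, htδ⟩ i
    rw [pow_zero, mul_one]
    refine (hball ?_).le
    rw [lt_div_iff₀ (by positivity)] at htδ
    rw [dist_self_add_left, Real.norm_eq_abs, abs_mul, abs_of_pos h0]
    nlinarith [ht i]
  | succ N ih => exact of_dslope h (ih h.of_succ (analyticAt_dslope hG))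

theorem HasUniformExpansion.comp_analytic (h : HasUniformExpansion (N + 1) φ) {a : ℝ}
    (ha : ∀ i, Tendsto (φ i) (𝓝[>] 0) (𝓝 a)) {G : ℝ → ℝ} (hG : AnalyticAt ℝ G a) :
    HasUniformExpansion (N + 1) (fun i t => G (φ i t)) := by
  refine ((h.sub_div_X ha).comp_analytic_add_X_mul hG).congr ?_
  filter_upwards [self_mem_nhdsWithin] with t (h0 : 0 < t) i
  rw [mul_div_cancel₀ _ h0.ne', add_sub_cancel]

theorem HasUniformExpansion.reindex {J : Type*} (h : HasUniformExpansion N φ) (σ : J → I) :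
    HasUniformExpansion N (fun i => φ (σ i)) := by
  obtain ⟨c, K, hK, hc, hb⟩ := h
  exact ⟨fun i => c (σ i), K, hK, fun i => hc (σ i), hb.mono fun t ht i => ht (σ i)⟩

theorem HasUniformExpansion.comp_reparam {ρ : I → ℝ → ℝ} (h : HasUniformExpansion N φ)
    (hρ : HasUniformExpansion N ρ) (hle : ∀ᶠ t in 𝓝[>] 0, ∀ i, ρ i t ∈ Set.Ioc 0 t) :
    HasUniformExpansion N (fun i t => φ i (ρ i t)) := by
  obtain ⟨c, K, hK, hc, hb⟩ := h
  have hpoly : HasUniformExpansion N (fun i t => ∑ j ∈ Finset.range N, c i j * ρ i t ^ j) :=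
    .sum fun j _ => (hρ.pow j).bounded_mul fun i => hc i j
  obtain ⟨R, hR, hbR⟩ := mem_nhdsGT_iff_exists_Ioo_subset.1 hb
  have hrem : HasUniformExpansion N
      (fun i t => φ i (ρ i t) - ∑ j ∈ Finset.range N, c i j * ρ i t ^ j) := by
    refine .of_bound (K := K) ?_
    filter_upwards [hle, Ioo_mem_nhdsGT hR] with t ht ⟨_, htR⟩ i
    obtain ⟨hpos, hρt⟩ := ht i
    refine (hbR ⟨hpos, hρt.trans_lt htR⟩ i).trans ?_
    gcongr
  exact (hpoly.add hrem).congr (Eventually.of_forall fun t i => add_sub_cancel _ _)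

theorem HasUniformExpansion.of_hasDerivAt {f f' : I → ℝ → ℝ} {A : ℝ}
    (h : HasUniformExpansion N f')
    (hf : ∀ᶠ t in 𝓝[>] 0, ∀ i, ∀ s ∈ Set.Icc 0 t, HasDerivAt (f i) (f' i s) s)
    (h0 : ∀ i, |f i 0| ≤ A) : HasUniformExpansion (N + 1) f := by
  obtain ⟨c, K, hK, hc, hb⟩ := h
  set g : I → ℝ → ℝ := fun i s => f i s - ∑ j ∈ Finset.range N, c i j / (j + 1) * s ^ (j + 1)
  have hg : ∀ i s, HasDerivAt (f i) (f' i s) s →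
      HasDerivAt (g i) (f' i s - ∑ j ∈ Finset.range N, c i j * s ^ j) s := by
    refine fun i s hs => hs.sub (HasDerivAt.fun_sum fun j _ => ?_)
    refine ((hasDerivAt_pow (j + 1) s).const_mul (c i j / (j + 1))).congr_deriv ?_
    push_cast
    field_simp
  have hpoly : HasUniformExpansion (N + 1)
      (fun i t => ∑ j ∈ Finset.range N, c i j / (j + 1) * t ^ (j + 1)) := by
    refine .sum fun j _ => ?_
    have hcj : ∀ i, |c i j / (j + 1)| ≤ K := fun i => by
      rw [abs_div, abs_of_pos (by positivity : (0 : ℝ) < j + 1)]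
      exact (div_le_self (abs_nonneg _) (by simp)).trans (hc i j)
    simpa only [mul_one] using (HasUniformExpansion.one.X_pow_mul (j + 1)).bounded_mul hcj
  have hrem : HasUniformExpansion (N + 1) (fun i t => g i t - g i 0) := by
    refine .of_bound (K := K) ?_
    obtain ⟨R, hR, hbR⟩ := mem_nhdsGT_iff_exists_Ioo_subset.1 hb
    filter_upwards [hf, Ioo_mem_nhdsGT hR] with t ht ⟨ht0, htR⟩ i
    obtain ⟨ξ, ⟨hξ0, hξt⟩, hslope⟩ := exists_hasDerivAt_eq_slope (g i) _ ht0
      (fun s hs => (hg i s (ht i s hs)).continuousAt.continuousWithinAt)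
      fun s hs => hg i s (ht i s (Set.Ioo_subset_Icc_self hs))
    have hξ := hbR ⟨hξ0, hξt.trans htR⟩ i
    rw [hslope, sub_zero, abs_div, abs_of_pos ht0, div_le_iff₀ ht0] at hξ
    calc |g i t - g i 0| ≤ K * ξ ^ N * t := hξ
      _ ≤ K * t ^ N * t := by gcongr
      _ = K * t ^ (N + 1) := by ring
  refine (((HasUniformExpansion.of_const h0).add hpoly).add hrem).congr
    (Eventually.of_forall fun t i => ?_)
  simp only [g, ne_eq, Nat.add_eq_zero_iff, one_ne_zero, and_false, not_false_eq_true, zero_pow,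
    mul_zero, Finset.sum_const_zero]
  ring

theorem HasUniformExpansion.of_hasDerivAt_chain {F : ℕ → I → ℝ → ℝ} {R : ℝ} (hR : 0 < R)
    (hd : ∀ j < N, ∀ i, ∀ t ∈ Set.Ico 0 R, HasDerivAt (F j i) (F (j + 1) i t) t)
    (hb : ∀ j ≤ N, ∀ i, ∀ t ∈ Set.Ico 0 R, |F j i t| ≤ K) : HasUniformExpansion N (F 0) := by
  induction N generalizing F with
  | zero =>
    refine .of_bound (K := K) ?_
    filter_upwards [Ioo_mem_nhdsGT hR] with t ht i
    simpa using hb 0 le_rfl i t (Set.Ioo_subset_Ico_self ht)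
  | succ N ih =>
    refine HasUniformExpansion.of_hasDerivAt (f' := F 1) (ih (F := fun j => F (j + 1))
      (fun j hj => hd (j + 1) (by lia)) fun j hj => hb (j + 1) (by lia)) ?_
      fun i => hb 0 (by lia) i 0 ⟨le_rfl, hR⟩
    filter_upwards [Ioo_mem_nhdsGT hR] with t ht i s hs
    exact hd 0 (by lia) i s ⟨hs.1, hs.2.trans_lt ht.2⟩

theorem HasUniformExpansionWith.measurable_coeff {Θ : Type*} [MeasurableSpace Θ]
    {φ : Θ → ℝ → ℝ} {c : Θ → ℕ → ℝ} (h : HasUniformExpansionWith N φ c K)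
    (hm : ∀ᶠ t in 𝓝[>] 0, Measurable fun θ => φ θ t) :
    ∀ j < N, Measurable fun θ => c θ j := by
  induction N generalizing φ c with
  | zero => exact fun j hj => absurd hj (Nat.not_lt_zero j)
  | succ N ih =>
    have hzero : Measurable fun θ => c θ 0 := by
      obtain ⟨R, hR, hmR⟩ := mem_nhdsGT_iff_exists_Ioo_subset.1 hm
      obtain ⟨u, -, hu, hlim⟩ := exists_seq_strictAnti_tendsto' (Set.mem_Ioi.1 hR)
      have hu0 : Tendsto u atTop (𝓝[>] 0) :=
        tendsto_nhdsWithin_iff.2 ⟨hlim, Eventually.of_forall fun n => (hu n).1⟩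
      exact measurable_of_tendsto_metrizable (f := fun n θ => φ θ (u n)) (fun n => hmR (hu n))
        (tendsto_pi_nhds.2 fun θ => (h.tendsto θ).comp hu0)
    rintro (_ | j) hj
    · exact hzero
    · exact ih h.sub_coeff_zero_div (hm.mono fun t ht => (ht.sub hzero).div_const t) j (by lia)

theorem HasUniformExpansionWith.integral {Θ : Type*} [MeasurableSpace Θ] {σ : Measure Θ}
    [IsFiniteMeasure σ] {φ : I → Θ → ℝ → ℝ} {c : I → Θ → ℕ → ℝ}
    (h : HasUniformExpansionWith N (fun p : I × Θ => φ p.1 p.2) (fun p => c p.1 p.2) K)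
    (hm : ∀ᶠ t in 𝓝[>] 0, ∀ i, Measurable fun θ => φ i θ t) :
    HasUniformExpansionWith N (fun i t => ∫ θ, φ i θ t ∂σ) (fun i j => ∫ θ, c i θ j ∂σ)
      (K * σ.real Set.univ) := by
  obtain ⟨hK, hc, hb⟩ := h
  have hcK : ∀ i j, ∀ᵐ θ ∂σ, ‖c i θ j‖ ≤ K := fun i j => Eventually.of_forall fun θ => hc (i, θ) j
  refine ⟨by positivity, fun i j => norm_integral_le_of_norm_le_const (hcK i j), ?_⟩
  have hci : ∀ i, ∀ j ∈ Finset.range N, Integrable (fun θ => c i θ j) σ := fun i j hj => by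
    have hi : HasUniformExpansionWith N (φ i) (c i) K :=
      ⟨hK, fun θ => hc (i, θ), hb.mono fun t ht θ => ht (i, θ)⟩
    exact .of_bound (hi.measurable_coeff (hm.mono fun t ht => ht i) j
      (Finset.mem_range.1 hj)).aestronglyMeasurable K (hcK i j)
  filter_upwards [hb, hm] with t ht hmt i
  have hrem : ∀ᵐ θ ∂σ, ‖φ i θ t - ∑ j ∈ Finset.range N, c i θ j * t ^ j‖ ≤ K * t ^ N :=
    Eventually.of_forall fun θ => ht (i, θ)
  have hpoly : Integrable (fun θ => ∑ j ∈ Finset.range N, c i θ j * t ^ j) σ :=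
    integrable_finsetSum _ fun j hj => (hci i j hj).mul_const _
  have hφ : Integrable (fun θ => φ i θ t) σ := by
    simpa using (Integrable.of_bound
      ((hmt i).aestronglyMeasurable.sub hpoly.aestronglyMeasurable) _ hrem).add hpoly
  have hsum : ∑ j ∈ Finset.range N, (∫ θ, c i θ j ∂σ) * t ^ j
      = ∫ θ, ∑ j ∈ Finset.range N, c i θ j * t ^ j ∂σ := by
    rw [integral_finsetSum _ fun j hj => (hci i j hj).mul_const _]
    simp only [integral_mul_const]
  rw [hsum, ← integral_sub hφ hpoly, mul_right_comm]
  exact norm_integral_le_of_norm_le_const hrem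

theorem HasUniformExpansion.integral {Θ : Type*} [MeasurableSpace Θ] {σ : Measure Θ}
    [IsFiniteMeasure σ] {φ : I → Θ → ℝ → ℝ}
    (h : HasUniformExpansion N (fun p : I × Θ => φ p.1 p.2))
    (hm : ∀ᶠ t in 𝓝[>] 0, ∀ i, Measurable fun θ => φ i θ t) :
    HasUniformExpansion N (fun i t => ∫ θ, φ i θ t ∂σ) := by
  obtain ⟨c, K, h⟩ := h
  exact ⟨_, _, HasUniformExpansionWith.integral (c := fun i θ => c (i, θ)) h hm⟩

end UniformExpansion

section FinitePart

theorem hasFinitePart_of_tendsto {F : ℝ → ℝ} {c : ℝ} (h : Tendsto F (𝓝[>] 0) (𝓝 c)) :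
    HasFinitePart F c :=
  ⟨∅, 0, 0, by simp, by simpa using h⟩

theorem HasFinitePart.add {F G : ℝ → ℝ} {c c' : ℝ} (h : HasFinitePart F c)
    (h' : HasFinitePart G c') : HasFinitePart (fun ε => F ε + G ε) (c + c') := by
  classical
  obtain ⟨S, a, d, hS, hc⟩ := h
  obtain ⟨S', a', d', hS', hc'⟩ := h'
  refine ⟨S ∪ S', fun p => (if p ∈ S then a p else 0) + (if p ∈ S' then a' p else 0), d + d',
    fun p hp => (Finset.mem_union.1 hp).elim (hS p) (hS' p), ?_⟩
  refine (hc.add hc').congr' (Eventually.of_forall fun ε => ?_)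
  have e1 : ∑ p ∈ S ∪ S', (if p ∈ S then a p else 0) * ε ^ (-p)
      = ∑ p ∈ S, a p * ε ^ (-p) := by
    simp only [ite_mul, zero_mul, Finset.sum_ite_mem,
      Finset.inter_eq_right.2 (Finset.subset_union_left (s₁ := S) (s₂ := S'))]
  have e2 : ∑ p ∈ S ∪ S', (if p ∈ S' then a' p else 0) * ε ^ (-p)
      = ∑ p ∈ S', a' p * ε ^ (-p) := by
    simp only [ite_mul, zero_mul, Finset.sum_ite_mem,
      Finset.inter_eq_right.2 (Finset.subset_union_right (s₁ := S) (s₂ := S'))]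
  simp only [add_mul, Finset.sum_add_distrib, e1, e2]
  ring

theorem HasFinitePart.const_mul {F : ℝ → ℝ} {c : ℝ} (h : HasFinitePart F c) (r : ℝ) :
    HasFinitePart (fun ε => r * F ε) (r * c) := by
  obtain ⟨S, a, d, hS, hc⟩ := h
  refine ⟨S, fun p => r * a p, r * d, hS, (hc.const_mul r).congr fun ε => ?_⟩
  rw [mul_sub, mul_add, Finset.mul_sum]
  simp only [mul_assoc]

theorem HasFinitePart.sum {κ : Type*} {s : Finset κ} {F : κ → ℝ → ℝ} {c : κ → ℝ}
    (h : ∀ k ∈ s, HasFinitePart (F k) (c k)) :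
    HasFinitePart (fun ε => ∑ k ∈ s, F k ε) (∑ k ∈ s, c k) := by
  classical
  induction s using Finset.induction_on with
  | empty => simpa using hasFinitePart_of_tendsto (tendsto_const_nhds (x := (0 : ℝ)))
  | insert a s ha ih =>
    simp only [Finset.sum_insert ha]
    exact (h a (Finset.mem_insert_self _ _)).add
      (ih fun k hk => h k (Finset.mem_insert_of_mem hk))

theorem hasFinitePart_rpow {q : ℝ} (hq : q < 0) : HasFinitePart (fun ε => ε ^ q) 0 :=
  ⟨{-q}, fun _ => 1, 0, by simpa using hq, by simp⟩

theorem hasFinitePart_log : HasFinitePart Real.log 0 :=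
  ⟨∅, 0, 1, by simp, by simp⟩

theorem finitePart_eq {F : ℝ → ℝ} {c : ℝ} (h : HasFinitePart F c) : finitePart F = c := by
  have h' : ∃ c, HasFinitePart F c := ⟨c, h⟩
  rw [finitePart, dif_pos h']
  exact h'.choose_spec.unique h

/-- The singular part, as `ε → 0+`, of the contribution of a term `s ^ (q - α)` in the volume of a
ball of radius `s` to the potential truncated at distance `ε`. -/
def gauge (α q ε : ℝ) : ℝ := if q = 0 then α * Real.log ε else (α / q - 1) * ε ^ q

theorem hasFinitePart_gauge (α : ℝ) {q : ℝ} (hq : q ≤ 0) : HasFinitePart (gauge α q) 0 := by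
  unfold gauge
  rcases hq.lt_or_eq with h | h
  · simpa only [h.ne, if_false, mul_zero] using (hasFinitePart_rpow h).const_mul (α / q - 1)
  · simpa only [h, if_true, mul_zero] using hasFinitePart_log.const_mul α

end FinitePart

/-! ### Potentials and the volume of balls -/

section LayerCake

theorem indicator_Ico_eq_sub_sub_integral {g g' : ℝ → ℝ} {a b : ℝ} (hab : a ≤ b)
    (hg : ∀ s ∈ Set.Icc a b, HasDerivAt g (g' s) s) (hg' : ContinuousOn g' (Set.Icc a b)) (d : ℝ) :
    (Set.Ico a b).indicator g d = (Set.Iio b).indicator (fun _ => g b) d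
      - (Set.Iio a).indicator (fun _ => g a) d
      - ∫ s in Set.Ioc a b, (Set.Iio s).indicator (fun _ => g' s) d := by
  have hswap : ∀ s, (Set.Iio s).indicator (fun _ => g' s) d = (Set.Ioi d).indicator g' s :=
    fun s => by simp only [Set.indicator, Set.mem_Iio, Set.mem_Ioi]
  simp only [hswap]
  rw [setIntegral_indicator measurableSet_Ioi, Set.Ioc_inter_Ioi]
  rcases lt_or_ge d b with hdb | hbd
  · have hsub : Set.uIcc (a ⊔ d) b ⊆ Set.Icc a b := by
      rw [Set.uIcc_of_le (sup_le hab hdb.le)]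
      exact Set.Icc_subset_Icc_left le_sup_left
    rw [← intervalIntegral.integral_of_le (sup_le hab hdb.le),
      intervalIntegral.integral_eq_sub_of_hasDerivAt (fun s hs => hg s (hsub hs))
        (hg'.mono hsub).intervalIntegrable]
    rcases lt_or_ge d a with hda | had
    · simp [hda, hdb, hda.le, hda.not_ge]
    · simp [had, hdb, had.not_gt]
  · have had : ¬ d < a := (hab.trans hbd).not_gt
    simp [hbd.not_gt, had]

theorem setIntegral_annulus_comp_dist {X : Type*} [PseudoMetricSpace X] [MeasurableSpace X]
    [OpensMeasurableSpace X] {ν : Measure X} [IsFiniteMeasure ν] (x : X) {g g' : ℝ → ℝ} {a b : ℝ}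
    (hab : a ≤ b) (hg : ∀ s ∈ Set.Icc a b, HasDerivAt g (g' s) s)
    (hg' : ContinuousOn g' (Set.Icc a b)) :
    ∫ y in ball x b \ ball x a, g (dist x y) ∂ν
      = g b * ν.real (ball x b) - g a * ν.real (ball x a)
        - ∫ s in a..b, g' s * ν.real (ball x s) := by
  obtain ⟨C, hC⟩ := isCompact_Icc.exists_bound_of_continuousOn hg'
  set F : X → ℝ → ℝ := fun y s => (ball x s).indicator (fun _ => g' s) y
  have hball : ∀ s c : ℝ, ∫ y, (ball x s).indicator (fun _ => c) y ∂ν = c * ν.real (ball x s) :=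
    fun s c => by
      rw [integral_indicator measurableSet_ball, setIntegral_const, smul_eq_mul, mul_comm]
  have hballi : ∀ s c : ℝ, Integrable ((ball x s).indicator fun _ => c) ν :=
    fun s c => (integrable_const c).indicator measurableSet_ball
  have hF : Integrable (Function.uncurry F) (ν.prod (volume.restrict (Set.Ioc a b))) := by
    have hset : MeasurableSet {p : X × ℝ | dist p.1 x < p.2} :=
      measurableSet_lt ((continuous_id.dist continuous_const).measurable.comp measurable_fst)
        measurable_snd
    have hmeas : AEStronglyMeasurable g' (volume.restrict (Set.Ioc a b)) :=
      (hg'.mono Set.Ioc_subset_Icc_self).aestronglyMeasurable measurableSet_Ioc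
    refine Integrable.of_bound ((hmeas.comp_snd (μ := ν)).indicator hset) C ?_
    filter_upwards [Measure.quasiMeasurePreserving_snd.ae (ae_restrict_mem measurableSet_Ioc)]
      with p hp
    exact (norm_indicator_le_norm_self _ _).trans (hC p.2 (Set.Ioc_subset_Icc_self hp))
  have hpointwise : ∀ y, (ball x b \ ball x a).indicator (fun y => g (dist x y)) y
      = (ball x b).indicator (fun _ => g b) y - (ball x a).indicator (fun _ => g a) y
        - ∫ s in Set.Ioc a b, F y s := fun y => by
    have := indicator_Ico_eq_sub_sub_integral hab hg hg' (dist x y)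
    simp only [Set.indicator, Set.mem_Ico, Set.mem_Iio] at this
    simp only [F, Set.indicator, Set.mem_sdiff, mem_ball', not_lt, ← this, and_comm]
  rw [← integral_indicator (measurableSet_ball.diff measurableSet_ball)]
  have hFint : Integrable (fun y => ∫ s in Set.Ioc a b, F y s) ν := hF.integral_prod_left
  simp only [hpointwise]
  rw [integral_sub (f := fun y => _ - _) ((hballi b _).sub (hballi a _)) hFint,
    integral_sub (hballi b _) (hballi a _), hball, hball, integral_integral_swap hF,
    intervalIntegral.integral_of_le hab]
  simp only [F, hball]

/-- The potential `∫_{ε ≤ |x - y| < R} |x - y| ^ α dy` expressed through the volumes `B s` of the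
balls of radius `s` about `x`, see `setIntegral_annulus_dist_rpow`. -/
def layerCake (α R : ℝ) (B : ℝ → ℝ) (ε : ℝ) : ℝ :=
  R ^ α * B R - ε ^ α * B ε - ∫ s in ε..R, α * s ^ (α - 1) * B s

theorem setIntegral_annulus_dist_rpow {X : Type*} [PseudoMetricSpace X] [MeasurableSpace X]
    [OpensMeasurableSpace X] {ν : Measure X} [IsFiniteMeasure ν] (x : X) (α : ℝ) {ε R : ℝ}
    (hε : 0 < ε) (hεR : ε ≤ R) :
    ∫ y in ball x R \ ball x ε, dist x y ^ α ∂ν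
      = layerCake α R (fun s => ν.real (ball x s)) ε := by
  have hne : ∀ s ∈ Set.Icc ε R, s ≠ 0 := fun s hs => (hε.trans_le hs.1).ne'
  exact setIntegral_annulus_comp_dist x hεR
    (fun s hs => Real.hasDerivAt_rpow_const (Or.inl (hne s hs)))
    (continuousOn_const.mul (continuousOn_id.rpow_const fun s hs => Or.inl (hne s hs)))

variable {α ε R : ℝ} {B B' : ℝ → ℝ}

theorem intervalIntegrable_rpow_mul (p : ℝ) (hε : 0 < ε) (hεR : ε ≤ R)
    (hB : IntervalIntegrable B volume ε R) :
    IntervalIntegrable (fun s => α * s ^ p * B s) volume ε R := by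
  refine hB.continuousOn_mul (continuousOn_const.mul (continuousOn_id.rpow_const fun s hs => ?_))
  rw [Set.uIcc_of_le hεR] at hs
  exact Or.inl (hε.trans_le hs.1).ne'

theorem layerCake_add (hε : 0 < ε) (hεR : ε ≤ R) (hB : IntervalIntegrable B volume ε R)
    (hB' : IntervalIntegrable B' volume ε R) :
    layerCake α R (fun s => B s + B' s) ε = layerCake α R B ε + layerCake α R B' ε := by
  simp only [layerCake, mul_add]
  rw [intervalIntegral.integral_add (intervalIntegrable_rpow_mul _ hε hεR hB)
    (intervalIntegrable_rpow_mul _ hε hεR hB')]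
  ring

theorem layerCake_sum {κ : Type*} {t : Finset κ} {F : κ → ℝ → ℝ} (hε : 0 < ε) (hεR : ε ≤ R)
    (hF : ∀ k ∈ t, IntervalIntegrable (F k) volume ε R) :
    layerCake α R (fun s => ∑ k ∈ t, F k s) ε = ∑ k ∈ t, layerCake α R (F k) ε := by
  simp only [layerCake, Finset.mul_sum]
  rw [intervalIntegral.integral_finsetSum
      fun k hk => intervalIntegrable_rpow_mul _ hε hεR (hF k hk),
    Finset.sum_sub_distrib, Finset.sum_sub_distrib]

theorem layerCake_const_mul (a : ℝ) :
    layerCake α R (fun s => a * B s) ε = a * layerCake α R B ε := by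
  simp only [layerCake, mul_left_comm _ a, intervalIntegral.integral_const_mul]
  ring

/-- The constant that `layerCake` and `gauge` differ by for a volume `s ^ (q - α)`. -/
def gaugeConst (α R q : ℝ) : ℝ := if q = 0 then -α * Real.log R else (1 - α / q) * R ^ q

theorem layerCake_pow (hε : 0 < ε) (hεR : ε ≤ R) (p : ℕ) :
    layerCake α R (fun s => s ^ p) ε = gauge α (α + p) ε + gaugeConst α R (α + p) := by
  have hR : 0 < R := hε.trans_le hεR
  have hmem : ∀ s ∈ Set.uIcc ε R, 0 < s := fun s hs => by
    rw [Set.uIcc_of_le hεR] at hs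
    exact hε.trans_le hs.1
  have h0 : (0 : ℝ) ∉ Set.uIcc ε R := fun h => (hmem 0 h).false
  have hint : ∫ s in ε..R, α * s ^ (α - 1) * s ^ p = α * ∫ s in ε..R, s ^ (α + p - 1) := by
    rw [← intervalIntegral.integral_const_mul]
    refine intervalIntegral.integral_congr fun s hs => ?_
    rw [mul_assoc, ← Real.rpow_add_natCast (hmem s hs).ne', sub_add_eq_add_sub]
  rw [layerCake, hint, ← Real.rpow_add_natCast hR.ne', ← Real.rpow_add_natCast hε.ne']
  by_cases hq : α + p = 0
  · simp only [gauge, gaugeConst, hq, if_true, Real.rpow_zero, zero_sub, Real.rpow_neg_one]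
    rw [integral_inv h0, Real.log_div hR.ne' hε.ne']
    ring
  · simp only [gauge, gaugeConst, hq, if_false]
    rw [integral_rpow (Or.inr ⟨fun h => hq (by linarith), h0⟩), sub_add_cancel]
    field_simp
    ring

theorem intervalIntegrable_rpow_mul_of_abs_le {K : ℝ} {p : ℕ} (hR : 0 ≤ R) (hp : 0 < α + p)
    (hBm : Measurable B) (hB : ∀ s ∈ Set.Ioc 0 R, |B s| ≤ K * s ^ p) :
    IntervalIntegrable (fun s => α * s ^ (α - 1) * B s) volume 0 R ∧
      |∫ s in (0 : ℝ)..R, α * s ^ (α - 1) * B s| ≤ |α| * K * (R ^ (α + p) / (α + p)) := by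
  set q := α + p with hq
  have hle : ∀ s ∈ Set.Ioc 0 R, ‖α * s ^ (α - 1) * B s‖ ≤ |α| * K * s ^ (q - 1) := fun s hs => by
    rw [hq, add_sub_right_comm, Real.rpow_add_natCast hs.1.ne', norm_mul, norm_mul,
      Real.norm_of_nonneg (Real.rpow_nonneg hs.1.le _), Real.norm_eq_abs, Real.norm_eq_abs]
    calc |α| * s ^ (α - 1) * |B s| ≤ |α| * s ^ (α - 1) * (K * s ^ p) :=
          mul_le_mul_of_nonneg_left (hB s hs)
            (mul_nonneg (abs_nonneg α) (Real.rpow_nonneg hs.1.le _))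
      _ = _ := by ring
  have hdom : IntervalIntegrable (fun s => |α| * K * s ^ (q - 1)) volume 0 R :=
    (intervalIntegral.intervalIntegrable_rpow' (by linarith)).const_mul _
  constructor
  · refine hdom.mono_fun' (by fun_prop) ?_
    rw [Set.uIoc_of_le hR]
    exact (ae_restrict_mem measurableSet_Ioc).mono hle
  · calc _ ≤ ∫ s in (0 : ℝ)..R, |α| * K * s ^ (q - 1) :=
          intervalIntegral.norm_integral_le_of_norm_le hR (Eventually.of_forall hle) hdom
      _ = _ := by
          rw [intervalIntegral.integral_const_mul, integral_rpow (Or.inl (by linarith)),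
            sub_add_cancel, Real.zero_rpow hp.ne', sub_zero]

theorem exists_tendsto_layerCake_of_abs_le {K : ℝ} {p : ℕ} (hR : 0 < R) (hp : 0 < α + p)
    (hBm : Measurable B) (hB : ∀ s ∈ Set.Ioc 0 R, |B s| ≤ K * s ^ p) :
    ∃ L, |L| ≤ (1 + |α| / (α + p)) * K * R ^ (α + p) ∧
      Tendsto (layerCake α R B) (𝓝[>] 0) (𝓝 L) := by
  obtain ⟨hint, hintle⟩ := intervalIntegrable_rpow_mul_of_abs_le hR.le hp hBm hB
  have hle : ∀ s ∈ Set.Ioc 0 R, |s ^ α * B s| ≤ K * s ^ (α + p) := fun s hs => by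
    rw [abs_mul, abs_of_nonneg (Real.rpow_nonneg hs.1.le _), Real.rpow_add_natCast hs.1.ne',
      mul_left_comm]
    exact mul_le_mul_of_nonneg_left (hB s hs) (Real.rpow_nonneg hs.1.le _)
  refine ⟨R ^ α * B R - ∫ s in (0 : ℝ)..R, α * s ^ (α - 1) * B s, ?_, ?_⟩
  · calc _ ≤ K * R ^ (α + p) + |α| * K * (R ^ (α + p) / (α + p)) :=
          (abs_sub _ _).trans (add_le_add (hle R ⟨hR, le_rfl⟩) hintle)
      _ = _ := by ring
  · have hbdry : Tendsto (fun ε => ε ^ α * B ε) (𝓝[>] 0) (𝓝 0) := by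
      refine squeeze_zero_norm' (eventually_of_mem (Ioc_mem_nhdsGT hR) hle) ?_
      have := ((Real.continuousAt_rpow_const 0 _ (Or.inr hp.le)).tendsto.const_mul K).mono_left
        (nhdsWithin_le_nhds (s := Set.Ioi 0))
      rwa [Real.zero_rpow hp.ne', mul_zero] at this
    have hinner : Tendsto (fun ε => ∫ s in ε..R, α * s ^ (α - 1) * B s) (𝓝[>] 0)
        (𝓝 (∫ s in (0 : ℝ)..R, α * s ^ (α - 1) * B s)) := by
      have hcont := intervalIntegral.continuousOn_primitive_interval_left
        ((intervalIntegrable_iff' (by finiteness)).1 hint) 0 Set.left_mem_uIcc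
      rw [Set.uIcc_of_le hR.le] at hcont
      exact hcont.tendsto.mono_left (nhdsWithin_le_of_mem (Icc_mem_nhdsGT hR))
    unfold layerCake
    simpa only [sub_zero] using (tendsto_const_nhds.sub hbdry).sub hinner

theorem layerCake_sub_sum_pow {N p : ℕ} {c : ℕ → ℝ} (hε : 0 < ε) (hεR : ε ≤ R)
    (hB : IntervalIntegrable B volume ε R) :
    layerCake α R (fun s => B s - ∑ j ∈ Finset.range N, c j * s ^ (p + j)) ε
      = layerCake α R B ε - ∑ j ∈ Finset.range N, c j * gauge α (α + (p + j : ℕ)) ε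
        - ∑ j ∈ Finset.range N, c j * gaugeConst α R (α + (p + j : ℕ)) := by
  have hpow : ∀ j, IntervalIntegrable (fun s : ℝ => c j * s ^ (p + j)) volume ε R := fun j =>
    (by fun_prop : Continuous fun s : ℝ => c j * s ^ (p + j)).intervalIntegrable _ _
  have hpoly : IntervalIntegrable (fun s => ∑ j ∈ Finset.range N, c j * s ^ (p + j)) volume ε R :=
    (by fun_prop : Continuous fun s => ∑ j ∈ Finset.range N, c j * s ^ (p + j)).intervalIntegrable
      _ _
  have hsplit := layerCake_add (α := α) hε hεR (hB.sub hpoly) hpoly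
  simp only [sub_add_cancel] at hsplit
  rw [sub_sub, ← Finset.sum_add_distrib, eq_sub_iff_add_eq, hsplit,
    layerCake_sum hε hεR fun j _ => hpow j]
  simp only [layerCake_const_mul, layerCake_pow hε hεR, mul_add]

theorem exists_tendsto_layerCake_sub_gauge {α R : ℝ} (K : ℝ) {N p : ℕ} (hR : 0 < R)
    (hp : 0 < α + (p + N : ℕ)) :
    ∃ C, ∀ {B : ℝ → ℝ} {c : ℕ → ℝ}, Monotone B → (∀ j, |c j| ≤ K) →
      (∀ s ∈ Set.Ioc 0 R,
        |B s - ∑ j ∈ Finset.range N, c j * s ^ (p + j)| ≤ K * s ^ (p + N)) →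
      ∃ L, |L| ≤ C ∧ Tendsto (fun ε => layerCake α R B ε
        - ∑ j ∈ Finset.range N, c j * gauge α (α + (p + j : ℕ)) ε) (𝓝[>] 0) (𝓝 L) := by
  refine ⟨(1 + |α| / (α + (p + N : ℕ))) * K * R ^ (α + (p + N : ℕ))
    + ∑ j ∈ Finset.range N, K * |gaugeConst α R (α + (p + j : ℕ))|, fun {B c} hBm hc hB => ?_⟩
  obtain ⟨L, hL, hlim⟩ := exists_tendsto_layerCake_of_abs_le hR hp
    (hBm.measurable.sub (by fun_prop)) hB
  refine ⟨L + ∑ j ∈ Finset.range N, c j * gaugeConst α R (α + (p + j : ℕ)),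
    (abs_add_le _ _).trans (add_le_add hL ((Finset.abs_sum_le_sum_abs _ _).trans
      (Finset.sum_le_sum fun j _ => ?_))), (hlim.add_const _).congr' ?_⟩
  · rw [abs_mul]
    exact mul_le_mul_of_nonneg_right (hc j) (abs_nonneg _)
  · filter_upwards [Ioc_mem_nhdsGT hR] with ε ⟨hε, hεR⟩
    exact (congrArg (· + _) (layerCake_sub_sum_pow hε hεR
      (hBm.monotoneOn _).intervalIntegrable)).trans (sub_add_cancel _ _)

end LayerCake

/-! ### Existence of the energy -/

section Energy

theorem integrableOn_dist_rpow {X : Type*} [PseudoMetricSpace X] [MeasurableSpace X]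
    [OpensMeasurableSpace X] {μ : Measure X} {S : Set X} (hS : MeasurableSet S) (hfin : μ S ≠ ⊤)
    {α : ℝ} (hα : α ≤ 0) {x : X} {ε : ℝ} (hε : 0 < ε) (hSε : Disjoint S (ball x ε)) :
    IntegrableOn (fun y => dist x y ^ α) S μ := by
  refine Measure.integrableOn_of_bounded (M := ε ^ α) hfin
    ((continuous_const.dist continuous_id).measurable.pow_const α).aestronglyMeasurable
    ((ae_restrict_mem hS).mono fun y hy => ?_)
  have hεy : ε ≤ dist x y := not_lt.1 fun h => Set.disjoint_left.1 hSε hy (mem_ball'.2 h)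
  rw [Real.norm_of_nonneg (Real.rpow_nonneg dist_nonneg α)]
  exact Real.rpow_le_rpow_of_nonpos hε hεy hα

theorem setIntegral_dist_rpow_le {X : Type*} [PseudoMetricSpace X] [MeasurableSpace X]
    [OpensMeasurableSpace X] {μ : Measure X} {S : Set X} (hS : MeasurableSet S) (hfin : μ S ≠ ⊤)
    {α : ℝ} (hα : α ≤ 0) {x : X} {ε : ℝ} (hε : 0 < ε) (hSε : Disjoint S (ball x ε)) :
    ∫ y in S, dist x y ^ α ∂μ ≤ ε ^ α * μ.real S := by
  have hle := setIntegral_mono_on (integrableOn_dist_rpow hS hfin hα hε hSε)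
    (integrableOn_const hfin (C := ε ^ α)) hS fun y hy => Real.rpow_le_rpow_of_nonpos hε
      (not_lt.1 fun h => Set.disjoint_left.1 hSε hy (mem_ball'.2 h)) hα
  rwa [setIntegral_const, smul_eq_mul, mul_comm] at hle

theorem measurable_measureReal_inter_ball {X : Type*} [PseudoMetricSpace X]
    [SecondCountableTopology X] [MeasurableSpace X] [OpensMeasurableSpace X] {μ : Measure X}
    {S : Set X} (hfin : μ S ≠ ⊤) (t : ℝ) : Measurable fun x => μ.real (S ∩ ball x t) := by
  have : IsFiniteMeasure (μ.restrict S) := isFiniteMeasure_restrict.2 hfin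
  have hs : MeasurableSet {q : X × X | dist q.2 q.1 < t} :=
    (isOpen_lt (continuous_snd.dist continuous_fst) continuous_const).measurableSet
  convert (measurable_measure_prodMk_left (ν := μ.restrict S) hs).ennreal_toReal using 2 with x
  rw [measureReal_def, Set.inter_comm, ← Measure.restrict_apply measurableSet_ball]
  rfl

variable {m n N : ℕ} {α K R ρ : ℝ} {M : Set (Euc n)} {Q : M → Set (Euc n)} {a : M → ℕ → ℝ}

theorem measurable_truncatedPotential (hfin : (μHE[m] : Measure (Euc n)) M ≠ ⊤) (ε : ℝ) :
    Measurable fun x => truncatedPotential m α M x ε := by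
  have : IsFiniteMeasure ((μHE[m] : Measure (Euc n)).restrict M) := isFiniteMeasure_restrict.2 hfin
  have hs : MeasurableSet {q : Euc n × Euc n | ε ≤ dist q.2 q.1} :=
    (isClosed_le continuous_const (continuous_snd.dist continuous_fst)).measurableSet
  have hf : Measurable fun q : Euc n × Euc n => dist q.1 q.2 ^ α :=
    Measurable.pow_const (measurable_fst.dist measurable_snd) α
  convert ((hf.indicator hs).stronglyMeasurable.integral_prod_right'
    (ν := (μHE[m] : Measure (Euc n)).restrict M)).measurable using 2 with x
  rw [truncatedPotential, Set.sdiff_eq, Set.inter_comm,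
    ← Measure.restrict_restrict measurableSet_ball.compl,
    ← integral_indicator measurableSet_ball.compl]
  simp only [Set.indicator, Set.mem_ofPred_eq, Set.mem_compl_iff, mem_ball, not_lt]

/-- `Q x` is a neighbourhood of `x` in `M`, of size between `ρ` and `R`, in which the volume of the
ball of radius `t ≤ R` about `x` is `∑_{j < N} a x j * t ^ (m + j) + O(t ^ (m + N))`. -/
structure HasVolumeExpansion (m N : ℕ) (K R ρ : ℝ) {n : ℕ} (M : Set (Euc n))
    (Q : M → Set (Euc n)) (a : M → ℕ → ℝ) : Prop where
  measurableSet : MeasurableSet M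
  measure_ne_top : (μHE[m] : Measure (Euc n)) M ≠ ⊤
  pos : 0 < ρ
  measurableSet_nhd : ∀ x, MeasurableSet (Q x)
  nhd_subset : ∀ x : M, Q x ⊆ M ∩ ball (x : Euc n) R
  inter_ball_subset : ∀ x : M, M ∩ ball (x : Euc n) ρ ⊆ Q x
  abs_coeff_le : ∀ x j, |a x j| ≤ K
  abs_volume_sub_le : ∀ x : M, ∀ t ∈ Set.Ioc 0 R,
    |(μHE[m] : Measure (Euc n)).real (Q x ∩ ball (x : Euc n) t)
      - ∑ j ∈ Finset.range N, a x j * t ^ (m + j)| ≤ K * t ^ (m + N)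

namespace HasVolumeExpansion

theorem measure_nhd_ne_top (h : HasVolumeExpansion m N K R ρ M Q a) (x : M) :
    (μHE[m] : Measure (Euc n)) (Q x) ≠ ⊤ :=
  measure_ne_top_of_subset ((h.nhd_subset x).trans Set.inter_subset_left) h.measure_ne_top

theorem disjoint_sdiff_nhd_ball (h : HasVolumeExpansion m N K R ρ M Q a) (x : M) :
    Disjoint (M \ Q x) (ball (x : Euc n) ρ) :=
  Set.disjoint_left.2 fun _ hy hyρ => hy.2 (h.inter_ball_subset x ⟨hy.1, hyρ⟩)

theorem truncatedPotential_eq (h : HasVolumeExpansion m N K R ρ M Q a) (hα : α ≤ 0) (x : M)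
    {ε : ℝ} (hε : 0 < ε) (hερ : ε ≤ ρ) (hεR : ε ≤ R) :
    truncatedPotential m α M x ε
      = layerCake α R (fun s => (μHE[m] : Measure (Euc n)).real (Q x ∩ ball (x : Euc n) s)) ε
        + ∫ y in M \ Q x, dist (x : Euc n) y ^ α ∂(μHE[m] : Measure (Euc n)) := by
  set μ : Measure (Euc n) := μHE[m]
  have : IsFiniteMeasure (μ.restrict (Q x)) := isFiniteMeasure_restrict.2 (h.measure_nhd_ne_top x)
  have hsplit : M \ ball (x : Euc n) ε = (Q x \ ball (x : Euc n) ε) ∪ (M \ Q x) := by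
    ext y
    have hQM : y ∈ Q x → y ∈ M := fun hy => (h.nhd_subset x hy).1
    have hMQ : y ∈ M → y ∈ ball (x : Euc n) ε → y ∈ Q x :=
      fun hy hyε => h.inter_ball_subset x ⟨hy, ball_subset_ball hερ hyε⟩
    simp only [Set.mem_sdiff, Set.mem_union]
    tauto
  have hnear : ∫ y in Q x \ ball (x : Euc n) ε, dist (x : Euc n) y ^ α ∂μ
      = layerCake α R (fun s => μ.real (Q x ∩ ball (x : Euc n) s)) ε := by
    have hQ : (ball (x : Euc n) R \ ball (x : Euc n) ε) ∩ Q x = Q x \ ball (x : Euc n) ε := by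
      rw [Set.inter_comm, ← Set.inter_sdiff_assoc,
        Set.inter_eq_left.2 ((h.nhd_subset x).trans Set.inter_subset_right)]
    rw [← hQ, ← Measure.restrict_restrict (measurableSet_ball.diff measurableSet_ball),
      setIntegral_annulus_dist_rpow (x : Euc n) α hε hεR]
    simp only [measureReal_restrict_apply measurableSet_ball, Set.inter_comm]
  rw [truncatedPotential, hsplit, setIntegral_union
    (Set.disjoint_left.2 fun y hy hy' => hy'.2 hy.1) (h.measurableSet.diff (h.measurableSet_nhd x))
    (integrableOn_dist_rpow ((h.measurableSet_nhd x).diff measurableSet_ball)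
      (measure_ne_top_of_subset Set.sdiff_subset (h.measure_nhd_ne_top x)) hα hε
      Set.disjoint_sdiff_left)
    (integrableOn_dist_rpow (h.measurableSet.diff (h.measurableSet_nhd x))
      (measure_ne_top_of_subset Set.sdiff_subset h.measure_ne_top) hα h.pos
      (h.disjoint_sdiff_nhd_ball x)), hnear]

end HasVolumeExpansion

/-- The truncated potential at `x` with its singular part removed, for the coefficients `a` of the
volumes of balls about `x`. -/
def regularizedPotential (m N : ℕ) (α : ℝ) {n : ℕ} (M : Set (Euc n)) (a : ℕ → ℝ) (x : Euc n)
    (ε : ℝ) : ℝ :=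
  truncatedPotential m α M x ε - ∑ j ∈ Finset.range N, a j * gauge α (α + (m + j : ℕ)) ε

theorem HasVolumeExpansion.exists_tendsto_regularizedPotential (m n N : ℕ) {α : ℝ} (K : ℝ)
    {R : ℝ} (hα : α ≤ 0) (hN : 0 < α + (m + N : ℕ)) (hR : 0 < R) :
    ∃ C, ∀ {M : Set (Euc n)} {Q : M → Set (Euc n)} {a : M → ℕ → ℝ} {ρ : ℝ},
      HasVolumeExpansion m N K R ρ M Q a → ∀ x : M, ∃ L, |L| ≤ C ∧
        Tendsto (regularizedPotential m N α M (a x) x) (𝓝[>] 0)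
          (𝓝 (L + ∫ y in M \ Q x, dist (x : Euc n) y ^ α ∂(μHE[m] : Measure (Euc n)))) := by
  obtain ⟨C, hC⟩ := exists_tendsto_layerCake_sub_gauge K hR hN
  refine ⟨C, fun {M Q a ρ} h x => ?_⟩
  have hmono : Monotone fun s => (μHE[m] : Measure (Euc n)).real (Q x ∩ ball (x : Euc n) s) :=
    fun s t hst => measureReal_mono (Set.inter_subset_inter_right _ (ball_subset_ball hst))
      (measure_ne_top_of_subset Set.inter_subset_left (h.measure_nhd_ne_top x))
  obtain ⟨L, hL, hlim⟩ := hC hmono (h.abs_coeff_le x) (h.abs_volume_sub_le x)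
  refine ⟨L, hL, (hlim.add_const _).congr' ?_⟩
  filter_upwards [Ioc_mem_nhdsGT h.pos, Ioc_mem_nhdsGT hR] with ε hερ hεR
  rw [regularizedPotential, h.truncatedPotential_eq hα x hερ.1 hερ.2 hεR.2, sub_add_eq_add_sub]

theorem hasFinitePart_truncatedPotential {x : Euc n} {a : ℕ → ℝ} {c : ℝ}
    (hN : ∀ j < N, α + (m + j : ℕ) ≤ 0)
    (h : Tendsto (regularizedPotential m N α M a x) (𝓝[>] 0) (𝓝 c)) :
    HasFinitePart (truncatedPotential m α M x) c := by
  have := (hasFinitePart_of_tendsto h).add (HasFinitePart.sum (s := Finset.range N)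
    fun j hj => (hasFinitePart_gauge α (hN j (Finset.mem_range.1 hj))).const_mul (a j))
  simpa only [regularizedPotential, sub_add_cancel, mul_zero, Finset.sum_const_zero, add_zero]
    using this

namespace HasVolumeExpansion

theorem hasUniformExpansionWith_volume (h : HasVolumeExpansion m N K R ρ M Q a) (hR : 0 < R)
    (hK : 0 ≤ K) : HasUniformExpansionWith N
      (fun (x : M) t => (μHE[m] : Measure (Euc n)).real (M ∩ ball (x : Euc n) t) / t ^ m) a K := by
  refine ⟨hK, h.abs_coeff_le, ?_⟩
  filter_upwards [Ioc_mem_nhdsGT h.pos, Ioc_mem_nhdsGT hR] with t ht htR x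
  have htm : 0 < t ^ m := pow_pos ht.1 m
  have hball : M ∩ ball (x : Euc n) t = Q x ∩ ball (x : Euc n) t :=
    Set.Subset.antisymm
      (fun y hy => ⟨h.inter_ball_subset x ⟨hy.1, ball_subset_ball ht.2 hy.2⟩, hy.2⟩)
      (Set.inter_subset_inter_left _ ((h.nhd_subset x).trans Set.inter_subset_left))
  have hle := h.abs_volume_sub_le x t htR
  rw [← hball] at hle
  refine le_of_mul_le_mul_left ?_ htm
  calc _ = |(μHE[m] : Measure (Euc n)).real (M ∩ ball (x : Euc n) t)
          - ∑ j ∈ Finset.range N, a x j * t ^ (m + j)| := by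
        rw [← abs_of_pos htm, ← abs_mul, abs_of_pos htm, mul_sub, mul_div_cancel₀ _ htm.ne',
          Finset.mul_sum]
        simp only [pow_add, mul_left_comm]
    _ ≤ _ := hle.trans_eq (by ring)

theorem measurable_of_tendsto_regularizedPotential (h : HasVolumeExpansion m N K R ρ M Q a)
    (hR : 0 < R) (hK : 0 ≤ K) {P : M → ℝ}
    (hP : ∀ x : M, Tendsto (regularizedPotential m N α M (a x) x) (𝓝[>] 0) (𝓝 (P x))) :
    Measurable P := by
  obtain ⟨u, -, hu, hulim⟩ := exists_seq_strictAnti_tendsto' (one_pos (α := ℝ))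
  have hu0 : Tendsto u atTop (𝓝[>] 0) :=
    tendsto_nhdsWithin_iff.2 ⟨hulim, Eventually.of_forall fun i => (hu i).1⟩
  have hcoeff := (h.hasUniformExpansionWith_volume hR hK).measurable_coeff
    (Eventually.of_forall fun t => ((measurable_measureReal_inter_ball h.measure_ne_top t).comp
      measurable_subtype_coe).div_const _)
  refine measurable_of_tendsto_metrizable (fun i => ?_)
    (tendsto_pi_nhds.2 fun x => (hP x).comp hu0)
  exact ((measurable_truncatedPotential h.measure_ne_top _).comp measurable_subtype_coe).sub
    (Finset.measurable_fun_sum _ fun j hj => (hcoeff j (Finset.mem_range.1 hj)).mul_const _)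

theorem integrableOn_of_abs_sub_le (h : HasVolumeExpansion m N K R ρ M Q a) (hα : α ≤ 0)
    {P : Euc n → ℝ} {C : ℝ} (hPm : Measurable fun x : M => P x)
    (hP : ∀ x : M, |P x - ∫ y in M \ Q x, dist (x : Euc n) y ^ α ∂(μHE[m] : Measure (Euc n))| ≤ C) :
    IntegrableOn P M (μHE[m] : Measure (Euc n)) := by
  set μ : Measure (Euc n) := μHE[m]
  have : IsFiniteMeasure (μ.restrict M) := isFiniteMeasure_restrict.2 h.measure_ne_top
  refine Integrable.of_bound
    ((aemeasurable_restrict_iff_comap_subtype h.measurableSet).2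
      hPm.aemeasurable).aestronglyMeasurable (C + ρ ^ α * μ.real M)
    ((ae_restrict_mem h.measurableSet).mono fun x hx => ?_)
  have hfar : ∫ y in M \ Q ⟨x, hx⟩, dist x y ^ α ∂μ ≤ ρ ^ α * μ.real M :=
    (setIntegral_dist_rpow_le (h.measurableSet.diff (h.measurableSet_nhd ⟨x, hx⟩))
      (measure_ne_top_of_subset Set.sdiff_subset h.measure_ne_top) hα h.pos
      (h.disjoint_sdiff_nhd_ball ⟨x, hx⟩)).trans
    (mul_le_mul_of_nonneg_left (measureReal_mono Set.sdiff_subset h.measure_ne_top)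
      (Real.rpow_nonneg h.pos.le α))
  have hfar0 : 0 ≤ ∫ y in M \ Q ⟨x, hx⟩, dist x y ^ α ∂μ :=
    integral_nonneg fun y => Real.rpow_nonneg dist_nonneg α
  have hsub := abs_le.1 (hP ⟨x, hx⟩)
  rw [Real.norm_eq_abs, abs_le]
  constructor <;> linarith [hsub.1, hsub.2]

/- No term of the singular part contributes to the finite part, so the potential is the limit of
the regularized one. -/
theorem exists_abs_potential_sub_le (m n N : ℕ) {α K R : ℝ} (hα : α ≤ 0)
    (hN : 0 < α + (m + N : ℕ)) (hN' : ∀ j < N, α + (m + j : ℕ) ≤ 0) (hR : 0 < R) (hK : 0 ≤ K) :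
    ∃ C, ∀ {M : Set (Euc n)} {Q : M → Set (Euc n)} {a : M → ℕ → ℝ} {ρ : ℝ},
      HasVolumeExpansion m N K R ρ M Q a → RieszEnergyDefined m α M ∧ ∀ x : M,
        |potential m α M x
          - ∫ y in M \ Q x, dist (x : Euc n) y ^ α ∂(μHE[m] : Measure (Euc n))| ≤ C := by
  obtain ⟨C, hC⟩ := exists_tendsto_regularizedPotential m n N K hα hN hR
  refine ⟨C, fun {M Q a ρ} h => ?_⟩
  have hlim : ∀ x : M, Tendsto (regularizedPotential m N α M (a x) x) (𝓝[>] 0)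
      (𝓝 (potential m α M x)) := fun x => by
    obtain ⟨L, -, hL⟩ := hC h x
    rwa [potential, finitePart_eq (hasFinitePart_truncatedPotential hN' hL)]
  have hsub : ∀ x : M, |potential m α M x
      - ∫ y in M \ Q x, dist (x : Euc n) y ^ α ∂(μHE[m] : Measure (Euc n))| ≤ C := fun x => by
    obtain ⟨L, hLC, hL⟩ := hC h x
    rwa [tendsto_nhds_unique (hlim x) hL, add_sub_cancel_right]
  refine ⟨⟨fun x _ ε hε => ?_, fun x hx => ⟨_, hasFinitePart_truncatedPotential hN' (hlim ⟨x, hx⟩)⟩,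
    h.integrableOn_of_abs_sub_le hα (h.measurable_of_tendsto_regularizedPotential hR hK hlim)
      hsub⟩, hsub⟩
  exact integrableOn_dist_rpow (h.measurableSet.diff measurableSet_ball)
    (measure_ne_top_of_subset Set.sdiff_subset h.measure_ne_top) hα hε Set.disjoint_sdiff_left

end HasVolumeExpansion

end Energy

/-! ### The area formula for injective `C^1` immersions -/

section AreaFormula

theorem euclideanHausdorffMeasure_image_le_of_edist_le {X Y Z : Type*} [EMetricSpace X]
    [MeasurableSpace X] [BorelSpace X] [EMetricSpace Y] [MeasurableSpace Y] [BorelSpace Y]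
    {f : Z → X} {g : Z → Y} {A : Set Z} {K : NNReal} (d : ℕ)
    (h : ∀ a ∈ A, ∀ b ∈ A, edist (f a) (f b) ≤ K * edist (g a) (g b)) :
    (μHE[d] : Measure X) (f '' A) ≤ (K : ENNReal) ^ d * (μHE[d] : Measure Y) (g '' A) := by
  classical
  rcases A.eq_empty_or_nonempty with rfl | ⟨a₀, -⟩
  · simp
  have : Nonempty Z := ⟨a₀⟩
  set F : Y → X := fun y => f (Function.invFunOn g A y)
  have hinv : ∀ a ∈ A, Function.invFunOn g A (g a) ∈ A ∧ g (Function.invFunOn g A (g a)) = g a :=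
    fun a ha => ⟨Function.invFunOn_mem ⟨a, ha, rfl⟩, Function.invFunOn_eq ⟨a, ha, rfl⟩⟩
  have hF : LipschitzOnWith K F (g '' A) := by
    rintro _ ⟨a, ha, rfl⟩ _ ⟨b, hb, rfl⟩
    have := h _ (hinv a ha).1 _ (hinv b hb).1
    rwa [(hinv a ha).2, (hinv b hb).2] at this
  have himg : F '' (g '' A) = f '' A := by
    rw [Set.image_image]
    refine Set.image_congr fun a ha => edist_le_zero.1 ?_
    simpa only [(hinv a ha).2, edist_self, mul_zero] using h _ (hinv a ha).1 _ ha
  have hle := hF.hausdorffMeasure_image_le (d := (d : ℝ)) (Nat.cast_nonneg d)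
  rw [himg, ENNReal.rpow_natCast] at hle
  simp only [Measure.euclideanHausdorffMeasure_def, Measure.smul_apply]
  calc _ ≤ _ • ((K : ENNReal) ^ d * μH[(d : ℝ)] (g '' A)) := by gcongr
    _ = _ := by rw [mul_smul_comm]

theorem le_of_forall_one_lt_le_pow_mul {a b : ENNReal} (k : ℕ)
    (h : ∀ κ : NNReal, 1 < κ → a ≤ (κ : ENNReal) ^ k * b) : a ≤ b := by
  have hpow : Tendsto (fun κ : NNReal => (κ : ENNReal) ^ k) (𝓝[>] 1) (𝓝 1) := by
    have : Continuous fun κ : NNReal => (κ : ENNReal) ^ k :=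
      (ENNReal.continuous_pow _).comp ENNReal.continuous_coe
    simpa using (this.tendsto 1).mono_left nhdsWithin_le_nhds
  have hlim : Tendsto (fun κ : NNReal => (κ : ENNReal) ^ k * b) (𝓝[>] 1) (𝓝 b) := by
    simpa using ENNReal.Tendsto.mul_const hpow (Or.inl one_ne_zero) (b := b)
  refine ge_of_tendsto hlim ?_
  filter_upwards [self_mem_nhdsWithin] with κ hκ using h κ hκ

theorem exists_nhds_edist_image_le {E F : Type*} [NormedAddCommGroup E] [NormedAddCommGroup F]
    [NormedSpace ℝ E] [NormedSpace ℝ F] {φ : E → F}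
    {L : E →L[ℝ] F} {u : E} (hφ : HasStrictFDerivAt φ L u) {c : NNReal}
    (hL : AntilipschitzWith c L) {κ : NNReal} (hκ : 1 < κ) :
    ∃ V ∈ 𝓝 u, ∀ a ∈ V, ∀ b ∈ V, edist (φ a) (φ b) ≤ κ * edist (L a) (L b) ∧
      edist (L a) (L b) ≤ κ * edist (φ a) (φ b) := by
  have hκ0 : (0 : ℝ) < κ := one_pos.trans (by exact_mod_cast hκ)
  set η : ℝ := 1 - (κ : ℝ)⁻¹ with hη
  have hη0 : 0 < η := sub_pos.2 (inv_lt_one_of_one_lt₀ (by exact_mod_cast hκ))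
  have hηκ : 1 + η ≤ κ := by
    have := mul_inv_cancel₀ hκ0.ne'
    nlinarith [sq_nonneg ((κ : ℝ) - 1), inv_pos.2 hκ0]
  have hstrict := hφ.isLittleO.bound (show 0 < η / (c + 1) by positivity)
  rw [nhds_prod_eq] at hstrict
  obtain ⟨V, hV, hVφ⟩ := eventually_prod_self_iff'.1 hstrict
  refine ⟨V, hV, fun a ha b hb => ?_⟩
  have hnear : ‖φ a - φ b - (L a - L b)‖ ≤ η * ‖L a - L b‖ := by
    have hdist := hL.le_mul_dist a b
    rw [dist_eq_norm, dist_eq_norm] at hdist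
    calc _ ≤ η / (c + 1) * ‖a - b‖ := by simpa only [map_sub] using hVφ a ha b hb
      _ ≤ η / (c + 1) * ((c + 1) * ‖L a - L b‖) := by
          gcongr
          exact hdist.trans (by gcongr; linarith)
      _ = _ := by field_simp
  have hupper := norm_sub_norm_le (φ a - φ b) (L a - L b)
  have hlower := norm_sub_norm_le (L a - L b) (φ a - φ b)
  rw [norm_sub_rev (L a - L b) (φ a - φ b)] at hlower
  simp only [edist_nndist, ← ENNReal.coe_mul, ENNReal.coe_le_coe, ← NNReal.coe_le_coe,
    NNReal.coe_mul, coe_nndist, dist_eq_norm]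
  refine ⟨by nlinarith [norm_nonneg (L a - L b)], ?_⟩
  rw [← inv_mul_le_iff₀ hκ0, ← sub_sub_cancel 1 (κ : ℝ)⁻¹, ← hη]
  linarith

theorem exists_nhds_setLIntegral_ofReal_le {X : Type*} [TopologicalSpace X] [MeasurableSpace X]
    (μ : Measure X) {g : X → ℝ} {u : X} (hg : ContinuousAt g u) (hu : 0 < g u) {κ : NNReal}
    (hκ : 1 < κ) :
    ∃ V ∈ 𝓝 u, ∀ A ⊆ V, MeasurableSet A →
      ENNReal.ofReal (g u) * μ A ≤ κ * ∫⁻ a in A, ENNReal.ofReal (g a) ∂μ ∧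
        ∫⁻ a in A, ENNReal.ofReal (g a) ∂μ ≤ κ * (ENNReal.ofReal (g u) * μ A) := by
  have hκ1 : (1 : ℝ) < κ := by exact_mod_cast hκ
  have hκ0 : (0 : ℝ) < κ := one_pos.trans hκ1
  have hV : ∀ᶠ a in 𝓝 u, g a < κ * g u ∧ (κ : ℝ)⁻¹ * g u < g a :=
    (hg.eventually (gt_mem_nhds (lt_mul_of_one_lt_left hu hκ1))).and
      (hg.eventually (lt_mem_nhds (mul_lt_of_lt_one_left hu (inv_lt_one_of_one_lt₀ hκ1))))
  refine ⟨_, hV, fun A hA hAm => ?_⟩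
  rw [← setLIntegral_const, ← lintegral_const_mul' _ _ ENNReal.coe_ne_top,
    ← lintegral_const_mul' _ _ ENNReal.coe_ne_top]
  constructor <;> refine setLIntegral_mono' hAm fun a ha => ?_ <;>
    rw [← ENNReal.ofReal_coe_nnreal, ← ENNReal.ofReal_mul hκ0.le] <;>
    refine ENNReal.ofReal_le_ofReal ?_
  · exact ((inv_mul_lt_iff₀ hκ0).1 (hA ha).2).le
  · exact (hA ha).1.le

theorem measure_le_of_forall_exists_nhds {X : Type*} [TopologicalSpace X]
    [SecondCountableTopology X] [MeasurableSpace X] [OpensMeasurableSpace X] {μ ν : Measure X}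
    (h : ∀ u, ∃ V ∈ 𝓝 u, ∀ A ⊆ V, MeasurableSet A → μ A ≤ ν A) : μ ≤ ν := by
  choose V hV hμν using h
  obtain ⟨t, htc, hcov⟩ :=
    TopologicalSpace.countable_cover_nhds fun u => interior_mem_nhds.2 (hV u)
  refine Measure.le_iff.2 fun A hA => ?_
  rcases t.eq_empty_or_nonempty with rfl | htne
  · have : IsEmpty X := Set.univ_eq_empty_iff.1 (by simpa using hcov.symm)
    simp [Set.eq_empty_of_isEmpty A]
  obtain ⟨w, rfl⟩ := htc.exists_eq_range htne
  set D : ℕ → Set X := fun i => A ∩ disjointed (fun j => interior (V (w j))) i with hD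
  have hDm : ∀ i, MeasurableSet (D i) := fun i =>
    hA.inter (MeasurableSet.disjointed (fun j => isOpen_interior.measurableSet) i)
  have hDd : Pairwise fun i j => Disjoint (D i) (D j) := fun i j hij =>
    (disjoint_disjointed _ hij).mono Set.inter_subset_right Set.inter_subset_right
  have hDU : ⋃ i, D i = A := by
    rw [hD, ← Set.inter_iUnion, iUnion_disjointed, ← Set.biUnion_range (f := w)
      (g := fun u => interior (V u)), hcov, Set.inter_univ]
  rw [← hDU, measure_iUnion hDd hDm, measure_iUnion hDd hDm]
  exact ENNReal.tsum_le_tsum fun i => hμν (w i) _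
    (Set.inter_subset_right.trans ((disjointed_subset _ i).trans interior_subset)) (hDm i)

variable {E F : Type*} [NormedAddCommGroup E] [InnerProductSpace ℝ E] [FiniteDimensional ℝ E]
  [NormedAddCommGroup F] [InnerProductSpace ℝ F]

theorem continuous_normDet : Continuous fun L : E →L[ℝ] F => (L : E →ₗ[ℝ] F).normDet := by
  have hsqrt : ∀ L : E →L[ℝ] F, (L : E →ₗ[ℝ] F).normDet
      = Real.sqrt (Matrix.gram ℝ fun i => L (stdOrthonormalBasis ℝ E i)).det := fun L => by
    rw [← Real.sqrt_sq (L : E →ₗ[ℝ] F).normDet_nonneg]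
    exact congrArg Real.sqrt
      ((L : E →ₗ[ℝ] F).normDet_sq_eq_det_gram (stdOrthonormalBasis ℝ E))
  simp only [hsqrt]
  refine Real.continuous_sqrt.comp (Continuous.matrix_det (continuous_matrix fun i j => ?_))
  simp only [Matrix.gram_apply]
  fun_prop

variable [MeasurableSpace E] [BorelSpace E] [MeasurableSpace F] [BorelSpace F]

open Module in
theorem exists_nhds_measure_image_le {φ : E → F} {u : E} (hφ : ContDiffAt ℝ 1 φ u)
    (hinj : Function.Injective (fderiv ℝ φ u)) {κ : NNReal} (hκ : 1 < κ) :
    ∃ V ∈ 𝓝 u, ∀ A ⊆ V, MeasurableSet A →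
      (μHE[finrank ℝ E] : Measure F) (φ '' A) ≤ (κ : ENNReal) ^ (finrank ℝ E + 1)
          * ∫⁻ a in A, ENNReal.ofReal (fderiv ℝ φ a : E →ₗ[ℝ] F).normDet ∧
        ∫⁻ a in A, ENNReal.ofReal (fderiv ℝ φ a : E →ₗ[ℝ] F).normDet
          ≤ (κ : ENNReal) ^ (finrank ℝ E + 1) * (μHE[finrank ℝ E] : Measure F) (φ '' A) := by
  set L := fderiv ℝ φ u
  obtain ⟨c, -, hc⟩ :=
    (L : E →ₗ[ℝ] F).exists_antilipschitzWith (LinearMap.ker_eq_bot.2 hinj)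
  obtain ⟨V, hV, hVφ⟩ := exists_nhds_edist_image_le (hφ.hasStrictFDerivAt one_ne_zero) hc hκ
  have hpos : 0 < (L : E →ₗ[ℝ] F).normDet := (LinearMap.normDet_nonneg _).lt_of_ne'
    (((L : E →ₗ[ℝ] F).normDet_ne_zero_tfae.out 0 4).2 hinj)
  have hcont : ContinuousAt (fun a => (fderiv ℝ φ a : E →ₗ[ℝ] F).normDet) u :=
    continuous_normDet.continuousAt.comp (hφ.fderiv_right (m := 0) (by norm_num)).continuousAt
  obtain ⟨V', hV', hJ⟩ := exists_nhds_setLIntegral_ofReal_le volume hcont hpos hκ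
  refine ⟨V ∩ V', inter_mem hV hV', fun A hA hAm => ?_⟩
  obtain ⟨hJ₁, hJ₂⟩ := hJ A (hA.trans Set.inter_subset_right) hAm
  have hφL := euclideanHausdorffMeasure_image_le_of_edist_le (finrank ℝ E)
    fun a ha b hb => (hVφ a (hA ha).1 b (hA hb).1).1
  have hLφ := euclideanHausdorffMeasure_image_le_of_edist_le (finrank ℝ E)
    fun a ha b hb => (hVφ a (hA ha).1 b (hA hb).1).2
  have hlinear := (L : E →ₗ[ℝ] F).euclideanHausdorffMeasure_image_eq_normDet_mul_volume A
  rw [ContinuousLinearMap.coe_coe] at hlinear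
  rw [hlinear] at hφL hLφ
  constructor
  · calc _ ≤ _ := hφL
      _ ≤ (κ : ENNReal) ^ finrank ℝ E * _ := mul_le_mul_right hJ₁ _
      _ = _ := by rw [pow_succ, mul_assoc]
  · calc _ ≤ _ := hJ₂
      _ ≤ (κ : ENNReal) * _ := mul_le_mul_right hLφ _
      _ = _ := by rw [pow_succ']; ring

open Module in
theorem euclideanHausdorffMeasure_image_eq_lintegral {φ : E → F} {O : Set E} (hO : IsOpen O)
    (hφ : ContDiffOn ℝ 1 φ O) (hinj : Set.InjOn φ O)
    (himm : ∀ u ∈ O, Function.Injective (fderiv ℝ φ u)) {A : Set E} (hA : A ⊆ O)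
    (hAm : MeasurableSet A) :
    (μHE[finrank ℝ E] : Measure F) (φ '' A)
      = ∫⁻ a in A, ENNReal.ofReal (fderiv ℝ φ a : E →ₗ[ℝ] F).normDet := by
  have hemb : MeasurableEmbedding (O.domRestrict φ) :=
    hφ.continuousOn.measurableEmbedding hO.measurableSet hinj
  set μ : Measure O := (μHE[finrank ℝ E] : Measure F).comap (O.domRestrict φ) with hμ
  set ν : Measure O := (volume.withDensity fun a =>
    ENNReal.ofReal (fderiv ℝ φ a : E →ₗ[ℝ] F).normDet).comap Subtype.val with hν
  have hμB : ∀ B : Set O, μ B = (μHE[finrank ℝ E] : Measure F) (φ '' (Subtype.val '' B)) :=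
    fun B => by rw [hμ, hemb.comap_apply, Set.domRestrict_eq, Set.image_comp]
  have hνB : ∀ B : Set O, MeasurableSet B → ν B
      = ∫⁻ a in Subtype.val '' B, ENNReal.ofReal (fderiv ℝ φ a : E →ₗ[ℝ] F).normDet :=
    fun B hB => by
      rw [hν, comap_subtype_coe_apply hO.measurableSet,
        withDensity_apply _ (hO.measurableSet.subtype_image hB)]
  have hcomp : ∀ κ : NNReal, 1 < κ → μ ≤ (κ ^ (finrank ℝ E + 1)) • ν ∧
      ν ≤ (κ ^ (finrank ℝ E + 1)) • μ := fun κ hκ => by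
    have hloc := fun u : O => exists_nhds_measure_image_le
      (hφ.contDiffAt (hO.mem_nhds u.2)) (himm u u.2) hκ
    constructor <;> refine measure_le_of_forall_exists_nhds fun u => ?_ <;>
      obtain ⟨V, hV, hVA⟩ := hloc u <;>
      refine ⟨Subtype.val ⁻¹' V, continuous_subtype_val.continuousAt hV, fun B hB hBm => ?_⟩ <;>
      have := hVA (Subtype.val '' B) (Set.image_subset_iff.2 hB)
        (hO.measurableSet.subtype_image hBm) <;>
      rw [Measure.smul_apply, hμB, hνB B hBm, ENNReal.smul_def, smul_eq_mul, ENNReal.coe_pow]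
    exacts [this.1, this.2]
  have hAO : (Subtype.val '' (Subtype.val ⁻¹' A : Set O)) = A :=
    Subtype.image_preimage_coe O A ▸ Set.inter_eq_right.2 hA
  have hμA := hμB (Subtype.val ⁻¹' A)
  have hνA := hνB _ (measurable_subtype_coe hAm)
  rw [hAO] at hμA hνA
  rw [← hμA, ← hνA]
  exact le_antisymm
    (le_of_forall_one_lt_le_pow_mul _ fun κ hκ => by
      simpa [ENNReal.smul_def] using (hcomp κ hκ).1 (Subtype.val ⁻¹' A))
    (le_of_forall_one_lt_le_pow_mul _ fun κ hκ => by
      simpa [ENNReal.smul_def] using (hcomp κ hκ).2 (Subtype.val ⁻¹' A))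

end AreaFormula

section Ray

variable {V : Type*} [NormedAddCommGroup V] [NormedSpace ℝ V]

theorem norm_smul_coe_sphere (θ : sphere (0 : V) 1) {t : ℝ} (ht : 0 ≤ t) : ‖t • (θ : V)‖ = t := by
  rw [norm_smul, Real.norm_of_nonneg ht, norm_eq_of_mem_sphere, mul_one]

theorem smul_coe_sphere_mem_ball (θ : sphere (0 : V) 1) {r t : ℝ} (ht : t ∈ Set.Ico 0 r) :
    t • (θ : V) ∈ ball (0 : V) r := by
  rw [mem_ball_zero_iff, norm_smul_coe_sphere θ ht.1]
  exact ht.2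

theorem tendsto_smul_nhdsGT_zero (v : V) : Tendsto (fun t : ℝ => t • v) (𝓝[>] 0) (𝓝 0) := by
  have : Continuous fun t : ℝ => t • v := by fun_prop
  simpa using (this.tendsto 0).mono_left nhdsWithin_le_nhds

variable {E : Type*} [NormedAddCommGroup E] [NormedSpace ℝ E]

theorem hasDerivAt_iteratedFDeriv_smul {f : V → E} {v : V} {t : ℝ} {j N : ℕ} (hj : j < N)
    (hf : ContDiffAt ℝ N f (t • v)) :
    HasDerivAt (fun t : ℝ => iteratedFDeriv ℝ j f (t • v) fun _ => v)
      (iteratedFDeriv ℝ (j + 1) f (t • v) fun _ => v) t := by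
  have hline : HasDerivAt (fun t : ℝ => t • v) v t := by
    simpa using (hasDerivAt_id t).smul_const v
  have hiter := (hf.differentiableAt_iteratedFDeriv
    (by exact_mod_cast hj)).hasFDerivAt.comp_hasDerivAt t hline
  refine ((ContinuousMultilinearMap.apply ℝ (fun _ : Fin j => V) E
    fun _ => v).hasFDerivAt.comp_hasDerivAt t hiter).congr_deriv ?_
  rw [iteratedFDeriv_succ_apply_left]
  rfl

theorem hasUniformExpansion_ray {I : Type*} {N : ℕ} {a : I → V → E} {r K : ℝ} (hr : 0 < r)
    (ha : ∀ i, ContDiffOn ℝ N (a i) (ball 0 r))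
    (hK : ∀ i, ∀ j ≤ N, ∀ u ∈ ball 0 r, ‖iteratedFDeriv ℝ j (a i) u‖ ≤ K) (ℓ : E →L[ℝ] ℝ) :
    HasUniformExpansion N (fun (p : I × sphere (0 : V) 1) t => ℓ (a p.1 (t • (p.2 : V)))) := by
  have hchain := HasUniformExpansion.of_hasDerivAt_chain (N := N) (R := r) (K := ‖ℓ‖ * |K|)
    (F := fun j (p : I × sphere (0 : V) 1) t =>
      ℓ (iteratedFDeriv ℝ j (a p.1) (t • (p.2 : V)) fun _ => (p.2 : V))) hr ?_ ?_
  · simpa only [iteratedFDeriv_zero_apply] using hchain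
  · rintro j hj ⟨i, θ⟩ t ht
    exact ℓ.hasFDerivAt.comp_hasDerivAt t (hasDerivAt_iteratedFDeriv_smul hj
      ((ha i).contDiffAt (isOpen_ball.mem_nhds (smul_coe_sphere_mem_ball θ ht))))
  · rintro j hj ⟨i, θ⟩ t ht
    refine (ℓ.le_opNorm _).trans ?_
    gcongr
    refine (ContinuousMultilinearMap.le_opNorm _ _).trans ?_
    simp only [norm_eq_of_mem_sphere, Finset.prod_const_one, mul_one]
    exact (hK i j hj _ (smul_coe_sphere_mem_ball θ ht)).trans (le_abs_self K)

end Ray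

/-! ### Graphs with bounded derivatives -/

/-- A `C^k` graph `u ↦ L u + h u` over the ball of radius `r` in an `m`-plane of `ℝⁿ`, tangent to
the plane at the origin, with derivatives of `h` bounded by `K` and slope at most `1 / 2`. Sheets
of the manifolds of bounded geometry are translates of such graphs. -/
structure GraphDatum (m n k : ℕ) (r K : ℝ) where
  L : Euc m →ₗᵢ[ℝ] Euc n
  h : Euc m → Euc n
  contDiffOn : ContDiffOn ℝ k h (ball 0 r)
  h_zero : h 0 = 0
  fderiv_zero : fderiv ℝ h 0 = 0
  inner_eq_zero : ∀ u ∈ ball 0 r, ∀ v, inner ℝ (L v) (h u) = 0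
  norm_iteratedFDeriv_le : ∀ j ≤ k, ∀ u ∈ ball 0 r, ‖iteratedFDeriv ℝ j h u‖ ≤ K
  norm_fderiv_le : ∀ u ∈ ball 0 r, ‖fderiv ℝ h u‖ ≤ 1 / 2

namespace GraphDatum

variable {m n k : ℕ} {r K : ℝ} (d : GraphDatum m n k r K)

/-- The parametrization of the graph. -/
def map (u : Euc m) : Euc n := d.L u + d.h u

theorem map_zero : d.map 0 = 0 := by simp only [map, LinearIsometry.map_zero, d.h_zero, add_zero]

theorem map_sub_map (u v : Euc m) : d.map u - d.map v = d.L (u - v) + (d.h u - d.h v) := by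
  simp only [map, map_sub]
  abel

theorem contDiffOn_map : ContDiffOn ℝ k d.map (ball 0 r) :=
  d.L.contDiff.contDiffOn.add d.contDiffOn

theorem differentiableAt_h (hk : 1 ≤ k) {u : Euc m} (hu : u ∈ ball 0 r) :
    DifferentiableAt ℝ d.h u :=
  (d.contDiffOn.contDiffAt (isOpen_ball.mem_nhds hu)).differentiableAt
    (by exact_mod_cast (by omega : k ≠ 0))

theorem fderiv_map (hk : 1 ≤ k) {u : Euc m} (hu : u ∈ ball 0 r) :
    fderiv ℝ d.map u = d.L.toContinuousLinearMap + fderiv ℝ d.h u :=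
  (d.L.toContinuousLinearMap.hasFDerivAt.add (d.differentiableAt_h hk hu).hasFDerivAt).fderiv

theorem fderiv_map_zero (hr : 0 < r) (hk : 1 ≤ k) :
    fderiv ℝ d.map 0 = d.L.toContinuousLinearMap := by
  rw [d.fderiv_map hk (mem_ball_self hr), d.fderiv_zero, add_zero]

theorem continuousAt_fderiv_map (hk : 1 ≤ k) {u : Euc m} (hu : u ∈ ball 0 r) :
    ContinuousAt (fderiv ℝ d.map) u :=
  ((d.contDiffOn_map.contDiffAt (isOpen_ball.mem_nhds hu)).fderiv_right (m := 0)
    (by rw [zero_add]; exact_mod_cast hk)).continuousAt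

theorem injective_fderiv_map (hk : 1 ≤ k) {u : Euc m} (hu : u ∈ ball 0 r) :
    Function.Injective (fderiv ℝ d.map u) := by
  refine (injective_iff_map_eq_zero _).2 fun v hv => ?_
  rw [d.fderiv_map hk hu] at hv
  have hneg : d.L v = -fderiv ℝ d.h u v := eq_neg_of_add_eq_zero_left hv
  have hslope := (fderiv ℝ d.h u).le_of_opNorm_le (d.norm_fderiv_le u hu) v
  rw [← norm_neg, ← hneg, d.L.norm_map] at hslope
  exact norm_le_zero_iff.1 (by linarith)

theorem norm_h_sub_le (hk : 1 ≤ k) {u v : Euc m} (hu : u ∈ ball 0 r) (hv : v ∈ ball 0 r) :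
    ‖d.h u - d.h v‖ ≤ 1 / 2 * ‖u - v‖ :=
  (convex_ball (0 : Euc m) r).norm_image_sub_le_of_norm_fderiv_le (𝕜 := ℝ)
    (fun _ hw => d.differentiableAt_h hk hw) d.norm_fderiv_le hv hu

theorem norm_h_le (hk : 1 ≤ k) {u : Euc m} (hu : u ∈ ball 0 r) :
    ‖d.h u‖ ≤ 1 / 2 * ‖u‖ := by
  simpa only [d.h_zero, sub_zero] using d.norm_h_sub_le hk hu (mem_ball_self (pos_of_mem_ball hu))

theorem norm_sub_le_norm_map_sub {u v : Euc m} (hu : u ∈ ball 0 r) (hv : v ∈ ball 0 r) :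
    ‖u - v‖ ≤ ‖d.map u - d.map v‖ := by
  have horth : inner ℝ (d.L (u - v)) (d.h u - d.h v) = 0 := by
    rw [inner_sub_right, d.inner_eq_zero u hu, d.inner_eq_zero v hv, sub_zero]
  have hpyth := norm_add_sq_real (d.L (u - v)) (d.h u - d.h v)
  rw [horth, d.L.norm_map, ← d.map_sub_map] at hpyth
  exact abs_le_of_sq_le_sq' (by nlinarith [sq_nonneg ‖d.h u - d.h v‖]) (norm_nonneg _) |>.2

theorem norm_map_sub_le (hk : 1 ≤ k) {u v : Euc m} (hu : u ∈ ball 0 r) (hv : v ∈ ball 0 r) :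
    ‖d.map u - d.map v‖ ≤ 3 / 2 * ‖u - v‖ := by
  rw [d.map_sub_map]
  refine (norm_add_le _ _).trans ?_
  rw [d.L.norm_map]
  linarith [d.norm_h_sub_le hk hu hv]

theorem injOn_map : Set.InjOn d.map (ball 0 r) := fun u hu v hv huv => by
  have := d.norm_sub_le_norm_map_sub hu hv
  rw [huv, sub_self, norm_zero] at this
  exact sub_eq_zero.1 (norm_le_zero_iff.1 this)

theorem norm_map_sq {u : Euc m} (hu : u ∈ ball 0 r) :
    ‖d.map u‖ ^ 2 = ‖u‖ ^ 2 + ‖d.h u‖ ^ 2 := by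
  rw [map, norm_add_sq_real, d.inner_eq_zero u hu, d.L.norm_map]
  ring

theorem norm_le_norm_map {u : Euc m} (hu : u ∈ ball 0 r) : ‖u‖ ≤ ‖d.map u‖ := by
  simpa only [d.map_zero, sub_zero] using
    d.norm_sub_le_norm_map_sub hu (mem_ball_self (pos_of_mem_ball hu))

theorem norm_map_le (hk : 1 ≤ k) {u : Euc m} (hu : u ∈ ball 0 r) :
    ‖d.map u‖ ≤ 3 / 2 * ‖u‖ := by
  simpa only [d.map_zero, sub_zero] using
    d.norm_map_sub_le hk hu (mem_ball_self (pos_of_mem_ball hu))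

end GraphDatum

/-- A graph together with a unit vector `θ` of its parameter plane, standing for the ray of the
graph in direction `θ`. Expansions are taken in the parameter of the ray, uniformly over `Ray`. -/
abbrev Ray (m n k : ℕ) (r K : ℝ) : Type := GraphDatum m n k r K × sphere (0 : Euc m) 1

namespace Ray

variable {m n k N : ℕ} {r K : ℝ} (p : Ray m n k r K)

/-- The square of the slope of the secant from the origin to the point of the ray at `t`. -/
def secantSq (t : ℝ) : ℝ := ‖p.1.h (t • (p.2 : Euc m))‖ ^ 2 / t ^ 2

/-- The cosine `t / ‖map (t • θ)‖` of the angle between that secant and the parameter plane,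
continued by `1` to `t = 0`. -/
def cosSecant (t : ℝ) : ℝ := (Real.sqrt (1 + secantSq p t))⁻¹

/-- The Jacobian of the parametrization along the ray. -/
def jac (t : ℝ) : ℝ := (fderiv ℝ p.1.map (t • (p.2 : Euc m)) : Euc m →ₗ[ℝ] Euc n).normDet

theorem secantSq_eq (t : ℝ) : p.secantSq t = ∑ l, (p.1.h (t • (p.2 : Euc m)) l / t) ^ 2 := by
  simp only [secantSq, EuclideanSpace.real_norm_sq_eq, Finset.sum_div, div_pow]

theorem tendsto_h_smul (hr : 0 < r) (hk : 1 ≤ k) (l : Fin n) :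
    Tendsto (fun t : ℝ => p.1.h (t • (p.2 : Euc m)) l) (𝓝[>] 0) (𝓝 0) := by
  have hh := (p.1.differentiableAt_h hk (mem_ball_self hr)).continuousAt.tendsto.comp
    (tendsto_smul_nhdsGT_zero (p.2 : Euc m))
  rw [p.1.h_zero] at hh
  exact ((EuclideanSpace.proj (𝕜 := ℝ) l).continuous.tendsto 0).comp hh

theorem tendsto_h_smul_div (hr : 0 < r) (hk : 1 ≤ k) (l : Fin n) :
    Tendsto (fun t : ℝ => p.1.h (t • (p.2 : Euc m)) l / t) (𝓝[>] 0) (𝓝 0) := by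
  have hslope := ((p.1.differentiableAt_h hk (mem_ball_self hr)).hasFDerivAt.hasLineDerivAt
    (p.2 : Euc m)).tendsto_slope_zero_right
  simp only [p.1.fderiv_zero, zero_add, p.1.h_zero, sub_zero,
    zero_apply] at hslope
  refine (((EuclideanSpace.proj (𝕜 := ℝ) l).continuous.tendsto 0).comp hslope).congr fun t => ?_
  simp [div_eq_inv_mul]

theorem tendsto_secantSq (hr : 0 < r) (hk : 1 ≤ k) : Tendsto p.secantSq (𝓝[>] 0) (𝓝 0) := by
  have hsum := tendsto_finsetSum Finset.univ fun l _ => (p.tendsto_h_smul_div hr hk l).pow 2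
  simp only [zero_pow two_ne_zero, Finset.sum_const_zero] at hsum
  exact hsum.congr fun t => (p.secantSq_eq t).symm

theorem hasUniformExpansion_secantSq (hr : 0 < r) (hk : N + 1 ≤ k) :
    HasUniformExpansion N (secantSq (m := m) (n := n) (k := k) (r := r) (K := K)) := by
  have hh : ∀ l : Fin n, HasUniformExpansion (N + 1)
      (fun (p : Ray m n k r K) t => p.1.h (t • (p.2 : Euc m)) l) := fun l =>
    hasUniformExpansion_ray (a := fun d : GraphDatum m n k r K => d.h) hr
      (fun d => d.contDiffOn.of_le (by exact_mod_cast hk))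
      (fun d j hj => d.norm_iteratedFDeriv_le j (hj.trans hk)) (EuclideanSpace.proj (𝕜 := ℝ) l)
  have hdiv : ∀ l : Fin n, HasUniformExpansion N
      (fun (p : Ray m n k r K) t => p.1.h (t • (p.2 : Euc m)) l / t) := fun l => by
    simpa only [sub_zero] using (hh l).sub_div_X fun p => p.tendsto_h_smul hr (by omega) l
  exact (HasUniformExpansion.sum (s := Finset.univ) fun l _ => (hdiv l).pow 2).congr
    (.of_forall fun t p => (p.secantSq_eq t).symm)

theorem hasUniformExpansion_cosSecant (hr : 0 < r) (hk : N + 2 ≤ k) :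
    HasUniformExpansion (N + 1) (cosSecant (m := m) (n := n) (k := k) (r := r) (K := K)) := by
  have htendsto : ∀ p : Ray m n k r K, Tendsto (fun t => 1 + p.secantSq t) (𝓝[>] 0) (𝓝 1) :=
    fun p => by simpa only [add_zero] using (p.tendsto_secantSq hr (by omega)).const_add 1
  exact (HasUniformExpansion.one.add (hasUniformExpansion_secantSq hr hk)).comp_analytic
    (G := fun y => (Real.sqrt y)⁻¹) htendsto
    ((Real.contDiffAt_sqrt one_ne_zero).analyticAt.inv (by simp))

theorem hasUniformExpansion_fderiv_map_apply (hr : 0 < r) (hk : N + 1 ≤ k) (v : Euc m)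
    (l : Fin n) : HasUniformExpansion N
      (fun (p : Ray m n k r K) t => fderiv ℝ p.1.map (t • (p.2 : Euc m)) v l) := by
  have hfderiv : HasUniformExpansion N
      (fun (p : Ray m n k r K) t => fderiv ℝ p.1.h (t • (p.2 : Euc m)) v l) :=
    hasUniformExpansion_ray (a := fun d : GraphDatum m n k r K => fderiv ℝ d.h) (K := K) hr
      (fun d => d.contDiffOn.fderiv_of_isOpen isOpen_ball (by exact_mod_cast hk))
      (fun d j hj u hu => by
        rw [norm_iteratedFDeriv_fderiv]
        exact d.norm_iteratedFDeriv_le (j + 1) (by omega) u hu)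
      ((EuclideanSpace.proj (𝕜 := ℝ) l).comp (ContinuousLinearMap.apply ℝ (Euc n) v))
  have hL : ∀ p : Ray m n k r K, |p.1.L v l| ≤ ‖v‖ := fun p =>
    (PiLp.norm_apply_le (p.1.L v) l).trans_eq (p.1.L.norm_map v)
  refine ((HasUniformExpansion.of_const hL).add hfderiv).congr ?_
  filter_upwards [Ioo_mem_nhdsGT hr] with t ht p
  rw [p.1.fderiv_map (by omega) (smul_coe_sphere_mem_ball p.2 ⟨ht.1.le, ht.2⟩)]
  rfl

theorem tendsto_jac (hr : 0 < r) (hk : 1 ≤ k) : Tendsto p.jac (𝓝[>] 0) (𝓝 1) := by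
  have hone : (fderiv ℝ p.1.map 0 : Euc m →ₗ[ℝ] Euc n).normDet = 1 := by
    rw [p.1.fderiv_map_zero hr hk]
    exact p.1.L.normDet_eq_one
  rw [← hone]
  exact (continuous_normDet.tendsto _).comp
    ((p.1.continuousAt_fderiv_map hk (mem_ball_self hr)).tendsto.comp
      (tendsto_smul_nhdsGT_zero _))

theorem hasUniformExpansion_jac (hr : 0 < r) (hk : N + 2 ≤ k) :
    HasUniformExpansion (N + 1) (jac (m := m) (n := n) (k := k) (r := r) (K := K)) := by
  set e := EuclideanSpace.basisFun (Fin m) ℝ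
  have hgram : HasUniformExpansion (N + 1) (fun (p : Ray m n k r K) t =>
      (Matrix.gram ℝ fun i => fderiv ℝ p.1.map (t • (p.2 : Euc m)) (e i)).det) := by
    refine .det fun i j => ?_
    simp only [Matrix.gram_apply, PiLp.inner_apply]
    exact .sum fun l _ => (hasUniformExpansion_fderiv_map_apply hr hk (e j) l).mul
      (hasUniformExpansion_fderiv_map_apply hr hk (e i) l)
  have hsq : ∀ (p : Ray m n k r K) t, p.jac t ^ 2
      = (Matrix.gram ℝ fun i => fderiv ℝ p.1.map (t • (p.2 : Euc m)) (e i)).det := fun p t =>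
    (fderiv ℝ p.1.map (t • (p.2 : Euc m)) : Euc m →ₗ[ℝ] Euc n).normDet_sq_eq_det_gram e
  have hjac : HasUniformExpansion (N + 1) (fun (p : Ray m n k r K) t => p.jac t ^ 2) :=
    hgram.congr (.of_forall fun t p => (hsq p t).symm)
  refine (hjac.comp_analytic (fun p => ?_) (Real.contDiffAt_sqrt one_ne_zero).analyticAt).congr
    (.of_forall fun t p => Real.sqrt_sq (LinearMap.normDet_nonneg _))
  simpa only [one_pow] using (p.tendsto_jac hr (by omega)).pow 2

end Ray

namespace Ray

variable {m n k N : ℕ} {r K : ℝ} (p : Ray m n k r K)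

theorem strictMonoOn_norm_map_smul (hk : 1 ≤ k) :
    StrictMonoOn (fun s : ℝ => ‖p.1.map (s • (p.2 : Euc m))‖) (Set.Ico 0 r) := by
  intro s hs s' hs' hlt
  have hu := smul_coe_sphere_mem_ball p.2 hs
  have hu' := smul_coe_sphere_mem_ball p.2 hs'
  have hsub := p.1.norm_h_sub_le hk hu hu'
  rw [← sub_smul, norm_sub_rev, norm_smul, norm_eq_of_mem_sphere, mul_one, Real.norm_eq_abs,
    abs_of_neg (sub_neg.2 hlt), norm_sub_rev] at hsub
  have hle := p.1.norm_h_le hk hu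
  have hle' := p.1.norm_h_le hk hu'
  rw [norm_smul_coe_sphere p.2 hs.1] at hle
  rw [norm_smul_coe_sphere p.2 hs'.1] at hle'
  refine lt_of_pow_lt_pow_left₀ 2 (norm_nonneg _) ?_
  rw [p.1.norm_map_sq hu, p.1.norm_map_sq hu', norm_smul_coe_sphere p.2 hs.1,
    norm_smul_coe_sphere p.2 hs'.1]
  set a := ‖p.1.h (s • (p.2 : Euc m))‖
  set b := ‖p.1.h (s' • (p.2 : Euc m))‖
  have hab : a - b ≤ 1 / 2 * (s' - s) := (norm_sub_norm_le _ _).trans (by linarith)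
  have hmul : (a - b) * (a + b) ≤ 1 / 2 * (s' - s) * (1 / 2 * (s + s')) :=
    mul_le_mul hab (by linarith) (add_nonneg (norm_nonneg _) (norm_nonneg _)) (by linarith)
  nlinarith [mul_pos (sub_pos.2 hlt) (add_pos_of_nonneg_of_pos hs.1 (hs.1.trans_lt hlt))]

/-- The parameter at which the ray leaves the ball of radius `t`, meaningful for `0 ≤ t < r`. -/
def radius (t : ℝ) : ℝ :=
  Function.invFunOn (fun s : ℝ => ‖p.1.map (s • (p.2 : Euc m))‖) (Set.Ico 0 r) t

theorem radius_mem_Ico_and_norm_map_radius {t : ℝ} (ht : t ∈ Set.Ico 0 r) :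
    p.radius t ∈ Set.Ico 0 r ∧ ‖p.1.map (p.radius t • (p.2 : Euc m))‖ = t := by
  have hcont : ContinuousOn (fun s : ℝ => ‖p.1.map (s • (p.2 : Euc m))‖) (Set.Icc 0 t) :=
    (p.1.contDiffOn_map.continuousOn.comp (by fun_prop) fun s hs =>
      smul_coe_sphere_mem_ball p.2 ⟨hs.1, hs.2.trans_lt ht.2⟩).norm
  have hle := p.1.norm_le_norm_map (smul_coe_sphere_mem_ball p.2 ht)
  rw [norm_smul_coe_sphere p.2 ht.1] at hle
  obtain ⟨τ, hτ, hτt⟩ := intermediate_value_Icc ht.1 hcont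
    ⟨by simpa only [zero_smul, p.1.map_zero, norm_zero] using ht.1, hle⟩
  have himg : t ∈ (fun s : ℝ => ‖p.1.map (s • (p.2 : Euc m))‖) '' Set.Ico 0 r :=
    ⟨τ, ⟨hτ.1, hτ.2.trans_lt ht.2⟩, hτt⟩
  exact ⟨Function.invFunOn_mem himg, Function.invFunOn_eq himg⟩

theorem norm_map_smul_lt_iff (hk : 1 ≤ k) {s t : ℝ} (hs : s ∈ Set.Ico 0 r)
    (ht : t ∈ Set.Ico 0 r) : ‖p.1.map (s • (p.2 : Euc m))‖ < t ↔ s < p.radius t := by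
  obtain ⟨hmem, heq⟩ := p.radius_mem_Ico_and_norm_map_radius ht
  rw [← (p.strictMonoOn_norm_map_smul hk).lt_iff_lt hs hmem, heq]

theorem radius_mem_Ioc {t : ℝ} (ht : t ∈ Set.Ioo 0 r) : p.radius t ∈ Set.Ioc 0 t := by
  obtain ⟨hmem, heq⟩ := p.radius_mem_Ico_and_norm_map_radius (Set.Ioo_subset_Ico_self ht)
  have hle := p.1.norm_le_norm_map (smul_coe_sphere_mem_ball p.2 hmem)
  rw [heq, norm_smul_coe_sphere p.2 hmem.1] at hle
  refine ⟨hmem.1.lt_of_ne fun h0 => ht.1.ne ?_, hle⟩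
  rwa [← h0, zero_smul, p.1.map_zero, norm_zero] at heq

theorem eventually_radius_mem_Ioc (hr : 0 < r) :
    ∀ᶠ t in 𝓝[>] 0, ∀ p : Ray m n k r K, p.radius t ∈ Set.Ioc 0 t := by
  filter_upwards [Ioo_mem_nhdsGT hr] with t ht p using p.radius_mem_Ioc ht

theorem radius_div_eq_cosSecant {t : ℝ} (ht : t ∈ Set.Ioo 0 r) :
    p.radius t / t = p.cosSecant (p.radius t) := by
  obtain ⟨hmem, heq⟩ := p.radius_mem_Ico_and_norm_map_radius (Set.Ioo_subset_Ico_self ht)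
  have hτ0 := (p.radius_mem_Ioc ht).1
  have hsq := p.1.norm_map_sq (smul_coe_sphere_mem_ball p.2 hmem)
  rw [heq, norm_smul_coe_sphere p.2 hmem.1] at hsq
  have hsec : t = p.radius t * Real.sqrt (1 + p.secantSq (p.radius t)) := by
    set τ := p.radius t
    calc t = Real.sqrt (t ^ 2) := (Real.sqrt_sq ht.1.le).symm
      _ = Real.sqrt (τ ^ 2 * (1 + p.secantSq τ)) := by
        rw [hsq, secantSq, mul_add, mul_one, mul_div_cancel₀ _ (pow_ne_zero 2 hτ0.ne')]
      _ = τ * Real.sqrt (1 + p.secantSq τ) := by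
        rw [Real.sqrt_mul (sq_nonneg τ), Real.sqrt_sq hτ0.le]
  have hpos : 0 < Real.sqrt (1 + p.secantSq (p.radius t)) :=
    Real.sqrt_pos.2 (by unfold secantSq; positivity)
  rw [cosSecant, div_eq_iff ht.1.ne', inv_mul_eq_div, eq_div_iff hpos.ne', ← hsec]

/- `radius` is only known implicitly, through `radius t / t = cosSecant (radius t)`. Substituting an
expansion of order `j` into the right-hand side yields one of order `j + 1` on the left. -/
theorem hasUniformExpansion_radius_div (hr : 0 < r) (hk : N + 2 ≤ k) :
    HasUniformExpansion (N + 1) (fun (p : Ray m n k r K) t => p.radius t / t) := by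
  suffices ∀ j ≤ N + 1, HasUniformExpansion j
      (fun (p : Ray m n k r K) t => p.radius t / t) from this _ le_rfl
  intro j hj
  induction j with
  | zero =>
    refine .of_bound (K := 1) ?_
    filter_upwards [eventually_radius_mem_Ioc hr] with t ht p
    have ht0 := (ht p).1.trans_le (ht p).2
    rw [abs_of_pos (div_pos (ht p).1 ht0), pow_zero, mul_one]
    exact div_le_one_of_le₀ (ht p).2 ht0.le
  | succ j ih =>
    have hradius : HasUniformExpansion (j + 1) (radius (m := m) (n := n) (k := k) (K := K)) :=
      (ih (by omega)).X_mul.congr <| by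
        filter_upwards [self_mem_nhdsWithin] with t ht p using mul_div_cancel₀ _ (ne_of_gt ht)
    refine (((hasUniformExpansion_cosSecant hr hk).mono hj).comp_reparam hradius
      (eventually_radius_mem_Ioc hr)).congr ?_
    filter_upwards [Ioo_mem_nhdsGT hr] with t ht p using (p.radius_div_eq_cosSecant ht).symm

theorem hasUniformExpansion_radius (hr : 0 < r) (hk : N + 2 ≤ k) :
    HasUniformExpansion (N + 1) (radius (m := m) (n := n) (k := k) (r := r) (K := K)) :=
  (hasUniformExpansion_radius_div hr hk).X_mul.of_succ.congr <| by
    filter_upwards [self_mem_nhdsWithin] with t ht p using mul_div_cancel₀ _ (ne_of_gt ht)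

/-! ### The volume of small balls in a graph -/

theorem jac_nonneg (t : ℝ) : 0 ≤ p.jac t := LinearMap.normDet_nonneg _

theorem measurable_jac : Measurable p.jac :=
  continuous_normDet.measurable.comp ((measurable_fderiv ℝ p.1.map).comp (by fun_prop))

theorem continuousOn_jac (hk : 1 ≤ k) : ContinuousOn p.jac (Set.Ico 0 r) := fun s hs => by
  have hfderiv : ContinuousAt (fun s : ℝ => fderiv ℝ p.1.map (s • (p.2 : Euc m))) s :=
    ContinuousAt.comp (f := fun s : ℝ => s • (p.2 : Euc m))
      (p.1.continuousAt_fderiv_map hk (smul_coe_sphere_mem_ball p.2 hs)) (by fun_prop)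
  exact (continuous_normDet.continuousAt.comp hfderiv).continuousWithinAt

/-- The volume, per unit of solid angle, of the part of the graph over the ray that lies in the
ball of radius `t`. -/
def sectorVolume (t : ℝ) : ℝ := ∫ s in (0 : ℝ)..p.radius t, p.jac s * s ^ (m - 1)

theorem intervalIntegrable_jac_mul_pow (hk : 1 ≤ k) {t : ℝ} (ht : t ∈ Set.Ioo 0 r) :
    IntervalIntegrable (fun s => p.jac s * s ^ (m - 1)) volume 0 (p.radius t) := by
  have hτ := p.radius_mem_Ioc ht
  refine ContinuousOn.intervalIntegrable ?_
  rw [Set.uIcc_of_le hτ.1.le]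
  exact ((p.continuousOn_jac hk).mono fun s hs =>
    ⟨hs.1, hs.2.trans_lt (hτ.2.trans_lt ht.2)⟩).mul (by fun_prop)

theorem sectorVolume_nonneg {t : ℝ} (ht : t ∈ Set.Ioo 0 r) : 0 ≤ p.sectorVolume t :=
  intervalIntegral.integral_nonneg (p.radius_mem_Ioc ht).1.le fun s hs =>
    mul_nonneg (p.jac_nonneg s) (pow_nonneg hs.1 _)

theorem sectorVolume_eq (hm : 1 ≤ m) (t : ℝ) : p.sectorVolume t
    = p.radius t ^ m * ∫ s : Set.Ioc (0 : ℝ) 1, (s : ℝ) ^ (m - 1) * p.jac (s * p.radius t)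
      ∂volume.comap Subtype.val := by
  rw [integral_subtype_comap measurableSet_Ioc
    (fun s : ℝ => s ^ (m - 1) * p.jac (s * p.radius t)),
    ← intervalIntegral.integral_of_le zero_le_one]
  have hscale := intervalIntegral.mul_integral_comp_mul_right (a := 0) (b := 1)
    (f := fun s => p.jac s * s ^ (m - 1)) (p.radius t)
  rw [zero_mul, one_mul] at hscale
  rw [sectorVolume, ← hscale, ← mul_pow_sub_one (by omega : m ≠ 0), mul_assoc,
    ← intervalIntegral.integral_const_mul (p.radius t ^ (m - 1))]
  congr 2 with s
  ring

theorem hasUniformExpansion_sectorVolume (hm : 1 ≤ m) (hr : 0 < r) (hk : N + 2 ≤ k) :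
    HasUniformExpansion (N + 1) (fun (p : Ray m n k r K) t => p.sectorVolume t / t ^ m) := by
  have hs : ∀ (j : ℕ) (q : Ray m n k r K × Set.Ioc (0 : ℝ) 1), |(q.2 : ℝ) ^ j| ≤ 1 := fun j q => by
    rw [abs_of_pos (pow_pos q.2.2.1 j)]
    exact pow_le_one₀ q.2.2.1.le q.2.2.2
  have hjac : HasUniformExpansion (N + 1) (fun (q : Ray m n k r K × Set.Ioc (0 : ℝ) 1) t =>
      q.1.jac (q.2 * q.1.radius t)) := by
    refine ((hasUniformExpansion_jac hr hk).reindex Prod.fst).comp_reparam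
      (((hasUniformExpansion_radius hr hk).reindex Prod.fst).bounded_mul (A := 1) fun q => ?_) ?_
    · simpa only [pow_one] using hs 1 q
    · filter_upwards [eventually_radius_mem_Ioc hr] with t ht q
      obtain ⟨hτ0, hτt⟩ := ht q.1
      exact ⟨mul_pos q.2.2.1 hτ0, (mul_le_of_le_one_left hτ0.le q.2.2.2).trans hτt⟩
  have : IsFiniteMeasure (volume.comap (Subtype.val : Set.Ioc (0 : ℝ) 1 → ℝ)) :=
    ⟨by
      rw [comap_subtype_coe_apply measurableSet_Ioc, Subtype.coe_image_univ]
      exact measure_Ioc_lt_top⟩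
  have hint := (hjac.bounded_mul (hs (m - 1))).integral
    (φ := fun (p : Ray m n k r K) (s : Set.Ioc (0 : ℝ) 1) t =>
      (s : ℝ) ^ (m - 1) * p.jac (s * p.radius t))
    (σ := volume.comap Subtype.val) (.of_forall fun t (p : Ray m n k r K) =>
      (by fun_prop : Measurable fun s : Set.Ioc (0 : ℝ) 1 => (s : ℝ) ^ (m - 1)).mul
        (p.measurable_jac.comp (by fun_prop)))
  refine (((hasUniformExpansion_radius_div hr hk).pow m).mul hint).congr
    (.of_forall fun t p => ?_)
  rw [p.sectorVolume_eq hm, div_pow, div_mul_eq_mul_div]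

end Ray

open Module in
theorem lintegral_eq_lintegral_toSphere {E : Type*} [NormedAddCommGroup E] [NormedSpace ℝ E]
    [FiniteDimensional ℝ E] [Nontrivial E] [MeasurableSpace E] [BorelSpace E] (μ : Measure E)
    [μ.IsAddHaarMeasure] {f : E → ENNReal} (hf : Measurable f) :
    ∫⁻ u, f u ∂μ = ∫⁻ θ : sphere (0 : E) 1, (∫⁻ s in Set.Ioi (0 : ℝ),
      f (s • (θ : E)) * ENNReal.ofReal (s ^ (finrank ℝ E - 1))) ∂μ.toSphere := by
  have hpolar : ∀ x : ({0}ᶜ : Set E), f x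
      = (fun q : sphere (0 : E) 1 × Set.Ioi (0 : ℝ) => f ((q.2 : ℝ) • (q.1 : E)))
        (homeomorphUnitSphereProd E x) := fun x => by
    have hx : ‖(x : E)‖ ≠ 0 := norm_ne_zero_iff.2 x.2
    simp [smul_smul, hx]
  have hmeas : Measurable fun q : sphere (0 : E) 1 × Set.Ioi (0 : ℝ) =>
      f ((q.2 : ℝ) • (q.1 : E)) := hf.comp (by fun_prop)
  conv_lhs => rw [← restrict_compl_singleton (μ := μ) (0 : E)]
  rw [← lintegral_subtype_comap (measurableSet_singleton _).compl, lintegral_congr hpolar,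
    μ.measurePreserving_homeomorphUnitSphereProd.lintegral_comp hmeas,
    lintegral_prod _ hmeas.aemeasurable]
  refine lintegral_congr fun θ => ?_
  rw [Measure.volumeIoiPow, lintegral_withDensity_eq_lintegral_mul _ (by fun_prop)
      (g := fun s : Set.Ioi (0 : ℝ) => f ((s : ℝ) • (θ : E)))
      (hmeas.comp measurable_prodMk_left),
    ← lintegral_subtype_comap measurableSet_Ioi
      (fun s => f (s • (θ : E)) * ENNReal.ofReal (s ^ (finrank ℝ E - 1)))]
  exact lintegral_congr fun s => mul_comm _ _

namespace GraphDatum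

variable {m n k : ℕ} {r K : ℝ} (d : GraphDatum m n k r K)

/-- The part of the parameter domain that is mapped into the ball of radius `t`. -/
def innerDomain (t : ℝ) : Set (Euc m) := ball 0 r ∩ (fun u => ‖d.map u‖) ⁻¹' Set.Iio t

theorem isOpen_innerDomain (t : ℝ) : IsOpen (d.innerDomain t) :=
  d.contDiffOn_map.continuousOn.norm.isOpen_inter_preimage isOpen_ball isOpen_Iio

theorem map_image_inter_ball (t : ℝ) :
    d.map '' ball 0 r ∩ ball 0 t = d.map '' d.innerDomain t := by
  ext y
  constructor
  · rintro ⟨⟨u, hu, rfl⟩, hy⟩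
    exact ⟨u, ⟨hu, mem_ball_zero_iff.1 hy⟩, rfl⟩
  · rintro ⟨u, ⟨hu, hy⟩, rfl⟩
    exact ⟨⟨u, hu, rfl⟩, mem_ball_zero_iff.2 hy⟩

theorem smul_mem_innerDomain_iff (hk : 1 ≤ k) (θ : sphere (0 : Euc m) 1) {s t : ℝ} (hs : 0 < s)
    (ht : t ∈ Set.Ioo 0 r) :
    s • (θ : Euc m) ∈ d.innerDomain t ↔ s ∈ Set.Ioo 0 (Ray.radius (d, θ) t) := by
  have hiff : s < r → (‖d.map (s • (θ : Euc m))‖ < t ↔ s < Ray.radius (d, θ) t) := fun hsr =>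
    Ray.norm_map_smul_lt_iff (d, θ) hk ⟨hs.le, hsr⟩ (Set.Ioo_subset_Ico_self ht)
  constructor
  · rintro ⟨hmem, hlt⟩
    rw [mem_ball_zero_iff, norm_smul_coe_sphere θ hs.le] at hmem
    exact ⟨hs, (hiff hmem).1 hlt⟩
  · rintro ⟨-, hlt⟩
    have hsr : s < r := hlt.trans_le ((Ray.radius_mem_Ioc (d, θ) ht).2.trans ht.2.le)
    exact ⟨smul_coe_sphere_mem_ball θ ⟨hs.le, hsr⟩, (hiff hsr).2 hlt⟩

/-- The Jacobian of the parametrization, restricted to `innerDomain t`. -/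
def density (t : ℝ) : Euc m → ENNReal :=
  (d.innerDomain t).indicator fun u =>
    ENNReal.ofReal (fderiv ℝ d.map u : Euc m →ₗ[ℝ] Euc n).normDet

theorem measurable_density (t : ℝ) : Measurable (d.density t) :=
  (continuous_normDet.measurable.comp (measurable_fderiv ℝ d.map)).ennreal_ofReal.indicator
    (d.isOpen_innerDomain t).measurableSet

theorem measure_map_inter_ball_eq_lintegral (hk : 1 ≤ k) (t : ℝ) :
    (μHE[m] : Measure (Euc n)) (d.map '' ball 0 r ∩ ball 0 t) = ∫⁻ u, d.density t u := by
  have harea := euclideanHausdorffMeasure_image_eq_lintegral isOpen_ball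
    (d.contDiffOn_map.of_le (by exact_mod_cast hk)) d.injOn_map
    (fun u hu => d.injective_fderiv_map hk hu) (A := d.innerDomain t) (fun u hu => hu.1)
    (d.isOpen_innerDomain t).measurableSet
  rw [finrank_euclideanSpace_fin] at harea
  rw [d.map_image_inter_ball, harea, ← lintegral_indicator (d.isOpen_innerDomain t).measurableSet]
  rfl

theorem lintegral_density_smul (hk : 1 ≤ k) (θ : sphere (0 : Euc m) 1) {t : ℝ}
    (ht : t ∈ Set.Ioo 0 r) :
    ∫⁻ s in Set.Ioi (0 : ℝ), d.density t (s • (θ : Euc m)) * ENNReal.ofReal (s ^ (m - 1))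
      = ENNReal.ofReal (Ray.sectorVolume (d, θ) t) := by
  set p : Ray m n k r K := (d, θ)
  have hindicator : ∀ s ∈ Set.Ioi (0 : ℝ),
      d.density t (s • (θ : Euc m)) * ENNReal.ofReal (s ^ (m - 1))
        = (Set.Ioo 0 (p.radius t)).indicator
          (fun s => ENNReal.ofReal (p.jac s * s ^ (m - 1))) s := fun s hs => by
    have hiff := d.smul_mem_innerDomain_iff hk θ hs ht
    by_cases hmem : s ∈ Set.Ioo 0 (p.radius t)
    · rw [density, Set.indicator_of_mem (hiff.2 hmem), Set.indicator_of_mem hmem,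
        ENNReal.ofReal_mul (p.jac_nonneg s)]
      rfl
    · rw [density, Set.indicator_of_notMem (fun h => hmem (hiff.1 h)),
        Set.indicator_of_notMem hmem, zero_mul]
  rw [setLIntegral_congr_fun measurableSet_Ioi hindicator, lintegral_indicator measurableSet_Ioo,
    Measure.restrict_restrict measurableSet_Ioo, Set.inter_eq_left.2 (fun s hs => hs.1),
    Ray.sectorVolume, intervalIntegral.integral_of_le (p.radius_mem_Ioc ht).1.le,
    ← restrict_Ioo_eq_restrict_Ioc, ofReal_integral_eq_lintegral_ofReal]
  · exact (p.intervalIntegrable_jac_mul_pow hk ht).1.mono_set Set.Ioo_subset_Ioc_self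
  · filter_upwards [ae_restrict_mem measurableSet_Ioo] with s hs
    exact mul_nonneg (p.jac_nonneg s) (pow_nonneg hs.1.le _)

theorem measurable_sectorVolume (hk : 1 ≤ k) {t : ℝ} (ht : t ∈ Set.Ioo 0 r) :
    Measurable fun θ : sphere (0 : Euc m) 1 => Ray.sectorVolume (d, θ) t := by
  have hlintegral : Measurable fun θ : sphere (0 : Euc m) 1 => ∫⁻ s in Set.Ioi (0 : ℝ),
      d.density t (s • (θ : Euc m)) * ENNReal.ofReal (s ^ (m - 1)) :=
    Measurable.lintegral_prod_right' (ν := volume.restrict (Set.Ioi (0 : ℝ)))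
      (f := fun q : sphere (0 : Euc m) 1 × ℝ =>
        d.density t (q.2 • (q.1 : Euc m)) * ENNReal.ofReal (q.2 ^ (m - 1)))
      (((d.measurable_density t).comp (by fun_prop)).mul (by fun_prop))
  simp only [d.lintegral_density_smul hk _ ht] at hlintegral
  simpa only [ENNReal.toReal_ofReal (Ray.sectorVolume_nonneg (d, _) ht)]
    using hlintegral.ennreal_toReal

theorem volume_map_inter_ball (hm : 1 ≤ m) (hk : 1 ≤ k) {t : ℝ} (ht : t ∈ Set.Ioo 0 r) :
    (μHE[m] : Measure (Euc n)).real (d.map '' ball 0 r ∩ ball 0 t)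
      = ∫ θ, Ray.sectorVolume (d, θ) t ∂(volume : Measure (Euc m)).toSphere := by
  have : Nonempty (Fin m) := ⟨⟨0, hm⟩⟩
  have hpolar := lintegral_eq_lintegral_toSphere volume (d.measurable_density t)
  simp only [finrank_euclideanSpace_fin, d.lintegral_density_smul hk _ ht] at hpolar
  rw [measureReal_def, d.measure_map_inter_ball_eq_lintegral hk, hpolar,
    integral_eq_lintegral_of_nonneg_ae
      (.of_forall fun θ => Ray.sectorVolume_nonneg (d, θ) ht)
      (d.measurable_sectorVolume hk ht).aestronglyMeasurable]

theorem hasUniformExpansion_volume {N : ℕ} (hm : 1 ≤ m) (hr : 0 < r) (hk : N + 2 ≤ k) :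
    HasUniformExpansion (N + 1) (fun (d : GraphDatum m n k r K) t =>
      (μHE[m] : Measure (Euc n)).real (d.map '' ball 0 r ∩ ball 0 t) / t ^ m) := by
  have hr_mem := Ioo_mem_nhdsGT hr
  refine ((Ray.hasUniformExpansion_sectorVolume hm hr hk).integral
    (φ := fun d θ t => Ray.sectorVolume (d, θ) t / t ^ m)
    (σ := (volume : Measure (Euc m)).toSphere) ?_).congr ?_
  · filter_upwards [hr_mem] with t ht d using
      (d.measurable_sectorVolume (by omega) ht).div_const _
  · filter_upwards [hr_mem] with t ht d
    rw [d.volume_map_inter_ball hm (by omega) ht, integral_div]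

/-- The part over `A` of the translate of the graph with origin `x`. -/
def patch (x : Euc n) (A : Set (Euc m)) : Set (Euc n) := (fun u => x + d.map u) '' A

/-- The translate of the graph with origin `x`. -/
def sheet (x : Euc n) : Set (Euc n) := d.patch x (ball 0 r)

theorem volume_sheet_inter_ball (x : Euc n) (t : ℝ) :
    (μHE[m] : Measure (Euc n)).real (d.sheet x ∩ ball x t)
      = (μHE[m] : Measure (Euc n)).real (d.map '' ball 0 r ∩ ball 0 t) := by
  have himage : d.sheet x ∩ ball x t = (fun y => x + y) '' (d.map '' ball 0 r ∩ ball 0 t) := by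
    ext y
    constructor
    · rintro ⟨⟨u, hu, rfl⟩, hy⟩
      exact ⟨d.map u, ⟨⟨u, hu, rfl⟩, by simpa [dist_eq_norm] using hy⟩, rfl⟩
    · rintro ⟨_, ⟨⟨u, hu, rfl⟩, hy⟩, rfl⟩
      exact ⟨⟨u, hu, rfl⟩, by simpa [dist_eq_norm] using hy⟩
  rw [himage, measureReal_def, (isometry_add_left x).euclideanHausdorffMeasure_image,
    ← measureReal_def]

theorem injOn_add_map (x : Euc n) : Set.InjOn (fun u => x + d.map u) (ball 0 r) :=
  fun _ hu _ hv h => d.injOn_map hu hv (add_left_cancel h)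

theorem measurableSet_patch (x : Euc n) {A : Set (Euc m)} (hA : MeasurableSet A)
    (hAr : A ⊆ ball 0 r) : MeasurableSet (d.patch x A) :=
  hA.image_of_continuousOn_injOn
    ((continuousOn_const.add d.contDiffOn_map.continuousOn).mono hAr) ((d.injOn_add_map x).mono hAr)

theorem measurableSet_sheet (x : Euc n) : MeasurableSet (d.sheet x) :=
  d.measurableSet_patch x measurableSet_ball subset_rfl

theorem patch_subset_sheet (x : Euc n) {A : Set (Euc m)} (hAr : A ⊆ ball 0 r) :
    d.patch x A ⊆ d.sheet x :=
  Set.image_mono hAr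

theorem isPreconnected_sheet (x : Euc n) : IsPreconnected (d.sheet x) :=
  (convex_ball (0 : Euc m) r).isPreconnected.image _
    (continuousOn_const.add d.contDiffOn_map.continuousOn)

theorem self_mem_sheet (hr : 0 < r) (x : Euc n) : x ∈ d.sheet x :=
  ⟨0, mem_ball_self hr, by simp only [d.map_zero, add_zero]⟩

end GraphDatum

/-! ### From bounded geometry to graphs over balls of uniform size -/

theorem norm_multilinear_le_of_orthonormalBasis {ι κ E F : Type*} [Fintype ι] [Fintype κ]
    [NormedAddCommGroup E] [InnerProductSpace ℝ E] [NormedAddCommGroup F] [NormedSpace ℝ F]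
    (e : OrthonormalBasis ι ℝ E) (f : ContinuousMultilinearMap ℝ (fun _ : κ => E) F) {b : ℝ}
    (hb : 0 ≤ b) (h : ∀ s : κ → ι, ‖f fun i => e (s i)‖ ≤ b) :
    ‖f‖ ≤ (Fintype.card ι : ℝ) ^ Fintype.card κ * b := by
  classical
  refine f.opNorm_le_bound (by positivity) fun w => ?_
  have hexpand : f w = ∑ s : κ → ι, (∏ i, inner ℝ (e (s i)) (w i)) • f fun i => e (s i) := by
    conv_lhs => rw [show w = fun i => ∑ a, inner ℝ (e a) (w i) • e a from
      funext fun i => (e.sum_repr' (w i)).symm]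
    rw [f.map_sum]
    exact Finset.sum_congr rfl fun s _ => f.map_smul_univ _ _
  have hterm : ∀ s : κ → ι,
      ‖(∏ i, inner ℝ (e (s i)) (w i)) • f fun i => e (s i)‖ ≤ (∏ i, ‖w i‖) * b := by
    intro s
    rw [norm_smul, norm_prod]
    gcongr with i
    · exact (norm_inner_le_norm _ _).trans_eq (by rw [e.orthonormal.1, one_mul])
    · exact h s
  calc ‖f w‖ ≤ ∑ _s : κ → ι, (∏ i, ‖w i‖) * b :=
        hexpand ▸ norm_sum_le_of_le _ fun s _ => hterm s
    _ = (Fintype.card ι : ℝ) ^ Fintype.card κ * b * ∏ i, ‖w i‖ := by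
        rw [Finset.sum_const, Finset.card_univ, Fintype.card_fun, nsmul_eq_mul]
        push_cast
        ring

theorem norm_fderiv_le_of_norm_iteratedFDeriv_two_le {E F : Type*} [NormedAddCommGroup E]
    [NormedSpace ℝ E] [NormedAddCommGroup F] [NormedSpace ℝ F] {f : E → F} {r B : ℝ}
    (hf : ContDiffOn ℝ 2 f (ball 0 r)) (hB : ∀ u ∈ ball 0 r, ‖iteratedFDeriv ℝ 2 f u‖ ≤ B)
    (hf0 : fderiv ℝ f 0 = 0) {u : E} (hu : u ∈ ball 0 r) : ‖fderiv ℝ f u‖ ≤ B * ‖u‖ := by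
  have hdiff : ∀ w ∈ ball (0 : E) r, DifferentiableAt ℝ (fderiv ℝ f) w := fun w hw =>
    ((hf.contDiffAt (isOpen_ball.mem_nhds hw)).fderiv_right (m := 1)
      (by norm_num)).differentiableAt one_ne_zero
  have hbound : ∀ w ∈ ball (0 : E) r, ‖fderiv ℝ (fderiv ℝ f) w‖ ≤ B := fun w hw => by
    rw [← norm_iteratedFDeriv_one, norm_iteratedFDeriv_fderiv]
    exact hB w hw
  simpa only [hf0, sub_zero] using (convex_ball (0 : E) r).norm_image_sub_le_of_norm_fderiv_le
    hdiff hbound (mem_ball_self (pos_of_mem_ball hu)) hu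

theorem Icc_subset_of_isOpen_of_isClosed {α : Type*} [ConditionallyCompleteLinearOrder α]
    [TopologicalSpace α] [OrderTopology α] [DenselyOrdered α] {S Z : Set α} {a b : α}
    (hS : IsOpen S) (hZ : IsClosed Z) (hZS : Z ⊆ S) (ha : a ∈ S)
    (h : ∀ t ∈ Set.Icc a b, Set.Icc a t ⊆ S → t ∈ Z) : Set.Icc a b ⊆ S := by
  by_contra hne
  obtain ⟨t, ⟨htI, htS⟩, hleast⟩ := (isCompact_Icc.inter_right hS.isClosed_compl).exists_isLeast
    (Set.inter_compl_nonempty_iff.2 hne)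
  have hat : a ≠ t := fun heq => htS (heq ▸ ha)
  have hIco : Set.Ico a t ⊆ S := fun s hs => by
    by_contra hsS
    exact (hleast ⟨⟨hs.1, hs.2.le.trans htI.2⟩, hsS⟩).not_gt hs.2
  have hZt : Set.Ico a t ⊆ Z := fun s hs =>
    h s ⟨hs.1, hs.2.le.trans htI.2⟩ fun s' hs' => hIco ⟨hs'.1, hs'.2.trans_lt hs.2⟩
  have ht : t ∈ closure (Set.Ico a t) := by
    rw [closure_Ico hat]
    exact Set.right_mem_Icc.2 htI.1
  exact htS (hZS (closure_minimal hZt hZ ht))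

section GraphMap

variable {E : Type*} [NormedAddCommGroup E] [InnerProductSpace ℝ E] {T : Submodule ℝ E}
  {x : E} {U : Set T} {h : T → Tᗮ}

/-- The parametrization, over the subspace `T`, of the graph of `h` with origin `x`. -/
def graphMap (x : E) (h : T → Tᗮ) (u : T) : E := x + (u : E) + (h u : E)

theorem graphMap_sub (u : T) : graphMap x h u - x = (u : E) + (h u : E) := by
  rw [graphMap, add_assoc, add_sub_cancel_left]

theorem dist_graphMap_le (u : T) : dist (graphMap x h u) x ≤ ‖u‖ + ‖h u‖ := by
  rw [dist_eq_norm, graphMap_sub]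
  exact norm_add_le _ _

section Projection

variable [T.HasOrthogonalProjection]

theorem orthogonalProjectionOnto_graphMap_sub (u : T) :
    T.orthogonalProjectionOnto (graphMap x h u - x) = u := by
  rw [graphMap_sub, map_add, Submodule.orthogonalProjectionOnto_mem_subspace_eq_self,
    Submodule.orthogonalProjectionOnto_apply_of_mem_orthogonal (h u).2, add_zero]

theorem orthogonalProjectionOnto_orthogonal_graphMap_sub (u : T) :
    Tᗮ.orthogonalProjectionOnto (graphMap x h u - x) = h u := by
  rw [graphMap_sub, map_add, Submodule.orthogonalProjectionOnto_mem_subspace_eq_self,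
    Submodule.orthogonalProjectionOnto_apply_of_mem_orthogonal (T.le_orthogonal_orthogonal u.2),
    zero_add]

theorem zero_mem_and_apply_zero_of_mem_graph (hx : x ∈ graphMap x h '' U) :
    (0 : T) ∈ U ∧ h 0 = 0 := by
  obtain ⟨u, hu, hux⟩ := hx
  have hu0 := orthogonalProjectionOnto_graphMap_sub (x := x) (h := h) u
  have hhu := orthogonalProjectionOnto_orthogonal_graphMap_sub (x := x) (h := h) u
  rw [hux, sub_self, map_zero] at hu0 hhu
  subst hu0
  exact ⟨hu, hhu.symm⟩

/- If `γ` runs in the graph, then `Tᗮ.proj (γ - x) = h (T.proj (γ - x))`; differentiating at `a`,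
where the derivative `D` of `γ` takes values in `T`, gives `0 = fderiv h 0 ∘ D`. -/
theorem fderiv_eq_zero_of_eventually_mem_graph {G : Type*} [NormedAddCommGroup G]
    [NormedSpace ℝ G] {γ : G → E} {D : G →L[ℝ] E} {a : G} (hγ : HasFDerivAt γ D a)
    (hγa : γ a = x) (hT : T = LinearMap.range D.toLinearMap) (hh : DifferentiableAt ℝ h 0)
    (hgraph : ∀ᶠ z in 𝓝 a, γ z ∈ graphMap x h '' U) : fderiv ℝ h 0 = 0 := by
  have hγx : HasFDerivAt (fun z => γ z - x) D a := hγ.sub_const x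
  have heq : (fun z => h (T.orthogonalProjectionOnto (γ z - x)))
      =ᶠ[𝓝 a] fun z => Tᗮ.orthogonalProjectionOnto (γ z - x) := by
    filter_upwards [hgraph] with z ⟨u, _, hu⟩
    rw [← hu, orthogonalProjectionOnto_graphMap_sub,
      orthogonalProjectionOnto_orthogonal_graphMap_sub]
  have hh0 : HasFDerivAt h (fderiv ℝ h 0) (T.orthogonalProjectionOnto (γ a - x)) := by
    rw [hγa, sub_self, map_zero]
    exact hh.hasFDerivAt
  have hleft := hh0.comp a (T.orthogonalProjectionOnto.hasFDerivAt.comp a hγx)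
  have hright := Tᗮ.orthogonalProjectionOnto.hasFDerivAt.comp a hγx
  have hderiv := (hright.congr_of_eventuallyEq heq).unique hleft
  ext1 w
  obtain ⟨v, hv⟩ : (w : E) ∈ LinearMap.range D.toLinearMap := hT ▸ w.2
  have hDv : D v = (w : E) := hv
  have hw := DFunLike.congr_fun hderiv v
  simp only [ContinuousLinearMap.comp_apply, hDv] at hw
  rw [Submodule.orthogonalProjectionOnto_mem_subspace_eq_self,
    Submodule.orthogonalProjectionOnto_apply_of_mem_orthogonal
      (T.le_orthogonal_orthogonal w.2)] at hw
  exact hw.symm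

end Projection

variable [FiniteDimensional ℝ E] {ε : ℝ}

theorem isCompact_inter_preimage_closedBall_of_closure_graph_inter_subset {ρ : ℝ} (hρ : ρ < ε)
    (hcl : closure (graphMap x h '' U) ∩ ball x ε ⊆ graphMap x h '' U) :
    IsCompact (U ∩ graphMap x h ⁻¹' closedBall x ρ) := by
  have hY : graphMap x h '' U ∩ closedBall x ρ = closure (graphMap x h '' U) ∩ closedBall x ρ :=
    (Set.inter_subset_inter_left _ subset_closure).antisymm fun y hy =>
      ⟨hcl ⟨hy.1, closedBall_subset_ball hρ hy.2⟩, hy.2⟩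
  have hcompact : IsCompact (graphMap x h '' U ∩ closedBall x ρ) :=
    hY ▸ (isCompact_closedBall x ρ).inter_left isClosed_closure
  convert hcompact.image (f := fun y => T.orthogonalProjectionOnto (y - x)) (by fun_prop) using 1
  rw [← Set.image_inter_preimage, Set.image_image]
  simp only [orthogonalProjectionOnto_graphMap_sub, Set.image_id']

/- As long as the ray through `u` stays in `U`, the slope bound keeps the graph over it inside a
smaller ball, so the ray cannot reach the boundary of `U` before `u`. -/
theorem ball_subset_of_closure_graph_inter_subset {B : ℝ} (hB : 0 ≤ B) (hU : IsOpen U)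
    (hd : ∀ u ∈ U, DifferentiableAt ℝ h u) (hb : ∀ u ∈ U, ‖fderiv ℝ h u‖ ≤ B)
    (hU0 : (0 : T) ∈ U) (h0 : h 0 = 0)
    (hcl : closure (graphMap x h '' U) ∩ ball x ε ⊆ graphMap x h '' U) :
    ball (0 : T) (ε / (1 + B)) ⊆ U := by
  intro u hu
  rw [mem_ball_zero_iff, lt_div_iff₀ (by positivity)] at hu
  have hray : Continuous fun t : ℝ => t • u := by fun_prop
  have hclosed := (isCompact_inter_preimage_closedBall_of_closure_graph_inter_subset hu
    hcl).isClosed.preimage hray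
  have hsub := Icc_subset_of_isOpen_of_isClosed (a := 0) (b := 1) (hU.preimage hray) hclosed
    (fun t ht => ht.1) (by simpa only [Set.mem_preimage, zero_smul] using hU0) ?_
  · simpa only [Set.mem_preimage, one_smul] using hsub (Set.right_mem_Icc.2 zero_le_one)
  intro t ht hseg
  have hsegment : segment ℝ 0 (t • u) ⊆ U := by
    rw [segment_eq_image]
    rintro _ ⟨s, hs, rfl⟩
    simp only [smul_zero, zero_add, smul_smul]
    exact hseg ⟨mul_nonneg hs.1 ht.1, mul_le_of_le_one_left ht.1 hs.2⟩
  have hgrow := (convex_segment (0 : T) (t • u)).norm_image_sub_le_of_norm_fderiv_le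
    (fun w hw => hd w (hsegment hw)) (fun w hw => hb w (hsegment hw))
    (left_mem_segment ℝ _ _) (right_mem_segment ℝ _ _)
  rw [h0, sub_zero, sub_zero] at hgrow
  refine ⟨hseg (Set.right_mem_Icc.2 ht.1), ?_⟩
  calc dist (graphMap x h (t • u)) x ≤ ‖t • u‖ + B * ‖t • u‖ :=
        (dist_graphMap_le _).trans (by gcongr)
    _ = t * (‖u‖ * (1 + B)) := by rw [norm_smul, Real.norm_of_nonneg ht.1]; ring
    _ ≤ ‖u‖ * (1 + B) := mul_le_of_le_one_left (by positivity) ht.2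

end GraphMap

section Euclidean

variable {m n k : ℕ} {T : Submodule ℝ (Euc n)} {x : Euc n} {U : Set T} {h : T → Tᗮ} {r : ℝ}

theorem exists_graphDatum_of_contDiffOn_ball {K : ℝ} (hr : 0 < r)
    (hT : Module.finrank ℝ T = m) (hk : 1 ≤ k) (hh : ContDiffOn ℝ k h (ball 0 r))
    (h0 : h 0 = 0) (hD0 : fderiv ℝ h 0 = 0)
    (hK : ∀ j ≤ k, ∀ u ∈ ball 0 r, ‖iteratedFDeriv ℝ j h u‖ ≤ K)
    (hslope : ∀ u ∈ ball 0 r, ‖fderiv ℝ h u‖ ≤ 1 / 2) :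
    ∃ d : GraphDatum m n k r K, d.sheet x = graphMap x h '' ball 0 r := by
  set A : Euc m ≃ₗᵢ[ℝ] T :=
    ((stdOrthonormalBasis ℝ T).reindex (finCongr hT)).repr.symm
  set h' : Euc m → Euc n := Tᗮ.subtypeₗᵢ ∘ h ∘ A
  have hA : ∀ {u : Euc m}, u ∈ ball 0 r → A u ∈ ball 0 r := fun {u} hu => by
    rwa [mem_ball_zero_iff, A.norm_map, ← mem_ball_zero_iff]
  have hcomp : ∀ {u : Euc m}, u ∈ ball 0 r → ContDiffAt ℝ k (h ∘ A) u := fun {u} hu =>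
    (hh.contDiffAt (isOpen_ball.mem_nhds (hA hu))).comp u A.contDiff.contDiffAt
  have hnorm : ∀ j ≤ k, ∀ u ∈ ball (0 : Euc m) r,
      ‖iteratedFDeriv ℝ j h' u‖ = ‖iteratedFDeriv ℝ j h (A u)‖ := fun j hj u hu => by
    rw [Tᗮ.subtypeₗᵢ.norm_iteratedFDeriv_comp_left (hcomp hu) (by exact_mod_cast hj),
      A.norm_iteratedFDeriv_comp_right]
  have hfderiv : ∀ u ∈ ball (0 : Euc m) r, ‖fderiv ℝ h' u‖ = ‖fderiv ℝ h (A u)‖ := fun u hu => by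
    rw [← norm_iteratedFDeriv_one, hnorm 1 hk u hu, norm_iteratedFDeriv_one]
  have hfderiv_zero : fderiv ℝ h' 0 = 0 := by
    have hnorm_zero := hfderiv 0 (mem_ball_self hr)
    rw [map_zero, hD0, ContinuousLinearMap.opNorm_zero] at hnorm_zero
    exact norm_eq_zero.1 hnorm_zero
  refine ⟨{ L := T.subtypeₗᵢ.comp A.toLinearIsometry
            h := h'
            contDiffOn := fun u hu =>
              (Tᗮ.subtypeₗᵢ.contDiff.contDiffAt.comp u (hcomp hu)).contDiffWithinAt
            h_zero := by simp only [h', Function.comp_apply, map_zero, h0]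
            fderiv_zero := hfderiv_zero
            inner_eq_zero := fun u _ v =>
              Submodule.inner_right_of_mem_orthogonal (A v).2 (h (A u)).2
            norm_iteratedFDeriv_le := fun j hj u hu =>
              (hnorm j hj u hu).trans_le (hK j hj _ (hA hu))
            norm_fderiv_le := fun u hu => (hfderiv u hu).trans_le (hslope _ (hA hu)) }, ?_⟩
  have himage : A '' ball 0 r = ball 0 r := by rw [A.image_ball, map_zero]
  rw [← himage, Set.image_image]
  refine Set.image_congr fun u _ => ?_
  rw [graphMap, add_assoc]
  rfl

theorem exists_graphDatum_of_graph {ε b : ℝ} (hr : 0 < r) (hk : 2 ≤ k) (hb : 0 ≤ b)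
    (hT : Module.finrank ℝ T = m) (hU : IsOpen U) (hh : ContDiffOn ℝ k h U)
    (hbound : ∀ (e : OrthonormalBasis (Fin m) ℝ T) (j : ℕ), j ≤ k → ∀ s : Fin j → Fin m, ∀ u ∈ U,
      ‖iteratedFDeriv ℝ j h u (fun i => e (s i))‖ ≤ b)
    (hU0 : (0 : T) ∈ U) (h0 : h 0 = 0) (hD0 : fderiv ℝ h 0 = 0)
    (hcl : closure (graphMap x h '' U) ∩ ball x ε ⊆ graphMap x h '' U)
    (hrε : r ≤ ε / (1 + m * b)) (hrb : (m : ℝ) ^ 2 * b * r ≤ 1 / 2) :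
    ∃ d : GraphDatum m n k r (∑ j ∈ Finset.range (k + 1), (m : ℝ) ^ j * b),
      d.sheet x ⊆ graphMap x h '' U := by
  have hnorm : ∀ j ≤ k, ∀ u ∈ U, ‖iteratedFDeriv ℝ j h u‖ ≤ (m : ℝ) ^ j * b := fun j hj u hu => by
    simpa only [Fintype.card_fin] using norm_multilinear_le_of_orthonormalBasis
      ((stdOrthonormalBasis ℝ T).reindex (finCongr hT)) _ hb fun s => hbound _ j hj s u hu
  have hdiff : ∀ u ∈ U, DifferentiableAt ℝ h u := fun u hu =>
    (hh.contDiffAt (hU.mem_nhds hu)).differentiableAt (by exact_mod_cast (by omega : k ≠ 0))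
  have hball : ball (0 : T) r ⊆ U := by
    refine (ball_subset_ball hrε).trans (ball_subset_of_closure_graph_inter_subset
      (by positivity) hU hdiff (fun u hu => ?_) hU0 h0 hcl)
    simpa only [norm_iteratedFDeriv_one, pow_one] using hnorm 1 (by omega) u hu
  have hslope : ∀ u ∈ ball (0 : T) r, ‖fderiv ℝ h u‖ ≤ 1 / 2 := fun u hu => by
    refine (norm_fderiv_le_of_norm_iteratedFDeriv_two_le
      ((hh.mono hball).of_le (by exact_mod_cast hk)) (fun w hw => hnorm 2 hk w (hball hw))
      hD0 hu).trans (le_trans ?_ hrb)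
    gcongr
    exact (mem_ball_zero_iff.1 hu).le
  have hsum : ∀ j ≤ k, ∀ u ∈ ball (0 : T) r, ‖iteratedFDeriv ℝ j h u‖
      ≤ ∑ j ∈ Finset.range (k + 1), (m : ℝ) ^ j * b := fun j hj u hu =>
    (hnorm j hj u (hball hu)).trans <| Finset.single_le_sum (f := fun j => (m : ℝ) ^ j * b)
      (fun j _ => by positivity) (Finset.mem_range.2 (by omega))
  obtain ⟨d, hd⟩ := exists_graphDatum_of_contDiffOn_ball (x := x) hr hT (by omega) (hh.mono hball)
    h0 hD0 hsum hslope
  exact ⟨d, hd.trans_subset (Set.image_mono hball)⟩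

end Euclidean

section Sheets

variable {m n k : ℕ} {N : Type*} [TopologicalSpace N] [ChartedSpace (Euc m) N]

namespace IsSheets

variable {g : N → Euc n} {x : Euc n} {r : ℝ} {l : ℕ} {W : Fin l → Set N}

theorem isOpen (hW : IsSheets m k g x r W) (i : Fin l) : IsOpen (W i) := by
  obtain ⟨e, -, ht, -, -⟩ := hW.ball i
  exact ht ▸ e.open_target

theorem exists_mem (hW : IsSheets m k g x r W) {p : N} (hp : g p ∈ Metric.ball x r) :
    ∃ i, p ∈ W i := by
  rw [← Set.mem_iUnion, hW.iUnion_eq]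
  exact hp

theorem closure_inter_subset (hW : IsSheets m k g x r W) (i : Fin l) :
    closure (W i) ∩ g ⁻¹' Metric.ball x r ⊆ W i := by
  rintro q ⟨hq, hqr⟩
  obtain ⟨j, hj⟩ := hW.exists_mem hqr
  obtain ⟨q', hq'j, hq'i⟩ := mem_closure_iff.1 hq (W j) (hW.isOpen j) hj
  obtain rfl : j = i := by
    by_contra hne
    exact Set.disjoint_left.1 (hW.disjoint hne) hq'j hq'i
  exact hj

theorem closure_image_inter_subset [CompactSpace N] (hW : IsSheets m k g x r W)
    (hg : Continuous g) (i : Fin l) : closure (g '' W i) ∩ Metric.ball x r ⊆ g '' W i := by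
  rintro _ ⟨hy, hyr⟩
  obtain ⟨q, hq, rfl⟩ := closure_minimal (Set.image_mono subset_closure)
    (isClosed_closure.isCompact.image hg).isClosed hy
  exact ⟨q, hW.closure_inter_subset i ⟨hq, hyr⟩, rfl⟩

end IsSheets

theorem hasFDerivAt_comp_extChartAt_symm {g : N → Euc n} {p : N}
    (hg : MDifferentiableAt (𝓡 m) 𝓘(ℝ, Euc n) g p) :
    HasFDerivAt (g ∘ (extChartAt (𝓡 m) p).symm)
      (mfderiv (𝓡 m) 𝓘(ℝ, Euc n) g p : Euc m →L[ℝ] Euc n) (extChartAt (𝓡 m) p p) := by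
  have h := hg.hasMFDerivAt.2
  simp only [writtenInExtChartAt, extChartAt_model_space_eq_id, PartialEquiv.refl_coe,
    modelWithCornersSelf_coe, Set.range_id] at h
  exact hasFDerivWithinAt_univ.1 h

theorem finrank_tangentPlane {g : N → Euc n} (hg : IsImm (m := m) k g) (p : N) :
    Module.finrank ℝ (tangentPlane m g p) = m :=
  (LinearMap.finrank_range_of_inj (hg.2 p)).trans finrank_euclideanSpace_fin

theorem fderiv_eq_zero_of_graph_over_tangentPlane {g : N → Euc n} {p : N}
    (hg : MDifferentiableAt (𝓡 m) 𝓘(ℝ, Euc n) g p) {W : Set N} (hW : W ∈ 𝓝 p)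
    {U : Set (tangentPlane m g p)} {h : tangentPlane m g p → (tangentPlane m g p)ᗮ}
    (hh : DifferentiableAt ℝ h 0) (hgraph : g '' W ⊆ graphMap (g p) h '' U) :
    fderiv ℝ h 0 = 0 := by
  have hinv : (extChartAt (𝓡 m) p).symm (extChartAt (𝓡 m) p p) = p := extChartAt_to_inv p
  have hcont := continuousAt_extChartAt_symm (I := 𝓡 m) p
  rw [ContinuousAt, hinv] at hcont
  refine fderiv_eq_zero_of_eventually_mem_graph (U := U) (hasFDerivAt_comp_extChartAt_symm hg)
    (by rw [Function.comp_apply, hinv]) rfl hh ?_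
  filter_upwards [hcont.eventually hW] with z hz using hgraph ⟨_, hz, rfl⟩

theorem exists_graphDatum_of_mem_boundedGeometry (hk : 2 ≤ k) {ε₀ b V r : ℝ} (hε₀ : 0 < ε₀)
    (hb : 0 ≤ b) (hr : 0 < r) (hrε : r ≤ ε₀ / (1 + m * b)) (hrb : (m : ℝ) ^ 2 * b * r ≤ 1 / 2)
    {M : Set (Euc n)} (hM : M ∈ BoundedGeometry m n k ε₀ b V) {x : Euc n} (hx : x ∈ M) :
    ∃ d : GraphDatum m n k r (∑ j ∈ Finset.range (k + 1), (m : ℝ) ^ j * b), d.sheet x ⊆ M := by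
  obtain ⟨-, N, _, _, _, _, _, g, hg, rfl, hsheets⟩ := hM
  obtain ⟨l, W, hW, hgraph⟩ := hsheets x hx
  obtain ⟨p, rfl⟩ := hx
  obtain ⟨i, hi⟩ := hW.exists_mem (mem_ball_self hε₀)
  obtain ⟨U, h, hU, hh, hS, hbound⟩ := hgraph i p hi rfl
  change g '' W i = graphMap (g p) h '' U at hS
  obtain ⟨hU0, hh0⟩ := zero_mem_and_apply_zero_of_mem_graph (hS.subset ⟨p, hi, rfl⟩)
  have hk0 : (k : WithTop ℕ∞) ≠ 0 := by exact_mod_cast (by omega : k ≠ 0)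
  have hD0 : fderiv ℝ h 0 = 0 :=
    fderiv_eq_zero_of_graph_over_tangentPlane ((hg.1 p).mdifferentiableAt hk0)
      ((hW.isOpen i).mem_nhds hi) ((hh.contDiffAt (hU.mem_nhds hU0)).differentiableAt hk0) hS.subset
  obtain ⟨d, hd⟩ := exists_graphDatum_of_graph hr hk hb (finrank_tangentPlane hg p) hU hh hbound
    hU0 hh0 hD0 (hS ▸ hW.closure_image_inter_subset hg.1.continuous i) hrε hrb
  exact ⟨d, hd.trans (hS.symm.subset.trans (Set.image_subset_range _ _))⟩

end Sheets

/-! ### Embedded submanifolds are locally a single sheet -/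

section AlmostFlat

variable {E : Type*} [NormedAddCommGroup E] [InnerProductSpace ℝ E]

/-- Every secant of `S` makes an angle with the subspace `T` whose sine is at most `η`. -/
def IsAlmostFlat (T : Submodule ℝ E) [T.HasOrthogonalProjection] (η : ℝ) (S : Set E) : Prop :=
  ∀ y ∈ S, ∀ z ∈ S, ‖Tᗮ.starProjection (y - z)‖ ≤ η * ‖y - z‖

variable {T : Submodule ℝ E} [T.HasOrthogonalProjection] {η : ℝ} {S S' : Set E}

theorem IsAlmostFlat.mono (h : IsAlmostFlat T η S') (hS : S ⊆ S') : IsAlmostFlat T η S :=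
  fun y hy z hz => h y (hS hy) z (hS hz)

theorem starProjection_orthogonal_eq_zero {y : E} (hy : y ∈ T) : Tᗮ.starProjection y = 0 := by
  rw [Submodule.starProjection_apply, Submodule.orthogonalProjectionOnto_apply_of_mem_orthogonal
    (T.le_orthogonal_orthogonal hy), ZeroMemClass.coe_zero]

theorem exists_isAlmostFlat_image_of_hasStrictFDerivAt {G : Type*} [NormedAddCommGroup G]
    [NormedSpace ℝ G] [FiniteDimensional ℝ G] {f : G → E} {D : G →L[ℝ] E} {a : G}
    (hf : HasStrictFDerivAt f D a) (hD : Function.Injective D) (hT : ∀ v, D v ∈ T) (hη : 0 < η) :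
    ∃ V ∈ 𝓝 a, IsAlmostFlat T η (f '' V) := by
  obtain ⟨C, -, hC⟩ := D.toLinearMap.injective_iff_antilipschitz.1 hD
  have hbound : (fun q : G × G => q.1 - q.2) =O[𝓝 (a, a)] fun q => D (q.1 - q.2) :=
    .of_bound C (.of_forall fun q => ZeroHomClass.bound_of_antilipschitz D hC _)
  have hequiv : Asymptotics.IsEquivalent (𝓝 (a, a)) (fun q : G × G => f q.1 - f q.2)
      fun q => D (q.1 - q.2) := hf.isLittleO.trans_isBigO hbound
  have hproj : (fun q : G × G => Tᗮ.starProjection (f q.1 - f q.2))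
      =O[𝓝 (a, a)] fun q => f q.1 - f q.2 - D (q.1 - q.2) := by
    refine .of_bound' (.of_forall fun q => ?_)
    have heq : Tᗮ.starProjection (f q.1 - f q.2)
        = Tᗮ.starProjection (f q.1 - f q.2 - D (q.1 - q.2)) := by
      rw [map_sub _ (f q.1 - f q.2), starProjection_orthogonal_eq_zero (hT _), sub_zero]
    rw [heq]
    exact Submodule.norm_starProjection_apply_le _ _
  have hsmall := ((hproj.trans_isLittleO hequiv).trans_isBigO hequiv.isBigO_symm).bound hη
  rw [nhds_prod_eq] at hsmall
  obtain ⟨V, hV, hVη⟩ := eventually_prod_self_iff'.1 hsmall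
  refine ⟨V, hV, ?_⟩
  rintro _ ⟨u, hu, rfl⟩ _ ⟨v, hv, rfl⟩
  exact hVη u hu v hv

theorem IsAlmostFlat.norm_starProjection_fderiv_le {G : Type*} [NormedAddCommGroup G]
    [NormedSpace ℝ G] {f : G → E} {D : G →L[ℝ] E} {a : G} (hS : IsAlmostFlat T η S)
    (hf : HasFDerivAt f D a) (hfS : ∀ᶠ u in 𝓝 a, f u ∈ S) (v : G) :
    ‖Tᗮ.starProjection (D v)‖ ≤ η * ‖D v‖ := by
  have hslope := (hf.hasLineDerivAt v).tendsto_slope_zero_right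
  refine le_of_tendsto_of_tendsto ((Tᗮ.starProjection.continuous.tendsto _).comp hslope).norm
    (hslope.norm.const_mul η) ?_
  have hline : Tendsto (fun t : ℝ => a + t • v) (𝓝[>] 0) (𝓝 a) := by
    simpa using (tendsto_smul_nhdsGT_zero v).const_add a
  filter_upwards [hline.eventually hfS] with t ht
  have hsec := hS _ ht _ hfS.self_of_nhds
  simp only [Function.comp_apply, map_smul, norm_smul]
  rw [mul_left_comm]
  gcongr

/- Pick `v` such that `w` and `L v` have the same projection to `T`. Then `w - L v` is the
difference of the two small components normal to `T`, although by orthogonality its square norm is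
`‖w‖ ^ 2 + ‖v‖ ^ 2`. -/
theorem eq_zero_of_orthogonal_of_almost_mem [FiniteDimensional ℝ E] {G : Type*}
    [NormedAddCommGroup G] [InnerProductSpace ℝ G] [FiniteDimensional ℝ G]
    (hT : Module.finrank ℝ G = Module.finrank ℝ T) (L : G →ₗᵢ[ℝ] E)
    (hL : ∀ v, ‖Tᗮ.starProjection (L v)‖ ≤ 1 / 4 * ‖v‖) {w : E}
    (hw : ‖Tᗮ.starProjection w‖ ≤ 1 / 4 * ‖w‖) (horth : ∀ v, inner ℝ w (L v) = 0) : w = 0 := by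
  have hnormal : ∀ y : E, T.orthogonalProjectionOnto y = 0 → Tᗮ.starProjection y = y := by
    intro y hy
    have hdecomp := T.starProjection_add_starProjection_orthogonal y
    rwa [T.starProjection_apply, hy, ZeroMemClass.coe_zero, zero_add] at hdecomp
  have hinj : Function.Injective (T.orthogonalProjectionOnto.toLinearMap ∘ₗ L.toLinearMap) := by
    refine (injective_iff_map_eq_zero _).2 fun v hv => ?_
    have hLv := hL v
    rw [hnormal (L v) hv, L.norm_map] at hLv
    exact norm_le_zero_iff.1 (by linarith)
  obtain ⟨v, hv⟩ := (LinearMap.injective_iff_surjective_of_finrank_eq_finrank hT).1 hinj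
    (T.orthogonalProjectionOnto w)
  have hsub : Tᗮ.starProjection (w - L v) = w - L v :=
    hnormal _ (by rw [map_sub, sub_eq_zero]; exact hv.symm)
  have hle : ‖w - L v‖ ≤ 1 / 4 * ‖w‖ + 1 / 4 * ‖v‖ := by
    rw [← hsub, map_sub]
    exact (norm_sub_le _ _).trans (add_le_add hw (hL v))
  have hpyth := norm_sub_sq_real w (L v)
  rw [horth, L.norm_map] at hpyth
  have hsq := pow_le_pow_left₀ (norm_nonneg _) hle 2
  have : ‖w‖ ^ 2 ≤ 0 := by nlinarith [sq_nonneg (‖w‖ - ‖v‖), sq_nonneg ‖v‖]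
  exact norm_eq_zero.1 (pow_eq_zero_iff two_ne_zero |>.1 (this.antisymm (sq_nonneg _)))

end AlmostFlat

namespace GraphDatum

variable {m n k : ℕ} {r K : ℝ} (d : GraphDatum m n k r K)

theorem dist_add_map_le (hk : 1 ≤ k) (x : Euc n) {u : Euc m} (hu : u ∈ ball 0 r) :
    dist (x + d.map u) x ≤ 3 / 2 * ‖u‖ := by
  rw [dist_eq_norm, add_sub_cancel_left]
  exact d.norm_map_le hk hu

/-- The point of the plane above which `y` lies, in the coordinates of the graph. -/
def proj (y : Euc n) : Euc m := d.L.toContinuousLinearMap.adjoint y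

theorem inner_proj (y : Euc n) (v : Euc m) : inner ℝ (d.proj y) v = inner ℝ y (d.L v) :=
  d.L.toContinuousLinearMap.adjoint_inner_left v y

theorem norm_proj_le (y : Euc n) : ‖d.proj y‖ ≤ ‖y‖ := by
  refine (ContinuousLinearMap.le_of_opNorm_le _ ?_ y).trans_eq (one_mul _)
  rw [LinearIsometryEquiv.norm_map]
  exact d.L.norm_toContinuousLinearMap_le

theorem inner_sub_map_proj {y : Euc n} (hy : d.proj y ∈ ball 0 r) (v : Euc m) :
    inner ℝ (y - d.map (d.proj y)) (d.L v) = 0 := by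
  rw [GraphDatum.map, inner_sub_left, inner_add_left, d.L.inner_map_map, d.inner_proj,
    real_inner_comm (d.L v) (d.h _), d.inner_eq_zero _ hy, add_zero, sub_self]

theorem inter_ball_subset_sheet_of_isAlmostFlat (hk : 1 ≤ k) {T : Submodule ℝ (Euc n)}
    (hT : Module.finrank ℝ T = m) {M : Set (Euc n)} {q x : Euc n} {ρ : ℝ} (hρr : ρ ≤ r)
    (hflat : IsAlmostFlat T (1 / 4) (M ∩ ball q (4 * ρ))) (hxq : x ∈ ball q ρ)
    (hd : d.sheet x ⊆ M) : M ∩ ball x ρ ⊆ d.sheet x := by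
  have hρ : 0 < ρ := pos_of_mem_ball hxq
  rw [mem_ball] at hxq
  have hmem : ∀ u ∈ ball (0 : Euc m) ρ, x + d.map u ∈ M ∩ ball q (4 * ρ) := fun u hu => by
    have hur := ball_subset_ball hρr hu
    refine ⟨hd ⟨u, hur, rfl⟩, ?_⟩
    rw [mem_ball_zero_iff] at hu
    rw [mem_ball]
    linarith [dist_triangle (x + d.map u) x q, d.dist_add_map_le hk x hur]
  have hr : 0 < r := hρ.trans_le hρr
  have hderiv : HasFDerivAt (fun u => x + d.map u) d.L.toContinuousLinearMap 0 := by
    rw [← d.fderiv_map_zero hr hk]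
    exact (((d.contDiffOn_map.contDiffAt (ball_mem_nhds 0 hr)).differentiableAt
      (by exact_mod_cast (by omega : k ≠ 0))).hasFDerivAt).const_add x
  have hL : ∀ v, ‖Tᗮ.starProjection (d.L v)‖ ≤ 1 / 4 * ‖v‖ := fun v => by
    simpa only [LinearIsometry.coe_toContinuousLinearMap, d.L.norm_map] using
      hflat.norm_starProjection_fderiv_le hderiv (eventually_of_mem (ball_mem_nhds 0 hρ) hmem) v
  intro y hy
  have hyx : dist y x < ρ := hy.2
  have hu : d.proj (y - x) ∈ ball 0 ρ := mem_ball_zero_iff.2 <|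
    (d.norm_proj_le _).trans_lt (dist_eq_norm y x ▸ hyx)
  have hyq : y ∈ M ∩ ball q (4 * ρ) :=
    ⟨hy.1, by rw [mem_ball]; linarith [dist_triangle y x q]⟩
  have hzero : y - (x + d.map (d.proj (y - x))) = 0 := by
    refine eq_zero_of_orthogonal_of_almost_mem (finrank_euclideanSpace_fin.trans hT.symm) d.L hL
      (hflat _ hyq _ (hmem _ hu)) fun v => ?_
    rw [← sub_sub]
    exact d.inner_sub_map_proj (ball_subset_ball hρr hu) v
  exact ⟨_, ball_subset_ball hρr hu, (sub_eq_zero.1 hzero).symm⟩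

end GraphDatum

section Embedding

variable {m n k : ℕ} {N : Type*} [TopologicalSpace N] [ChartedSpace (Euc m) N]

theorem IsImm.hasStrictFDerivAt_comp_extChartAt_symm {g : N → Euc n} (hk : 1 ≤ k)
    (hg : IsImm (m := m) k g) (p : N) :
    HasStrictFDerivAt (g ∘ (extChartAt (𝓡 m) p).symm)
      (mfderiv (𝓡 m) 𝓘(ℝ, Euc n) g p : Euc m →L[ℝ] Euc n) (extChartAt (𝓡 m) p p) := by
  have hk0 : (k : WithTop ℕ∞) ≠ 0 := by exact_mod_cast (by omega : k ≠ 0)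
  have hcd := (contMDiffAt_iff.1 (hg.1 p)).2
  simp only [extChartAt_model_space_eq_id, PartialEquiv.refl_coe, modelWithCornersSelf_coe,
    Set.range_id] at hcd
  exact (contDiffWithinAt_univ.1 hcd).hasStrictFDerivAt'
    (hasFDerivAt_comp_extChartAt_symm ((hg.1 p).mdifferentiableAt hk0)) hk0

variable [CompactSpace N] {ι : N → Euc n}

theorem exists_isAlmostFlat_range_inter_ball (hk : 1 ≤ k) (hι : IsImm (m := m) k ι)
    (hinj : Function.Injective ι) (p : N) {η : ℝ} (hη : 0 < η) :
    ∃ ρ > 0, IsAlmostFlat (tangentPlane m ι p) η (Set.range ι ∩ ball (ι p) ρ) := by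
  set φ := extChartAt (𝓡 m) p
  obtain ⟨V, hV, hflat⟩ := exists_isAlmostFlat_image_of_hasStrictFDerivAt
    (hι.hasStrictFDerivAt_comp_extChartAt_symm hk p) (hι.2 p)
    (T := tangentPlane m ι p) (fun v => ⟨v, rfl⟩) hη
  have hO : φ.source ∩ φ ⁻¹' V ∈ 𝓝 p :=
    inter_mem (extChartAt_source_mem_nhds p) ((continuousAt_extChartAt p).preimage_mem_nhds hV)
  have himage := image_mem_map (m := ι) hO
  rw [(hι.1.continuous.isClosedEmbedding hinj).isInducing.map_nhds_eq, mem_nhdsWithin_iff]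
    at himage
  obtain ⟨ρ, hρ, hball⟩ := himage
  refine ⟨ρ, hρ, hflat.mono ?_⟩
  rintro y ⟨hyι, hyρ⟩
  obtain ⟨q, ⟨hqs, hqV⟩, rfl⟩ := hball ⟨hyρ, hyι⟩
  exact ⟨φ q, hqV, by rw [Function.comp_apply, φ.left_inv hqs]⟩

theorem exists_range_inter_ball_subset_sheet (hk : 1 ≤ k) (hι : IsImm (m := m) k ι)
    (hinj : Function.Injective ι) {r : ℝ} (hr : 0 < r) (K : ℝ) :
    ∃ ρ > 0, ∀ x ∈ Set.range ι, ∀ d : GraphDatum m n k r K,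
      d.sheet x ⊆ Set.range ι → Set.range ι ∩ ball x ρ ⊆ d.sheet x := by
  refine (isCompact_range hι.1.continuous).induction_on (p := fun S => ∃ ρ > 0, ∀ x ∈ S,
    ∀ d : GraphDatum m n k r K, d.sheet x ⊆ Set.range ι → Set.range ι ∩ ball x ρ ⊆ d.sheet x)
    ⟨1, one_pos, fun x hx => hx.elim⟩ ?_ ?_ ?_
  · rintro S S' hS ⟨ρ, hρ, h⟩
    exact ⟨ρ, hρ, fun x hx => h x (hS hx)⟩
  · rintro S S' ⟨ρ, hρ, h⟩ ⟨ρ', hρ', h'⟩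
    refine ⟨min ρ ρ', lt_min hρ hρ', fun x hx d hd => ?_⟩
    rcases hx with hx | hx
    · exact (Set.inter_subset_inter_right _ (ball_subset_ball (min_le_left _ _))).trans
        (h x hx d hd)
    · exact (Set.inter_subset_inter_right _ (ball_subset_ball (min_le_right _ _))).trans
        (h' x hx d hd)
  · rintro _ ⟨p, rfl⟩
    obtain ⟨ρ, hρ, hflat⟩ := exists_isAlmostFlat_range_inter_ball hk hι hinj p
      (by norm_num : (0 : ℝ) < 1 / 4)
    have hρ' : 0 < min (ρ / 4) r := lt_min (by positivity) hr
    refine ⟨ball (ι p) (min (ρ / 4) r), mem_nhdsWithin_of_mem_nhds (ball_mem_nhds _ hρ'),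
      min (ρ / 4) r, hρ', fun x hx d hd => ?_⟩
    refine d.inter_ball_subset_sheet_of_isAlmostFlat hk (finrank_tangentPlane hι p)
      (min_le_right _ _) (hflat.mono ?_) hx hd
    gcongr
    linarith [min_le_left (ρ / 4) r]

end Embedding

/-! ### The potential of a closed submanifold of bounded geometry -/

section AlphaBar

variable {m : ℕ} {α : ℝ}

theorem cast_alphaBar (hα : α ≤ -2 * (m : ℝ)) : (alphaBar m α : ℝ) = ⌊-α⌋ - m := by
  have hfloor : (2 * m : ℤ) ≤ ⌊-α⌋ := Int.le_floor.2 (by push_cast; linarith)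
  have hcast : ((alphaBar m α : ℕ) : ℤ) = ⌊-α⌋ - m := Int.toNat_of_nonneg (by omega)
  exact_mod_cast congrArg (Int.cast (R := ℝ)) hcast

theorem zero_lt_add_alphaBar_succ (hα : α ≤ -2 * (m : ℝ)) :
    0 < α + (m + (alphaBar m α + 1) : ℕ) := by
  push_cast
  linarith [cast_alphaBar hα, Int.lt_floor_add_one (-α)]

theorem add_le_zero_of_lt_alphaBar_succ (hα : α ≤ -2 * (m : ℝ)) {j : ℕ}
    (hj : j < alphaBar m α + 1) : α + (m + j : ℕ) ≤ 0 := by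
  have hj' : (j : ℝ) ≤ alphaBar m α := by exact_mod_cast Nat.lt_succ_iff.1 hj
  push_cast
  linarith [cast_alphaBar hα, Int.floor_le (-α)]

end AlphaBar

section SheetSystem

variable {m n k N : ℕ} {r K α : ℝ} {M : Set (Euc n)} {d : M → GraphDatum m n k r K}

/-- Every point `x` of `M` is the origin of a sheet `d x` in `M`, which is all of `M` near `x`,
uniformly in `x`. -/
structure IsSheetSystem (M : Set (Euc n)) (d : M → GraphDatum m n k r K) : Prop where
  measurableSet : MeasurableSet M
  measure_ne_top : (μHE[m] : Measure (Euc n)) M ≠ ⊤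
  sheet_subset : ∀ x : M, (d x).sheet x ⊆ M
  exists_inter_ball_subset : ∃ ρ > 0, ∀ x : M, M ∩ ball (x : Euc n) ρ ⊆ (d x).sheet x

theorem GraphDatum.exists_abs_volume_sub_le (hm : 1 ≤ m) (hr : 0 < r) (hk : N + 2 ≤ k) :
    ∃ R > 0, ∃ K' ≥ 0, ∃ c : GraphDatum m n k r K → ℕ → ℝ, (∀ d j, |c d j| ≤ K') ∧
      ∀ d x, ∀ t ∈ Set.Ioc 0 R, |(μHE[m] : Measure (Euc n)).real (d.sheet x ∩ ball x t)
        - ∑ j ∈ Finset.range (N + 1), c d j * t ^ (m + j)| ≤ K' * t ^ (m + (N + 1)) := by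
  obtain ⟨c, K', hK', hc, hexp⟩ := GraphDatum.hasUniformExpansion_volume (n := n) (K := K) hm hr hk
  obtain ⟨R, hR, hexp⟩ := mem_nhdsGT_iff_exists_Ioc_subset.1 hexp
  refine ⟨R, hR, K', hK', c, hc, fun d x t ht => ?_⟩
  have htm : 0 < t ^ m := pow_pos ht.1 m
  have hscaled := mul_le_mul_of_nonneg_left (hexp ht d) htm.le
  rw [← abs_of_pos htm, ← abs_mul, abs_of_pos htm, mul_sub, mul_div_cancel₀ _ htm.ne',
    Finset.mul_sum] at hscaled
  rw [d.volume_sheet_inter_ball, pow_add, mul_left_comm]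
  simpa only [pow_add, mul_left_comm (t ^ m)] using hscaled

namespace IsSheetSystem

theorem exists_hasVolumeExpansion (hm : 1 ≤ m) (hr : 0 < r) (hk : N + 2 ≤ k) :
    ∃ R > 0, ∃ K' ≥ 0, ∀ {M : Set (Euc n)} {d : M → GraphDatum m n k r K}, IsSheetSystem M d →
      ∃ ρ a, HasVolumeExpansion m (N + 1) K' R ρ M
        (fun x => (d x).sheet x ∩ ball (x : Euc n) R) a := by
  obtain ⟨R, hR, K', hK', c, hc, hvol⟩ := GraphDatum.exists_abs_volume_sub_le (n := n) (K := K)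
    hm hr hk
  refine ⟨R, hR, K', hK', fun {M d} h => ?_⟩
  obtain ⟨ρ, hρ, hsheet⟩ := h.exists_inter_ball_subset
  exact ⟨min ρ R, fun x => c (d x),
    { measurableSet := h.measurableSet
      measure_ne_top := h.measure_ne_top
      pos := lt_min hρ hR
      measurableSet_nhd := fun x => ((d x).measurableSet_sheet x).inter measurableSet_ball
      nhd_subset := fun x => Set.inter_subset_inter_left _ (h.sheet_subset x)
      inter_ball_subset := fun x => Set.subset_inter
        ((Set.inter_subset_inter_right _ (ball_subset_ball (min_le_left _ _))).trans (hsheet x))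
        (Set.inter_subset_right.trans (ball_subset_ball (min_le_right _ _)))
      abs_coeff_le := fun x => hc (d x)
      abs_volume_sub_le := fun x t ht => by
        rw [Set.inter_assoc, Set.inter_eq_right.2 (ball_subset_ball ht.2)]
        exact hvol (d x) x t ht }⟩

theorem integrableOn_dist_rpow (h : IsSheetSystem M d) (hα : α ≤ 0) (x : M) {S : Set (Euc n)}
    (hSM : S ⊆ M) (hS : MeasurableSet S) (hdisj : Disjoint S ((d x).sheet x)) :
    IntegrableOn (fun y => dist (x : Euc n) y ^ α) S (μHE[m] : Measure (Euc n)) := by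
  obtain ⟨ρ, hρ, hsheet⟩ := h.exists_inter_ball_subset
  exact RieszRepulsion.integrableOn_dist_rpow hS (measure_ne_top_of_subset hSM h.measure_ne_top)
    hα hρ (Set.disjoint_left.2 fun y hy hyρ =>
      Set.disjoint_left.1 hdisj hy (hsheet x ⟨hSM hy, hyρ⟩))

theorem exists_setIntegral_le_potential_add (hm : 1 ≤ m) (hr : 0 < r)
    (hk : alphaBar m α + 2 ≤ k) (hα : α ≤ -2 * (m : ℝ)) :
    ∃ C, ∀ {M : Set (Euc n)} {d : M → GraphDatum m n k r K}, IsSheetSystem M d →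
      RieszEnergyDefined m α M ∧ ∀ x : M, ∀ S ⊆ M, Disjoint S ((d x).sheet x) →
        ∫ y in S, dist (x : Euc n) y ^ α ∂(μHE[m] : Measure (Euc n))
          ≤ potential m α M x + C := by
  have hα0 : α ≤ 0 := hα.trans (by simp)
  obtain ⟨R, hR, K', hK', hexp⟩ := exists_hasVolumeExpansion (n := n) (K := K) hm hr hk
  obtain ⟨C, hC⟩ := HasVolumeExpansion.exists_abs_potential_sub_le m n (alphaBar m α + 1) hα0
    (zero_lt_add_alphaBar_succ hα) (fun _ hj => add_le_zero_of_lt_alphaBar_succ hα hj) hR hK'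
  refine ⟨C, fun {M d} h => ?_⟩
  obtain ⟨ρ, a, ha⟩ := hexp h
  obtain ⟨hdef, hpot⟩ := hC ha
  refine ⟨hdef, fun x S hSM hdisj => ?_⟩
  have hfar : IntegrableOn (fun y => dist (x : Euc n) y ^ α)
      (M \ ((d x).sheet x ∩ ball (x : Euc n) R)) (μHE[m] : Measure (Euc n)) :=
    RieszRepulsion.integrableOn_dist_rpow (ha.measurableSet.diff (ha.measurableSet_nhd x))
      (measure_ne_top_of_subset Set.sdiff_subset ha.measure_ne_top) hα0 ha.pos
      (ha.disjoint_sdiff_nhd_ball x)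
  have hmono := setIntegral_mono_set hfar
    (Eventually.of_forall fun y => Real.rpow_nonneg dist_nonneg α)
    (Set.subset_sdiff.2 ⟨hSM, hdisj.mono_right Set.inter_subset_left⟩).eventuallyLE
  linarith [(abs_le.1 (hpot x)).1]

end IsSheetSystem

theorem exists_isSheetSystem {k : ℕ} (hk : 2 ≤ k) {ε₀ b V r : ℝ} (hε₀ : 0 < ε₀) (hb : 0 ≤ b)
    (hr : 0 < r) (hrε : r ≤ ε₀ / (1 + m * b)) (hrb : (m : ℝ) ^ 2 * b * r ≤ 1 / 2) {N : Type*}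
    [TopologicalSpace N] [ChartedSpace (Euc m) N] [CompactSpace N] {ι : N → Euc n}
    (hι : IsImm (m := m) k ι) (hinj : Function.Injective ι)
    (hM : Set.range ι ∈ BoundedGeometry m n k ε₀ b V) :
    ∃ d : Set.range ι → GraphDatum m n k r (∑ j ∈ Finset.range (k + 1), (m : ℝ) ^ j * b),
      IsSheetSystem (Set.range ι) d := by
  choose d hd using fun x : Set.range ι =>
    exists_graphDatum_of_mem_boundedGeometry hk hε₀ hb hr hrε hrb hM x.2
  obtain ⟨ρ, hρ, hsheet⟩ := exists_range_inter_ball_subset_sheet (by omega) hι hinj hr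
    (∑ j ∈ Finset.range (k + 1), (m : ℝ) ^ j * b)
  exact ⟨d, (isCompact_range hι.1.continuous).measurableSet,
    ne_top_of_le_ne_top ENNReal.ofReal_ne_top hM.1, hd, ρ, hρ,
    fun x => hsheet x x.2 (d x) (hd x)⟩

end SheetSystem

/-! ### Separation of the two sheets through a double point -/

section Separation

variable {m n k : ℕ} {N : Type*} [TopologicalSpace N]

theorem IsSheets.notMem_connectedComponentIn [ChartedSpace (Euc m) N] {f : N → Euc n} {x : Euc n}
    {r : ℝ} {l : ℕ} {W : Fin l → Set N} (hW : IsSheets m k f x r W) {p q : N}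
    (hp : f p ∈ Metric.ball x r) (hpq : f p = f q) (hne : p ≠ q) :
    q ∉ connectedComponentIn (f ⁻¹' Metric.ball x r) p := fun hq => by
  obtain ⟨i, hi⟩ := hW.exists_mem hp
  have hcover : f ⁻¹' Metric.ball x r ⊆ W i ∪ ⋃ j ∈ {j | j ≠ i}, W j := by
    rw [← hW.iUnion_eq]
    refine Set.iUnion_subset fun j => ?_
    by_cases hji : j = i
    · exact hji ▸ Set.subset_union_left
    · exact (Set.subset_biUnion_of_mem (s := {j | j ≠ i}) (u := W) hji).trans
        Set.subset_union_right
  have hsub : connectedComponentIn (f ⁻¹' Metric.ball x r) p ⊆ W i :=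
    isPreconnected_connectedComponentIn.subset_left_of_subset_union (hW.isOpen i)
      (isOpen_biUnion fun j _ => hW.isOpen j)
      (Set.disjoint_iUnion₂_right.2 fun j hj => hW.disjoint (Ne.symm hj))
      ((connectedComponentIn_subset _ _).trans hcover) ⟨p, mem_connectedComponentIn hp, hi⟩
  exact hne <| congrArg Subtype.val <|
    (hW.embedding i).injective (a₁ := ⟨p, hi⟩) (a₂ := ⟨q, hsub hq⟩) hpq

theorem GraphDatum.dist_lt_of_mem_sheet {r K : ℝ} (d : GraphDatum m n k r K) (hk : 1 ≤ k)
    {x y : Euc n} (hy : y ∈ d.sheet x) : dist y x < 3 / 2 * r := by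
  obtain ⟨u, hu, rfl⟩ := hy
  have hur := mem_ball_zero_iff.1 hu
  linarith [d.dist_add_map_le hk x hu]

/- Otherwise `d` would join the two sheets to a connected subset of the range of `ι`, which pulls
back to a connected set containing `p` and `q`. -/
theorem GraphDatum.disjoint_sheet_of_notMem_connectedComponentIn [CompactSpace N] {ι f : N → Euc n}
    (hι : Continuous ι) (hinj : Function.Injective ι) {δ ε r K : ℝ} (hr : 0 < r) (hk : 1 ≤ k)
    (hε : 3 * r + 2 * δ ≤ ε) (hf : ∀ p, dist (f p) (ι p) < δ) {p q : N} (hpq : f p = f q)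
    (hsep : q ∉ connectedComponentIn (f ⁻¹' ball (f p) ε) p) {d₁ d₂ d : GraphDatum m n k r K}
    {x : Euc n} (h₁ : d₁.sheet (ι p) ⊆ Set.range ι) (h₂ : d₂.sheet (ι q) ⊆ Set.range ι)
    (h : d.sheet x ⊆ Set.range ι) (hx : x ∈ d₁.sheet (ι p)) :
    Disjoint (d₂.sheet (ι q)) (d.sheet x) := by
  refine Set.disjoint_left.2 fun y hy₂ hy => hsep ?_
  set A := d₁.sheet (ι p) ∪ d.sheet x ∪ d₂.sheet (ι q)
  have hA : IsPreconnected A :=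
    ((d₁.isPreconnected_sheet _).union x hx (d.self_mem_sheet hr x)
      (d.isPreconnected_sheet x)).union y (Or.inr hy) hy₂ (d₂.isPreconnected_sheet _)
  have hpre : IsPreconnected (ι ⁻¹' A) := hA.preimage_of_isClosedMap hinj hι.isClosedMap
    (Set.union_subset (Set.union_subset h₁ h) h₂)
  refine hpre.subset_connectedComponentIn (Or.inl (Or.inl (d₁.self_mem_sheet hr _)))
    (fun z hz => ?_) (Or.inr (d₂.self_mem_sheet hr _))
  have hp : dist (ι p) (f p) < δ := dist_comm (f p) (ι p) ▸ hf p
  have hq : dist (ι q) (f p) < δ := by rw [hpq, dist_comm]; exact hf q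
  have hxp := d₁.dist_lt_of_mem_sheet hk hx
  have hz' := hf z
  have htri := dist_triangle (f z) (ι z) (f p)
  rw [Set.mem_preimage, mem_ball]
  rcases hz with (hz | hz) | hz
  · linarith [d₁.dist_lt_of_mem_sheet hk hz, dist_triangle (ι z) (ι p) (f p)]
  · linarith [d.dist_lt_of_mem_sheet hk hz, dist_triangle4 (ι z) x (ι p) (f p)]
  · linarith [d₂.dist_lt_of_mem_sheet hk hz, dist_triangle (ι z) (ι q) (f p)]

end Separation

/-! ### The interaction of two close sheets -/

theorem mul_le_setIntegral_of_pairwise_disjoint {X : Type*} [MeasurableSpace X] {μ : Measure X}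
    {M : Set X} (hM : MeasurableSet M) {g : X → ℝ} (hg : IntegrableOn g M μ)
    (hg0 : ∀ x ∈ M, 0 ≤ g x) {S : ℕ → Set X} (hS : ∀ j, MeasurableSet (S j))
    (hdisj : Pairwise fun i j => Disjoint (S i) (S j)) (hSM : ∀ j, S j ⊆ M) {J : ℕ} {c : ℝ}
    (hc : ∀ j < J, c ≤ ∫ x in S j, g x ∂μ) : J * c ≤ ∫ x in M, g x ∂μ := by
  calc J * c = ∑ _j ∈ Finset.range J, c := by
        rw [Finset.sum_const, Finset.card_range, nsmul_eq_mul]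
    _ ≤ ∑ j ∈ Finset.range J, ∫ x in S j, g x ∂μ :=
        Finset.sum_le_sum fun j hj => hc j (Finset.mem_range.1 hj)
    _ = ∫ x in ⋃ j ∈ Finset.range J, S j, g x ∂μ :=
        (integral_biUnion_finset _ (fun j _ => hS j) (fun i _ j _ hij => hdisj hij)
          fun j _ => hg.mono_set (hSM j)).symm
    _ ≤ ∫ x in M, g x ∂μ := setIntegral_mono_set hg ((ae_restrict_mem hM).mono hg0)
        (Set.iUnion₂_subset fun j _ => hSM j).eventuallyLE

section Shell

variable {m : ℕ} {r σ : ℝ}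

/-- The dyadic shell `{u | σ / 2 ≤ ‖u‖ < σ}` of `ℝᵐ`. -/
def shell (m : ℕ) (σ : ℝ) : Set (Euc m) := ball 0 σ \ ball 0 (σ / 2)

theorem measurableSet_shell : MeasurableSet (shell m σ) :=
  measurableSet_ball.diff measurableSet_ball

theorem shell_subset_ball (hσ : σ ≤ r) : shell m σ ⊆ ball 0 r :=
  Set.sdiff_subset.trans (ball_subset_ball hσ)

theorem pairwise_disjoint_shell (hr : 0 ≤ r) :
    Pairwise fun i j : ℕ => Disjoint (shell m (r / 2 ^ i)) (shell m (r / 2 ^ j)) := by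
  refine (pairwise_disjoint_on _).2 fun i j hij => ?_
  refine Set.disjoint_left.2 fun u hu hu' => hu.2 (ball_subset_ball ?_ hu'.1)
  rw [div_div, ← pow_succ]
  gcongr
  · exact one_le_two
  · exact hij

theorem volume_real_ball_zero (hσ : 0 < σ) : (volume : Measure (Euc m)).real (ball 0 σ)
    = σ ^ m * (volume : Measure (Euc m)).real (ball 0 1) := by
  rw [measureReal_def, Measure.addHaar_ball_of_pos _ _ hσ, ENNReal.toReal_mul,
    ENNReal.toReal_ofReal (by positivity), finrank_euclideanSpace_fin, ← measureReal_def]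

theorem half_volume_ball_le_volume_shell (hm : 1 ≤ m) (hσ : 0 < σ) :
    σ ^ m * (volume : Measure (Euc m)).real (ball 0 1) / 2
      ≤ (volume : Measure (Euc m)).real (shell m σ) := by
  have hhalf : (σ / 2) ^ m ≤ σ ^ m / 2 := by
    rw [div_pow]
    exact div_le_div_of_nonneg_left (by positivity) two_pos (le_self_pow₀ one_le_two (by omega))
  have hmul := mul_le_mul_of_nonneg_right hhalf
    (measureReal_nonneg (μ := (volume : Measure (Euc m))) (s := ball 0 1))
  rw [shell, measureReal_sdiff (ball_subset_ball (by linarith)) measurableSet_ball,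
    volume_real_ball_zero hσ, volume_real_ball_zero (half_pos hσ)]
  linarith

end Shell

section Interaction

variable {m n k : ℕ} {r K α σ : ℝ}

theorem GraphDatum.volume_le_measure_patch (d : GraphDatum m n k r K) (x : Euc n) {A : Set (Euc m)}
    (hAr : A ⊆ ball 0 r) (hfin : (μHE[m] : Measure (Euc n)) (d.patch x A) ≠ ⊤) :
    (volume : Measure (Euc m)).real A ≤ (μHE[m] : Measure (Euc n)).real (d.patch x A) := by
  have hcontract := euclideanHausdorffMeasure_image_le_of_edist_le (f := id)
    (g := fun u => x + d.map u) (A := A) (K := 1) m fun u hu v hv => by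
      rw [ENNReal.coe_one, one_mul, edist_dist, edist_dist, id, id]
      refine ENNReal.ofReal_le_ofReal ?_
      rw [dist_eq_norm, dist_eq_norm, add_sub_add_left_eq_sub]
      exact d.norm_sub_le_norm_map_sub (hAr hu) (hAr hv)
  rw [Set.image_id, ENNReal.coe_one, one_pow, one_mul,
    EuclideanSpace.euclideanHausdorffMeasure_eq_volume] at hcontract
  exact ENNReal.toReal_mono hfin hcontract

theorem dist_le_of_mem_patch_ball (hk : 1 ≤ k) {d₁ d₂ : GraphDatum m n k r K} (hσr : σ ≤ r)
    {x₁ x₂ y₁ y₂ : Euc n} (hx : dist x₁ x₂ ≤ 2 * σ) (h₁ : y₁ ∈ d₁.patch x₁ (ball 0 σ))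
    (h₂ : y₂ ∈ d₂.patch x₂ (ball 0 σ)) : dist y₁ y₂ ≤ 5 * σ := by
  obtain ⟨u, hu, rfl⟩ := h₁
  obtain ⟨w, hw, rfl⟩ := h₂
  have hdu := d₁.dist_add_map_le hk x₁ (ball_subset_ball hσr hu)
  have hdw := d₂.dist_add_map_le hk x₂ (ball_subset_ball hσr hw)
  rw [mem_ball_zero_iff] at hu hw
  rw [dist_comm] at hdw
  linarith [dist_triangle4 (x₁ + d₁.map u) x₁ x₂ (x₂ + d₂.map w)]

theorem le_setIntegral_dist_rpow_of_mem_patch_ball (hk : 1 ≤ k) (hα : α ≤ 0)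
    {d₁ d₂ : GraphDatum m n k r K} (hσ : 0 < σ) (hσr : σ ≤ r) {x₁ x₂ y : Euc n}
    (hx : dist x₁ x₂ ≤ 2 * σ) (hdisj : Disjoint (d₁.sheet x₁) (d₂.sheet x₂))
    (hy : y ∈ d₁.patch x₁ (ball 0 σ))
    (hfin : (μHE[m] : Measure (Euc n)) (d₂.patch x₂ (ball 0 σ)) ≠ ⊤)
    (hint : IntegrableOn (fun z => dist y z ^ α) (d₂.patch x₂ (ball 0 σ))
      (μHE[m] : Measure (Euc n))) :
    (5 * σ) ^ α * (σ ^ m * (volume : Measure (Euc m)).real (ball 0 1))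
      ≤ ∫ z in d₂.patch x₂ (ball 0 σ), dist y z ^ α ∂(μHE[m] : Measure (Euc n)) := by
  have hball : ball (0 : Euc m) σ ⊆ ball 0 r := ball_subset_ball hσr
  have hvol := d₂.volume_le_measure_patch x₂ hball hfin
  rw [volume_real_ball_zero hσ] at hvol
  refine (mul_le_mul_of_nonneg_left hvol (by positivity)).trans <|
    setIntegral_ge_of_const_le_real (d₂.measurableSet_patch x₂ measurableSet_ball hball) hfin
      (fun z hz => Real.rpow_le_rpow_of_nonpos (dist_pos.2 fun hyz => ?_)
        (dist_le_of_mem_patch_ball hk hσr hx hy hz) hα) hint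
  exact Set.disjoint_left.1 hdisj (d₁.patch_subset_sheet x₁ hball hy)
    (d₂.patch_subset_sheet x₂ hball (hyz ▸ hz))

theorem GraphDatum.le_setIntegral_patch_shell (hm : 1 ≤ m) (hα : α ≤ -2 * (m : ℝ)) (hσ : 0 < σ)
    (hσr : σ ≤ r) (hσ1 : σ ≤ 1) (d : GraphDatum m n k r K) (x : Euc n)
    (hfin : (μHE[m] : Measure (Euc n)) (d.patch x (shell m σ)) ≠ ⊤) {g : Euc n → ℝ}
    (hg : IntegrableOn g (d.patch x (shell m σ)) (μHE[m] : Measure (Euc n)))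
    (hle : ∀ y ∈ d.patch x (shell m σ),
      (5 * σ) ^ α * (σ ^ m * (volume : Measure (Euc m)).real (ball 0 1)) ≤ g y) :
    (volume : Measure (Euc m)).real (ball 0 1) ^ 2 * 5 ^ α / 2
      ≤ ∫ y in d.patch x (shell m σ), g y ∂(μHE[m] : Measure (Euc n)) := by
  set v := (volume : Measure (Euc m)).real (ball 0 1)
  have : 0 ≤ v := measureReal_nonneg
  have hshell : shell m σ ⊆ ball 0 r := shell_subset_ball hσr
  have hvol : σ ^ m * v / 2 ≤ (μHE[m] : Measure (Euc n)).real (d.patch x (shell m σ)) :=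
    (half_volume_ball_le_volume_shell hm hσ).trans (d.volume_le_measure_patch x hshell hfin)
  have hscale : 1 ≤ σ ^ α * (σ ^ m * σ ^ m) := by
    rw [← Real.rpow_natCast, ← Real.rpow_add hσ, ← Real.rpow_add hσ]
    exact Real.one_le_rpow_of_pos_of_le_one_of_nonpos hσ hσ1 (by linarith)
  calc v ^ 2 * 5 ^ α / 2 ≤ v ^ 2 * 5 ^ α / 2 * (σ ^ α * (σ ^ m * σ ^ m)) :=
        le_mul_of_one_le_right (by positivity) hscale
    _ = (5 * σ) ^ α * (σ ^ m * v) * (σ ^ m * v / 2) := by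
        rw [Real.mul_rpow (by norm_num) hσ.le]
        ring
    _ ≤ (5 * σ) ^ α * (σ ^ m * v) * (μHE[m] : Measure (Euc n)).real (d.patch x (shell m σ)) := by
        gcongr
    _ ≤ ∫ y in d.patch x (shell m σ), g y ∂(μHE[m] : Measure (Euc n)) :=
        setIntegral_ge_of_const_le_real (d.measurableSet_patch x measurableSet_shell hshell) hfin
          hle hg

/- Every dyadic scale between `r` and the distance of the two origins contributes the same amount,
because the exponent `α` is at most minus the dimension of the product of the two sheets. -/
theorem IsSheetSystem.le_setIntegral_of_close_sheets (hm : 1 ≤ m) (hk : 1 ≤ k)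
    (hα : α ≤ -2 * (m : ℝ)) (hr : 0 < r) (hr1 : r ≤ 1) {M : Set (Euc n)}
    {d : M → GraphDatum m n k r K} (h : IsSheetSystem M d) {g : Euc n → ℝ}
    (hg : IntegrableOn g M (μHE[m] : Measure (Euc n)))
    (hle : ∀ x : M, ∀ S ⊆ M, Disjoint S ((d x).sheet x) →
      ∫ y in S, dist (x : Euc n) y ^ α ∂(μHE[m] : Measure (Euc n)) ≤ g x)
    {x₁ x₂ : M} {J : ℕ} (hx : dist x₁ x₂ ≤ 2 * (r / 2 ^ J))
    (hdisj : ∀ x : M, (x : Euc n) ∈ (d x₁).sheet x₁ →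
      Disjoint ((d x₂).sheet x₂) ((d x).sheet x)) :
    J * ((volume : Measure (Euc m)).real (ball 0 1) ^ 2 * 5 ^ α / 2)
      ≤ ∫ x in M, g x ∂(μHE[m] : Measure (Euc n)) := by
  have hα0 : α ≤ 0 := hα.trans (by simp)
  have hσr : ∀ j : ℕ, r / 2 ^ j ≤ r := fun j => div_le_self hr.le (one_le_pow₀ one_le_two)
  set S : ℕ → Set (Euc n) := fun j => (d x₁).patch x₁ (shell m (r / 2 ^ j))
  have hS₁ : ∀ j, S j ⊆ (d x₁).sheet x₁ := fun j =>
    (d x₁).patch_subset_sheet x₁ (shell_subset_ball (hσr j))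
  have hSM : ∀ j, S j ⊆ M := fun j => (hS₁ j).trans (h.sheet_subset x₁)
  refine mul_le_setIntegral_of_pairwise_disjoint h.measurableSet hg
    (fun x hx => by simpa using hle ⟨x, hx⟩ ∅ (Set.empty_subset _) (Set.empty_disjoint _))
    (fun j => (d x₁).measurableSet_patch x₁ measurableSet_shell (shell_subset_ball (hσr j)))
    (fun i j hij => (pairwise_disjoint_shell hr.le hij).image ((d x₁).injOn_add_map x₁)
      (shell_subset_ball (hσr i)) (shell_subset_ball (hσr j))) hSM fun j hj => ?_
  refine (d x₁).le_setIntegral_patch_shell hm hα (by positivity) (hσr j) ((hσr j).trans hr1) x₁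
    (measure_ne_top_of_subset (hSM j) h.measure_ne_top) (hg.mono_set (hSM j)) fun y hy => ?_
  set T := (d x₂).patch x₂ (ball 0 (r / 2 ^ j))
  have hball : ball (0 : Euc m) (r / 2 ^ j) ⊆ ball 0 r := ball_subset_ball (hσr j)
  have hT₂ : T ⊆ (d x₂).sheet x₂ := (d x₂).patch_subset_sheet x₂ hball
  have hTM : T ⊆ M := hT₂.trans (h.sheet_subset x₂)
  have hyT : Disjoint T ((d ⟨y, hSM j hy⟩).sheet y) :=
    (hdisj ⟨y, hSM j hy⟩ (hS₁ j hy)).mono_left hT₂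
  have hJ : r / 2 ^ J ≤ r / 2 ^ j := by
    gcongr
    exact one_le_two
  exact (le_setIntegral_dist_rpow_of_mem_patch_ball hk hα0 (by positivity) (hσr j)
    (hx.trans (by linarith)) (hdisj x₁ ((d x₁).self_mem_sheet hr x₁)).symm
    (Set.image_mono Set.sdiff_subset hy) (measure_ne_top_of_subset hTM h.measure_ne_top)
    (h.integrableOn_dist_rpow hα0 ⟨y, hSM j hy⟩ hTM
      ((d x₂).measurableSet_patch x₂ measurableSet_ball hball) hyT)).trans
    (hle ⟨y, hSM j hy⟩ T hTM hyT)

end Interaction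

/-! ### The energy of a nearly self-touching submanifold -/

theorem RieszEnergyDefined.setIntegral_potential_add_le {m n : ℕ} {α V : ℝ} {M : Set (Euc n)}
    (h : RieszEnergyDefined m α M) (hV : 0 ≤ V)
    (hMV : (μHE[m] : Measure (Euc n)) M ≤ ENNReal.ofReal V) (C : ℝ) :
    ∫ x in M, (potential m α M x + C) ∂(μHE[m] : Measure (Euc n))
      ≤ rieszEnergy m α M + V * |C| := by
  have hconst : IntegrableOn (fun _ : Euc n => C) M (μHE[m] : Measure (Euc n)) :=
    integrableOn_const (ne_top_of_le_ne_top ENNReal.ofReal_ne_top hMV)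
  rw [integral_add h.integrableOn_potential hconst, setIntegral_const, smul_eq_mul, rieszEnergy,
    add_le_add_iff_left]
  exact (mul_le_mul_of_nonneg_left (le_abs_self C) measureReal_nonneg).trans
    (mul_le_mul_of_nonneg_right (ENNReal.toReal_le_of_le_ofReal hV hMV) (abs_nonneg C))

theorem IsSheetSystem.exists_lt_rieszEnergy_of_close_sheets {m n k : ℕ} {r K α : ℝ} (hm : 1 ≤ m)
    (hk : alphaBar m α + 2 ≤ k) (hα : α ≤ -2 * (m : ℝ)) (hr : 0 < r) (hr1 : r ≤ 1) {V : ℝ}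
    (hV : 0 ≤ V) (C : ℝ) :
    ∃ δ ∈ Set.Ioc 0 r, ∀ {M : Set (Euc n)} {d : M → GraphDatum m n k r K}, IsSheetSystem M d →
      (μHE[m] : Measure (Euc n)) M ≤ ENNReal.ofReal V → RieszEnergyDefined m α M ∧
        ∀ x₁ x₂ : M, dist x₁ x₂ ≤ 2 * δ →
          (∀ x : M, (x : Euc n) ∈ (d x₁).sheet x₁ →
            Disjoint ((d x₂).sheet x₂) ((d x).sheet x)) →
          C < rieszEnergy m α M := by
  obtain ⟨C₀, hC₀⟩ := exists_setIntegral_le_potential_add (n := n) (K := K) hm hr hk hα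
  set c : ℝ := (volume : Measure (Euc m)).real (ball 0 1) ^ 2 * 5 ^ α / 2
  have hc : 0 < c := by
    have : 0 < (volume : Measure (Euc m)).real (ball 0 1) :=
      ENNReal.toReal_pos (measure_ball_pos _ _ one_pos).ne' measure_ball_lt_top.ne
    positivity
  obtain ⟨J, hJ⟩ := exists_nat_gt ((C + V * |C₀|) / c)
  rw [div_lt_iff₀ hc] at hJ
  refine ⟨r / 2 ^ J, ⟨by positivity, div_le_self hr.le (one_le_pow₀ one_le_two)⟩,
    fun {M d} h hMV => ?_⟩
  obtain ⟨hdef, hpot⟩ := hC₀ h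
  refine ⟨hdef, fun x₁ x₂ hx hdisj => ?_⟩
  have hlow : J * c ≤ ∫ x in M, (potential m α M x + C₀) ∂(μHE[m] : Measure (Euc n)) :=
    h.le_setIntegral_of_close_sheets hm (by omega) hα hr hr1
      (hdef.integrableOn_potential.add (integrableOn_const h.measure_ne_top)) hpot hx hdisj
  linarith [hdef.setIntegral_potential_add_le hV hMV C₀]

theorem exists_sheet_radius {m : ℕ} (hm : 1 ≤ m) {ε₀ b : ℝ} (hε₀ : 0 < ε₀) (hb : 0 < b) :
    ∃ r : ℝ, 0 < r ∧ r ≤ ε₀ / (1 + m * b) ∧ (m : ℝ) ^ 2 * b * r ≤ 1 / 2 ∧ r ≤ 1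
      ∧ 5 * r ≤ ε₀ := by
  refine ⟨min (min (ε₀ / (1 + m * b)) (1 / 2 / ((m : ℝ) ^ 2 * b))) (min 1 (ε₀ / 5)),
    by positivity, (min_le_left _ _).trans (min_le_left _ _), ?_,
    (min_le_right _ _).trans (min_le_left _ _), ?_⟩
  · rw [mul_comm, ← le_div_iff₀ (by positivity)]
    exact (min_le_left _ _).trans (min_le_right _ _)
  · rw [mul_comm, ← le_div_iff₀ (by positivity)]
    exact (min_le_right _ _).trans (min_le_right _ _)

end

end RieszRepulsion

open RieszRepulsion in
theorem theorem1_general {m n : ℕ} (hm : 1 ≤ m) {α : ℝ} (hα : α ≤ -2 * (m : ℝ)) {ε₀ b V : ℝ}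
    (hε₀ : 0 < ε₀) (hb : 0 < b) (hV : 0 < V) (C : ℝ) :
    ∃ δ : ℝ, 0 < δ ∧ ∀ (N : Type*) [TopologicalSpace N] [ChartedSpace (Euc m) N] [CompactSpace N]
      (ι f : N → Euc n), IsImm (m := m) (alphaBar m α + 3) ι → Function.Injective ι →
        Set.range ι ∈ BoundedGeometry m n (alphaBar m α + 3) ε₀ b V →
        (∀ p : N, dist (f p) (ι p) < δ) →
        ∀ p q : N, f p = f q → q ∉ connectedComponentIn (f ⁻¹' ball (f p) ε₀) p →
          RieszEnergyDefined m α (Set.range ι) ∧ C < rieszEnergy m α (Set.range ι) := by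
  obtain ⟨r, hr, hrε, hrb, hr1, hr5⟩ := exists_sheet_radius hm hε₀ hb
  obtain ⟨δ, ⟨hδ, hδr⟩, henergy⟩ := IsSheetSystem.exists_lt_rieszEnergy_of_close_sheets (n := n)
    (K := ∑ j ∈ Finset.range (alphaBar m α + 3 + 1), (m : ℝ) ^ j * b) hm
    (show alphaBar m α + 2 ≤ alphaBar m α + 3 by omega) hα hr hr1 hV.le C
  refine ⟨δ, hδ, fun N _ _ _ ι f hι hinj hM hf p q hpq hsep => ?_⟩
  obtain ⟨d, hd⟩ := exists_isSheetSystem (by omega) hε₀ hb.le hr hrε hrb hι hinj hM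
  obtain ⟨hdef, hlt⟩ := henergy hd hM.1
  refine ⟨hdef, hlt ⟨ι p, p, rfl⟩ ⟨ι q, q, rfl⟩ ?_ fun x hx => ?_⟩
  · have hp : dist (ι p) (f p) < δ := dist_comm (f p) (ι p) ▸ hf p
    rw [Subtype.dist_eq]
    linarith [dist_triangle (ι p) (f p) (ι q), hpq ▸ hf q]
  · exact GraphDatum.disjoint_sheet_of_notMem_connectedComponentIn hι.1.continuous hinj hr
      (by omega) (by linarith) hf hpq hsep (hd.sheet_subset _) (hd.sheet_subset _)
      (hd.sheet_subset x) hx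

open RieszRepulsion in
/-- `M = range ι` is the embedded closed submanifold, `f` (read on the parametrizing manifold `N`)
is the immersion `M → M'`, and `M' = range f`. -/
theorem theorem1 (m n : ℕ) (hm : 1 ≤ m) (α : ℝ) (hα : α ≤ -2 * (m : ℝ))
    (ε₀ b V : ℝ) (hε₀ : 0 < ε₀) (hb : 0 < b) (hV : 0 < V) (C : ℝ) (hC : 0 < C) :
    ∃ δ : ℝ, 0 < δ ∧
      ∀ (N : Type*) [TopologicalSpace N] [ChartedSpace (Euc m) N]
        [IsManifold (𝓡 m) (alphaBar m α + 3 : ℕ) N] [CompactSpace N] [T2Space N]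
        (ι f : N → Euc n),
        IsImm (m := m) (alphaBar m α + 3) ι → Function.Injective ι →
        Set.range ι ∈ BoundedGeometry m n (alphaBar m α + 3) ε₀ b V →
        IsImm (m := m) (alphaBar m α + 3) f →
        Set.range f ∈ BoundedGeometry m n (alphaBar m α + 3) ε₀ b V →
        (∀ p : N, dist (f p) (ι p) < δ) →
        ∀ x' : Euc n, (∃ p₁ p₂ : N, p₁ ≠ p₂ ∧ f p₁ = x' ∧ f p₂ = x') →
        (∃ (l : ℕ) (W : Fin l → Set N), 2 ≤ l ∧ IsSheets m (alphaBar m α + 3) f x' ε₀ W) →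
        RieszEnergyDefined m α (Set.range ι) ∧ C < rieszEnergy m α (Set.range ι) := by
  obtain ⟨δ, hδ, h⟩ := theorem1_general (n := n) hm hα hε₀ hb hV C
  refine ⟨δ, hδ, fun N _ _ _ _ _ ι f hι hinj hM _ _ hf x' => ?_⟩
  rintro ⟨p, q, hne, rfl, hq⟩ ⟨l, W, -, hW⟩
  exact h N ι f hι hinj hM hf p q hq.symm
    (hW.notMem_connectedComponentIn (mem_ball_self hε₀) hq.symm hne)
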